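/- Let $\mathbb F$ be a field of characteristic $0$, and let $A$ be a differential algebra over $\mathbb F$: a commutative associative unital $\mathbb F$-algebra with an $\mathbb F$-linear derivation $\partial$. Let $A[\partial]$ be the algebra of differential operators; for $a(\partial)=\sum_j a_j\partial^j\in A[\partial]$ the symbol of the adjoint operator is $a^*(\lambda)=\sum_j(-\lambda-\partial)^j(a_j)\in A[\lambda]$. The notation $|_{x=\partial}$ means: expand in powers of $x$, replace $x$ by $\partial$, and let $\partial$ act on the element (in parentheses) to its right; e.g. for $c\in A$ and $P(\lambda)\in M[\lambda]$, $(|_{x=\partial}c)P(\lambda+x)=\sum_n(\partial^nc)P_n(\lambda)$ if $P(\lambda+x)=\sum_nx^nP_n(\lambda)$. A *conformal derivation* of $A$ is an $\mathbb F$-linear map $\phi_\lambda:A\to A[\lambda]$ with $\phi_\lambda(a(\partial)b)=(|_{x=\partial}b)\phi_\lambda(a(x))+a(\lambda+x)(|_{x=\partial}\phi_\lambda(b))$; these form a left $A[\partial]$-module $\mathrm{CDer}(A)$ under $(a(\partial)\phi)_\lambda=(|_{x=\partial}a^*(\lambda))\phi_{\lambda+x}$. A *Lie conformal algebroid (LCAd)*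 over $A$ is a left $A[\partial]$-module $E$ with an $A[\partial]$-module homomorphism $\theta:E\to\mathrm{CDer}(A)$ and an $\mathbb F$-bilinear $\lambda$-bracket $[\cdot_\lambda\cdot]:E\times E\to E[\lambda]$ satisfying $[\partial u_\lambda v]=-\lambda[u_\lambda v]$, $[u_\lambda\partial v]=(\lambda+\partial)[u_\lambda v]$, $[v_\lambda u]=-(|_{x=\partial}[u_{-\lambda-x}v])$, $[u_\lambda[v_\mu w]]-[v_\mu[u_\lambda w]]=[[u_\lambda v]_{\lambda+\mu}w]$, and, for $u,v,w\in E$, $a(\partial)\in A[\partial]$, $b\in A$, $$[u_\lambda a(\partial)v]=a(\lambda+x)(|_{x=\partial}[u_\lambda v])+\theta(u)_\lambda(a(x))(|_{x=\partial}v),\qquad \theta([u_\lambda v])_\mu(b)=\theta(u)_\lambda(\theta(v)_{\mu-\lambda}(b))-\theta(v)_{\mu-\lambda}(\theta(u)_\lambda(b)).$$ A *module* over $E$ is a left $A[\partial]$-module $M$ with an $\mathbb F$-bilinear map $E\times M\to M[\lambda]$, $(u,m)\mapsto u_\lambda m$, such that $$u_\lambda(a(\partial)m)=a(\lambda+x)(|_{x=\partial}u_\lambda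 m)+\theta(u)_\lambda(a(x))(|_{x=\partial}m),\quad (a(\partial)u)_\lambda m=(|_{x=\partial}a^*(\lambda))(u_{\lambda+x}m),\quad [u_\lambda v]_\mu m=u_\lambda(v_{\mu-\lambda}m)-v_{\mu-\lambda}(u_\lambda m).$$ For $k\ge0$ let $C^k(E,M)$ be the vector space of $\mathbb F$-linear maps $\varphi_{\lambda_1,\dots,\lambda_k}:E^{\otimes k}\to M[\lambda_1,\dots,\lambda_k]/\langle\partial+\lambda_1+\dots+\lambda_k\rangle$ (the quotient by the image of the operator $\partial+\lambda_1+\dots+\lambda_k$) such that, for all $a_i(\partial)\in A[\partial]$, $u_i\in E$ and $\pi\in S_k$, $$\varphi_{\lambda_1,\dots,\lambda_k}(a_1(\partial)u_1,\dots,a_k(\partial)u_k)=(|_{x_1=\partial}a_1^*(\lambda_1))\cdots(|_{x_k=\partial}a_k^*(\lambda_k))\,\varphi_{\lambda_1+x_1,\dots,\lambda_k+x_k}(u_1,\dots,u_k),$$ $$\varphi_{\lambda_1,\dots,\lambda_k}(u_1,\dots,u_k)=\mathrm{sign}(\pi)\,\varphi_{\lambda_{\pi(1)},\dots,\lambda_{\pi(k)}}(u_{\pi(1)},\dots,u_{\pi(k)}).$$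 **Proposition.** Let $E$ be an LCAd over $A$ and $M$ a module over $E$. For every $k\ge0$ there is a unique linear map $d:C^k(E,M)\to C^{k+1}(E,M)$ given by $$(d\varphi)_{\lambda_1,\dots,\lambda_{k+1}}(u_1,\dots,u_{k+1})=\sum_{i=1}^{k+1}(-1)^{i+1}{u_i}_{\lambda_i}\big(\varphi_{\lambda_1,\dots,\check{\lambda_i},\dots,\lambda_{k+1}}(u_1,\dots,\check{u_i},\dots,u_{k+1})\big)$$ $$\qquad+\sum_{1\le i<j\le k+1}(-1)^{i+j}\varphi_{\lambda_i+\lambda_j,\lambda_1,\dots,\check{\lambda_i},\dots,\check{\lambda_j},\dots,\lambda_{k+1}}\big([{u_i}_{\lambda_i}u_j],u_1,\dots,\check{u_i},\dots,\check{u_j},\dots,u_{k+1}\big),$$ where the right-hand side is evaluated on any $\mathbb F$-linear lift $E^{\otimes k}\to M[\lambda_1,\dots,\lambda_k]$ of $\varphi$ and then taken modulo $\partial+\lambda_1+\dots+\lambda_{k+1}$, and does not depend on the lift. In particular, $d\varphi$ again satisfies the two conditions defining cochains. Moreover $d\circ d=0$. (The resulting complex $(C^\bullet(E,M),d)$ is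 by definition the LCAd cohomology complex of $E$ with coefficients in $M$.) -/

import Mathlib

open scoped TensorProduct

noncomputable section

namespace LCAd

/-! ## Differential algebras and their modules -/

/-- A differential algebra over `F`: a commutative unital algebra `A` with a derivation. -/
class DiffAlgebra (F A : Type*) [Field F] [CommRing A] [Algebra F A] where
  der : Derivation F A A

/-- A left module over the algebra `A[∂]` of differential operators (in which `∂ a = a ∂ + a'`):
an `A`-module with an `F`-linear `∂` obeying the Leibniz rule. -/
class DiffModule (F A M : Type*) [Field F] [CommRing A] [Algebra F A] [DiffAlgebra F A]
    [AddCommGroup M] [Module F M] [Module A M] where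
  del : M →ₗ[F] M
  del_smul : ∀ (a : A) (m : M), del (a • m) = DiffAlgebra.der (F := F) a • m + a • del m

/-- `A` as a left module over `A[∂]`. -/
instance selfDiffModule (F A : Type*) [Field F] [CommRing A] [Algebra F A] [DiffAlgebra F A] :
    DiffModule F A A where
  del := (DiffAlgebra.der (F := F) (A := A)).toLinearMap
  del_smul a m := by
    simp [smul_eq_mul, mul_comm, add_comm]

/-- The action of `∂` on a left `A[∂]`-module. -/
abbrev del (F A : Type*) {M : Type*} [Field F] [CommRing A] [Algebra F A] [DiffAlgebra F A]
    [AddCommGroup M] [Module F M] [Module A M] [DiffModule F A M] : M →ₗ[F] M :=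
  DiffModule.del (A := A)

section Operators

variable (F : Type*) [Field F] {A : Type*} [CommRing A] [Algebra F A] [DiffAlgebra F A]
variable {M : Type*} [AddCommGroup M] [Module F M] [Module A M] [IsScalarTower F A M]
  [DiffModule F A M]
variable {N : Type*} [AddCommGroup N] [Module F N]
variable {R : Type*} [CommRing R] [Algebra F R] {S : Type*} [CommRing S] [Algebra F S]

/-- A differential operator `a(∂) = ∑ aᵢ ∂ⁱ` is recorded by its symbol, a polynomial over `A`;
this is its action `a(∂) m = ∑ aᵢ ∂ⁱ m`. -/
def diffOp (a : Polynomial A) (m : M) : M :=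
  a.sum fun i c => c • ((del F A : M →ₗ[F] M) ^ i) m

/-! ## Polynomials with coefficients in a module

`M[λ]` is `F[λ] ⊗ M`, and `M[λ₁, …, λₖ]` is `F[λ₁, …, λₖ] ⊗ M`. Below `R` and `S` stand for
polynomial algebras over `F`. -/

/-- Multiplication by `ℓ ∈ R` on `R ⊗ N`. -/
def lamMul (ℓ : R) : Module.End F (R ⊗[F] N) := Algebra.lsmul F F (R ⊗[F] N) ℓ

/-- `c ∈ A` acting on the coefficients. -/
def coefMul (c : A) : Module.End F (R ⊗[F] M) := (Algebra.lsmul F F M c).lTensor R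

variable (A) in
/-- `∂` acting on the coefficients. -/
def coefDel : Module.End F (R ⊗[F] M) := (del F A : M →ₗ[F] M).lTensor R

variable (A) in
/-- The operator `ℓ + ∂`, with `∂` acting on the coefficients. -/
def lamDel (ℓ : R) : Module.End F (R ⊗[F] M) := lamMul F ℓ + coefDel F A

/-- The product `c(λ) m`, for `c(λ)` with coefficients in `A` and `m ∈ M`. -/
def coefSmul (m : M) : R ⊗[F] A →ₗ[F] R ⊗[F] M :=
  ((LinearMap.toSpanSingleton A M m).restrictScalars F).lTensor R

/-- `a(ℓ + ∂) P = ∑ aᵢ (ℓ + ∂)ⁱ P`, with `∂` acting on the coefficients of `P`. -/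
def diffOpShift (ℓ : R) (a : Polynomial A) (P : R ⊗[F] M) : R ⊗[F] M :=
  a.sum fun i c => coefMul F c ((lamDel F A ℓ ^ i) P)

/-- The map `p ⊗ m ↦ s(p) g(m)`: change the variables by `s` and apply `g` to coefficients. -/
def extCoef (s : S →ₐ[F] R) (g : N →ₗ[F] R ⊗[F] M) : S ⊗[F] N →ₗ[F] R ⊗[F] M :=
  TensorProduct.lift <| LinearMap.mk₂ F (fun p m => s p • g m)
    (fun p q m => by rw [map_add, add_smul])
    (fun c p m => by rw [map_smul, smul_assoc])
    (fun p m n => by rw [map_add, smul_add])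
    (fun c p m => by rw [map_smul, smul_comm])

/-- The change of variables `s` on `S ⊗ N`. -/
def substVar (s : S →ₐ[F] R) : S ⊗[F] N →ₗ[F] R ⊗[F] N := s.toLinearMap.rTensor N

/-- For `f : N → M[λ]`, `m ↦ f_λ(m)`, the map `P ↦ f_ℓ(P)`: substitute `λ = ℓ` and
extend `R`-linearly to polynomials `P` with coefficients in `N`. -/
def applyAt (ℓ : R) (f : N →ₗ[F] Polynomial F ⊗[F] M) : R ⊗[F] N →ₗ[F] R ⊗[F] M :=
  extCoef F (AlgHom.id F R) (substVar F (Polynomial.aeval ℓ) ∘ₗ f)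

/-- Constant polynomials. -/
def const (R : Type*) [CommRing R] [Algebra F R] (m : N) : R ⊗[F] N := 1 ⊗ₜ[F] m

variable (A) in
/-- `|_{x=∂} P(-λ-x) = ∑ (-λ-∂)ⁿ mₙ` for `P(λ) = ∑ λⁿ mₙ`. -/
def reflect : Polynomial F ⊗[F] M →ₗ[F] Polynomial F ⊗[F] M :=
  TensorProduct.lift <| LinearMap.mk₂ F
    (fun p m => Polynomial.aeval
      (-(lamDel F A Polynomial.X : Module.End F (Polynomial F ⊗[F] M))) p
      (const F (Polynomial F) m))
    (fun p q m => by rw [map_add, LinearMap.add_apply])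
    (fun c p m => by rw [map_smul, LinearMap.smul_apply])
    (fun p m n => by rw [const, TensorProduct.tmul_add, map_add]; rfl)
    (fun c p m => by rw [const, TensorProduct.tmul_smul, map_smul]; rfl)

/-- For `Q = ∑ xⁿ qₙ ∈ R[x]`, `a ∈ A`, `m ∈ M`: the element `∑ qₙ (∂ⁿ a) m`. -/
def expandMul (a : A) : Polynomial R →ₗ[F] M →ₗ[F] R ⊗[F] M :=
  Polynomial.lsum fun n => (TensorProduct.mk F R M).compl₂
    (Algebra.lsmul F F M (((DiffAlgebra.der (F := F) (A := A)).toLinearMap ^ n) a))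

/-- `(|_{x=∂} a) P(λ+x)`, where `s : R → R[x]` is the substitution `λ ↦ λ + x`: expand `P(λ+x)`
in powers of `x` and replace `xⁿ` by `∂ⁿ a`. -/
def shiftMul (s : R →ₐ[F] Polynomial R) (a : A) : Module.End F (R ⊗[F] M) :=
  TensorProduct.lift (expandMul F a ∘ₗ s.toLinearMap)

/-- `(|_{x=∂} a^*(ℓ)) P(ℓ+x)`, where `s` is the substitution `ℓ ↦ ℓ + x`. As
`a^*(ℓ) = ∑ (-ℓ-∂)ʲ aⱼ`, this is `∑ (|_{x=∂} aⱼ) (-ℓ-x)ʲ P(ℓ+x)`. -/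
def adjMul (s : R →ₐ[F] Polynomial R) (ℓ : R) (a : Polynomial A) : Module.End F (R ⊗[F] M) :=
  a.sum fun j c => shiftMul F s c * lamMul F ((-ℓ) ^ j)

/-- `λ ↦ λ + x` in one variable. -/
def shiftOne : Polynomial F →ₐ[F] Polynomial (Polynomial F) :=
  Polynomial.aeval (Polynomial.C Polynomial.X + Polynomial.X)

/-- `λᵢ ↦ λᵢ + x`, the other variables being fixed. -/
def shiftVar {k : ℕ} (i : Fin k) :
    MvPolynomial (Fin k) F →ₐ[F] Polynomial (MvPolynomial (Fin k) F) :=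
  MvPolynomial.aeval fun j =>
    Polynomial.C (MvPolynomial.X j) + if j = i then Polynomial.X else 0

end Operators

/-! ## Lie conformal algebroids and their modules -/

/-- The axioms of a Lie conformal algebra for a `λ`-bracket `br u v = [u_λ v]`. -/
structure IsLieConformalAlgebra (F A : Type*) {E : Type*} [Field F] [CommRing A] [Algebra F A]
    [DiffAlgebra F A] [AddCommGroup E] [Module F E] [Module A E] [IsScalarTower F A E]
    [DiffModule F A E] (br : E →ₗ[F] E →ₗ[F] Polynomial F ⊗[F] E) : Prop where
  /-- `[∂u_λ v] = -λ [u_λ v]` -/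
  sesq_left : ∀ u v : E, br (del F A u) v = -lamMul F Polynomial.X (br u v)
  /-- `[u_λ ∂v] = (λ + ∂) [u_λ v]` -/
  sesq_right : ∀ u v : E,
    br u (del F A v) = lamDel F A Polynomial.X (br u v)
  /-- `[v_λ u] = -(|_{x=∂} [u_{-λ-x} v])` -/
  skew : ∀ u v : E, br v u = -reflect F A (br u v)
  /-- `[u_λ [v_μ w]] - [v_μ [u_λ w]] = [[u_λ v]_{λ+μ} w]`, with `λ = X 0` and `μ = X 1` -/
  jacobi : ∀ u v w : E,
    applyAt F (MvPolynomial.X 0) (br u) (applyAt F (MvPolynomial.X 1) (br v)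
        (const F (MvPolynomial (Fin 2) F) w))
      - applyAt F (MvPolynomial.X 1) (br v) (applyAt F (MvPolynomial.X 0) (br u)
        (const F (MvPolynomial (Fin 2) F) w))
      = applyAt F (MvPolynomial.X 0 + MvPolynomial.X 1) (br.flip w)
        (applyAt F (MvPolynomial.X 0) (br u) (const F (MvPolynomial (Fin 2) F) v))

/-- Conformal derivations of `A`: linear maps `φ_λ : A → A[λ]` such that
`φ_λ(a(∂)b) = (|_{x=∂} b) φ_λ(a(x)) + a(λ+x) (|_{x=∂} φ_λ(b))`. -/
def IsConformalDerivation (F : Type*) {A : Type*} [Field F] [CommRing A] [Algebra F A]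
    [DiffAlgebra F A] (φ : A →ₗ[F] Polynomial F ⊗[F] A) : Prop :=
  ∀ (a : Polynomial A) (b : A),
    φ (diffOp F a b) =
      (a.sum fun i c => coefMul F (((del F A : A →ₗ[F] A) ^ i) b) (φ c))
        + diffOpShift F Polynomial.X a (φ b)

/-- A Lie conformal algebroid `E` over the differential algebra `A`: a left `A[∂]`-module with
an anchor `θ : E → CDer(A)` and a `λ`-bracket `bracket u v = [u_λ v]`. -/
class LieConformalAlgebroid (F A E : Type*) [Field F] [CommRing A] [Algebra F A]
    [DiffAlgebra F A] [AddCommGroup E] [Module F E] [Module A E] [IsScalarTower F A E]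
    [DiffModule F A E] where
  bracket : E →ₗ[F] E →ₗ[F] Polynomial F ⊗[F] E
  lca : IsLieConformalAlgebra F A bracket
  /-- `anchor u a = θ(u)_λ(a)` -/
  anchor : E →ₗ[F] A →ₗ[F] Polynomial F ⊗[F] A
  anchor_der : ∀ u : E, IsConformalDerivation F (anchor u)
  /-- `θ(a(∂)u)_λ = (|_{x=∂} a^*(λ)) θ(u)_{λ+x}` -/
  anchor_diffOp : ∀ (a : Polynomial A) (u : E) (b : A),
    anchor (diffOp F a u) b = adjMul F (shiftOne F) Polynomial.X a (anchor u b)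
  /-- `[u_λ a(∂)v] = a(λ+x) (|_{x=∂} [u_λ v]) + θ(u)_λ(a(x)) (|_{x=∂} v)` -/
  bracket_diffOp : ∀ (u : E) (a : Polynomial A) (v : E),
    bracket u (diffOp F a v) =
      diffOpShift F Polynomial.X a (bracket u v)
        + a.sum fun i c => coefSmul F (((del F A : E →ₗ[F] E) ^ i) v) (anchor u c)
  /-- `θ([u_λ v])_μ(a) = θ(u)_λ(θ(v)_{μ-λ}(a)) - θ(v)_{μ-λ}(θ(u)_λ(a))`,
  with `λ = X 0` and `μ = X 1` -/
  anchor_bracket : ∀ (u v : E) (a : A),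
    applyAt F (MvPolynomial.X 1) (anchor.flip a) (applyAt F (MvPolynomial.X 0) (bracket u)
        (const F (MvPolynomial (Fin 2) F) v))
      = applyAt F (MvPolynomial.X 0) (anchor u)
          (applyAt F (MvPolynomial.X 1 - MvPolynomial.X 0) (anchor v)
            (const F (MvPolynomial (Fin 2) F) a))
        - applyAt F (MvPolynomial.X 1 - MvPolynomial.X 0) (anchor v)
          (applyAt F (MvPolynomial.X 0) (anchor u) (const F (MvPolynomial (Fin 2) F) a))

/-- A module over the Lie conformal algebroid `E`: a left `A[∂]`-module with a `λ`-action
`action u m = u_λ m`. -/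
class LCAdModule (F A E M : Type*) [Field F] [CommRing A] [Algebra F A]
    [DiffAlgebra F A] [AddCommGroup E] [Module F E] [Module A E] [IsScalarTower F A E]
    [DiffModule F A E] [LieConformalAlgebroid F A E]
    [AddCommGroup M] [Module F M] [Module A M] [IsScalarTower F A M] [DiffModule F A M] where
  action : E →ₗ[F] M →ₗ[F] Polynomial F ⊗[F] M
  /-- `u_λ(a(∂)m) = a(λ+x) (|_{x=∂} u_λ m) + θ(u)_λ(a(x)) (|_{x=∂} m)` -/
  action_diffOp : ∀ (u : E) (a : Polynomial A) (m : M),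
    action u (diffOp F a m) =
      diffOpShift F Polynomial.X a (action u m)
        + a.sum fun i c => coefSmul F (((del F A : M →ₗ[F] M) ^ i) m)
            (LieConformalAlgebroid.anchor u c)
  /-- `(a(∂)u)_λ m = (|_{x=∂} a^*(λ)) (u_{λ+x} m)` -/
  diffOp_action : ∀ (a : Polynomial A) (u : E) (m : M),
    action (diffOp F a u) m = adjMul F (shiftOne F) Polynomial.X a (action u m)
  /-- `[u_λ v]_μ(m) = u_λ(v_{μ-λ} m) - v_{μ-λ}(u_λ m)`, with `λ = X 0` and `μ = X 1` -/
  bracket_action : ∀ (u v : E) (m : M),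
    applyAt F (MvPolynomial.X 1) (action.flip m)
        (applyAt F (MvPolynomial.X 0) (LieConformalAlgebroid.bracket A u)
          (const F (MvPolynomial (Fin 2) F) v))
      = applyAt F (MvPolynomial.X 0) (action u)
          (applyAt F (MvPolynomial.X 1 - MvPolynomial.X 0) (action v)
            (const F (MvPolynomial (Fin 2) F) m))
        - applyAt F (MvPolynomial.X 1 - MvPolynomial.X 0) (action v)
          (applyAt F (MvPolynomial.X 0) (action u) (const F (MvPolynomial (Fin 2) F) m))

/-! ## Cochains -/

section Cochains

variable (F A M : Type*) [Field F] [CommRing A] [Algebra F A] [DiffAlgebra F A]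
  [AddCommGroup M] [Module F M] [Module A M] [IsScalarTower F A M] [DiffModule F A M]

/-- `M[λ₁, …, λₖ]` -/
abbrev PolyMod (F M : Type*) [Field F] [AddCommGroup M] [Module F M] (k : ℕ) : Type _ :=
  MvPolynomial (Fin k) F ⊗[F] M

/-- The operator `∂ + λ₁ + ⋯ + λₖ` on `M[λ₁, …, λₖ]`. -/
def totalDel (k : ℕ) : Module.End F (PolyMod F M k) :=
  lamDel F A (∑ i : Fin k, MvPolynomial.X i)

/-- `M[λ₁, …, λₖ] / ⟨∂ + λ₁ + ⋯ + λₖ⟩` -/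
abbrev QuotMod (k : ℕ) : Type _ := PolyMod F M k ⧸ LinearMap.range (totalDel F A M k)

/-- The quotient map. -/
abbrev toQuot (k : ℕ) : PolyMod F M k →ₗ[F] QuotMod F A M k :=
  (LinearMap.range (totalDel F A M k)).mkQ

variable {F A M}

theorem range_le_comap {k l : ℕ} (f : PolyMod F M k →ₗ[F] PolyMod F M l)
    (h : f ∘ₗ totalDel F A M k = totalDel F A M l ∘ₗ f) :
    LinearMap.range (totalDel F A M k) ≤ (LinearMap.range (totalDel F A M l)).comap f := by
  rintro _ ⟨P, rfl⟩
  exact ⟨f P, (LinearMap.congr_fun h P).symm⟩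

theorem totalDel_tmul {k : ℕ} (p : MvPolynomial (Fin k) F) (m : M) :
    totalDel F A M k (p ⊗ₜ[F] m) =
      p ⊗ₜ[F] del F A m + ((∑ i : Fin k, MvPolynomial.X i) * p) ⊗ₜ[F] m := by
  simp only [totalDel, lamDel, coefDel, lamMul, LinearMap.add_apply, Algebra.lsmul_coe,
    LinearMap.lTensor_tmul, TensorProduct.smul_tmul', smul_eq_mul]
  rw [add_comm]

theorem expandMul_comm {k : ℕ} (a : A) (Q : Polynomial (MvPolynomial (Fin k) F)) (m : M) :
    totalDel F A M k (expandMul F a Q m) =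
      expandMul F a Q (del F A m)
        + expandMul F a
          ((Polynomial.C (∑ i : Fin k, MvPolynomial.X i) + Polynomial.X) * Q) m := by
  induction Q using Polynomial.induction_on' with
  | add p q hp hq =>
    simp only [map_add, LinearMap.add_apply, hp, hq, mul_add]
    abel
  | monomial n c =>
    have key : ∀ (j : ℕ) (q : MvPolynomial (Fin k) F) (x : M),
        expandMul F a (Polynomial.monomial j q) x =
          q ⊗ₜ[F] ((((DiffAlgebra.der (F := F) (A := A)).toLinearMap ^ j) a) • x) := by
      intro j q x
      simp [expandMul, Polynomial.lsum, Polynomial.sum_monomial_index]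
    rw [add_mul, Polynomial.C_mul_monomial, Polynomial.X_mul_monomial, map_add,
      LinearMap.add_apply, key, key, key, key, totalDel_tmul, DiffModule.del_smul,
      TensorProduct.tmul_add, pow_succ', Module.End.mul_apply]
    simp only [Derivation.coeFn_coe]
    abel

theorem shiftVar_sum {k : ℕ} (i : Fin k) :
    shiftVar F i (∑ j : Fin k, MvPolynomial.X j)
      = Polynomial.C (∑ j : Fin k, MvPolynomial.X j) + Polynomial.X := by
  simp [shiftVar, Finset.sum_add_distrib]

theorem shiftMul_comm {k : ℕ} (i : Fin k) (a : A) :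
    shiftMul F (shiftVar F i) a ∘ₗ totalDel F A M k
      = totalDel F A M k ∘ₗ shiftMul F (shiftVar F i) a := by
  refine TensorProduct.ext' fun p m => ?_
  rw [LinearMap.comp_apply, LinearMap.comp_apply, totalDel_tmul, map_add]
  simp only [shiftMul, TensorProduct.lift.tmul, LinearMap.comp_apply, AlgHom.toLinearMap_apply]
  rw [expandMul_comm, map_mul, shiftVar_sum]

theorem lamMul_comm {k : ℕ} (q : MvPolynomial (Fin k) F) :
    lamMul F q ∘ₗ totalDel F A M k = totalDel F A M k ∘ₗ lamMul F q := by
  refine TensorProduct.ext' fun p m => ?_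
  rw [LinearMap.comp_apply, LinearMap.comp_apply, totalDel_tmul]
  simp only [lamMul, Algebra.lsmul_coe, smul_add, TensorProduct.smul_tmul', smul_eq_mul,
    totalDel_tmul]
  rw [mul_left_comm]

theorem adjMul_comm {k : ℕ} (i : Fin k) (a : Polynomial A) :
    adjMul F (shiftVar F i) (MvPolynomial.X i) a ∘ₗ totalDel F A M k
      = totalDel F A M k ∘ₗ adjMul F (shiftVar F i) (MvPolynomial.X i) a := by
  have h : Commute (adjMul F (shiftVar F i) (MvPolynomial.X i) a) (totalDel F A M k) := by
    simp only [adjMul, Polynomial.sum_def]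
    exact Commute.sum_left _ _ _ fun j _ =>
      Commute.mul_left (shiftMul_comm i _) (lamMul_comm _)
  exact h

theorem rename_comm {k : ℕ} (π : Equiv.Perm (Fin k)) :
    substVar F (MvPolynomial.rename π) ∘ₗ totalDel F A M k
      = totalDel F A M k ∘ₗ substVar F (MvPolynomial.rename π) := by
  refine TensorProduct.ext' fun p m => ?_
  rw [LinearMap.comp_apply, LinearMap.comp_apply, totalDel_tmul, map_add]
  simp only [substVar, LinearMap.rTensor_tmul, AlgHom.toLinearMap_apply, totalDel_tmul, map_mul,
    map_sum, MvPolynomial.rename_X]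
  rw [Equiv.sum_comp π (fun j => (MvPolynomial.X j : MvPolynomial (Fin k) F))]

variable (F M) in
/-- `(|_{x=∂} a^*(λᵢ)) P(…, λᵢ+x, …)` on `M[λ₁, …, λₖ] / ⟨∂ + λ₁ + ⋯ + λₖ⟩`. -/
def adjQuot {k : ℕ} (i : Fin k) (a : Polynomial A) : Module.End F (QuotMod F A M k) :=
  Submodule.mapQ _ _ (adjMul F (shiftVar F i) (MvPolynomial.X i) a)
    (range_le_comap _ (adjMul_comm i a))

variable (F A M) in
/-- `P(λ₁, …, λₖ) ↦ P(λ_{π(1)}, …, λ_{π(k)})` on `M[λ₁, …, λₖ] / ⟨∂ + λ₁ + ⋯ + λₖ⟩`. -/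
def permQuot {k : ℕ} (π : Equiv.Perm (Fin k)) : Module.End F (QuotMod F A M k) :=
  Submodule.mapQ _ _ (substVar F (MvPolynomial.rename π)) (range_le_comap _ (rename_comm π))

variable (F A M) in
/-- The space `Cᵏ(E, M)` of `k`-cochains: `F`-linear maps
`φ : E^{⊗k} → M[λ₁, …, λₖ] / ⟨∂ + λ₁ + ⋯ + λₖ⟩` that are sesquilinear over `A[∂]`
and skewsymmetric. -/
def Cochain (E : Type*) [AddCommGroup E] [Module F E] [Module A E] [DiffModule F A E] (k : ℕ) :
    Submodule F (MultilinearMap F (fun _ : Fin k => E) (QuotMod F A M k)) where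
  carrier := {φ |
    (∀ (a : Fin k → Polynomial A) (u : Fin k → E),
      φ (fun i => diffOp F (a i) (u i)) =
        (List.ofFn fun i => adjQuot F M i (a i)).prod (φ u)) ∧
    ∀ (π : Equiv.Perm (Fin k)) (u : Fin k → E),
      φ u = (Equiv.Perm.sign π : ℤ) • permQuot F A M π (φ (u ∘ π))}
  add_mem' := by
    rintro φ ψ ⟨h1, h2⟩ ⟨h3, h4⟩
    refine ⟨fun a u => ?_, fun π u => ?_⟩
    · rw [add_apply, add_apply, h1, h3, map_add]
    · rw [add_apply, add_apply, map_add, smul_add, ← h2, ← h4]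
  zero_mem' := by
    refine ⟨fun a u => ?_, fun π u => ?_⟩ <;> simp
  smul_mem' := by
    rintro c φ ⟨h1, h2⟩
    refine ⟨fun a u => ?_, fun π u => ?_⟩
    · rw [smul_apply, smul_apply, h1, map_smul]
    · rw [smul_apply, smul_apply, map_smul, smul_comm, ← h2]

end Cochains

/-! ## The differential -/

section Differential

variable {F : Type*} (A : Type*) {E M : Type*} [Field F] [CommRing A] [Algebra F A]
  [DiffAlgebra F A]
  [AddCommGroup E] [Module F E] [Module A E] [IsScalarTower F A E] [DiffModule F A E]
  [LieConformalAlgebroid F A E]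
  [AddCommGroup M] [Module F M] [Module A M] [IsScalarTower F A M] [DiffModule F A M]
  [LCAdModule F A E M]

/-- `∑ᵢ (-1)^{i+1} u_i_{λᵢ}(Φ_{λ₁, …, λ̌ᵢ, …, λₖ₊₁}(u₁, …, ǔᵢ, …, uₖ₊₁))`; indices start at `0`
in the code. -/
def actionSum {k : ℕ} (Φ : MultilinearMap F (fun _ : Fin k => E) (PolyMod F M k))
    (u : Fin (k + 1) → E) : PolyMod F M (k + 1) :=
  ∑ i : Fin (k + 1), (-1 : ℤ) ^ (i : ℕ) •
    applyAt F (MvPolynomial.X i) (LCAdModule.action A (u i))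
      (substVar F (MvPolynomial.rename i.succAbove) (Φ fun l => u (i.succAbove l)))

/-- The linear map `e ↦ Φ(e, v₁, …, vₙ)`. -/
def firstSlot {n : ℕ} (Φ : MultilinearMap F (fun _ : Fin (n + 1) => E) (PolyMod F M (n + 1)))
    (v : Fin n → E) : E →ₗ[F] PolyMod F M (n + 1) where
  toFun e := Φ (Fin.cons e v)
  map_add' x y := MultilinearMap.cons_add Φ v x y
  map_smul' c x := MultilinearMap.cons_smul Φ v c x

/-- `∑_{i<j} (-1)^{i+j} Φ_{λᵢ+λⱼ, λ₁, …, λ̌ᵢ, …, λ̌ⱼ, …}([uᵢ_{λᵢ} uⱼ], u₁, …, ǔᵢ, …, ǔⱼ, …)`;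
the sum is empty for `k = 0`. For `i < j`, the map `l ↦ j.succAbove (i.succAbove l)` lists in
increasing order the indices different from `i` and `j`. -/
def bracketSum : ∀ {k : ℕ}, MultilinearMap F (fun _ : Fin k => E) (PolyMod F M k) →
    (Fin (k + 1) → E) → PolyMod F M (k + 1)
  | 0, _, _ => 0
  | n + 1, Φ, u => ∑ j : Fin (n + 2), ∑ i : Fin (n + 1),
      if i.castSucc < j then
        (-1 : ℤ) ^ ((i : ℕ) + (j : ℕ)) •
          extCoef F (Polynomial.aeval (MvPolynomial.X i.castSucc))
            (substVar F (MvPolynomial.aeval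
                (Fin.cons (MvPolynomial.X i.castSucc + MvPolynomial.X j)
                  fun l => MvPolynomial.X (j.succAbove (i.succAbove l))))
              ∘ₗ firstSlot Φ fun l => u (j.succAbove (i.succAbove l)))
            (LieConformalAlgebroid.bracket A (u i.castSucc) (u j))
      else 0

/-- The linear map `d : Cᵏ(E, M) → Cᵏ⁺¹(E, M)` is given by the Chevalley–Eilenberg formula: for
every cochain `φ` and every choice of a linear lift `Φ : E^{⊗k} → M[λ₁, …, λₖ]` of `φ`, the value
`(dφ)(u₁, …, uₖ₊₁)` is the class of the formula evaluated on `Φ`. -/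
def IsCEDifferential {k : ℕ} (d : Cochain F A M E k →ₗ[F] Cochain F A M E (k + 1)) : Prop :=
  ∀ (φ : Cochain F A M E k) (Φ : MultilinearMap F (fun _ : Fin k => E) (PolyMod F M k)),
    (∀ u : Fin k → E, toQuot F A M k (Φ u) = φ.1 u) →
    ∀ u : Fin (k + 1) → E,
      (d φ).1 u = toQuot F A M (k + 1) (actionSum A Φ u + bracketSum A Φ u)

end Differential

end LCAd

end

/-! The quotient by `∂ + λ₁ + ⋯ + λₖ` obscures an ordinary Cartan calculus, so the argument is run
upstairs. A cochain is replaced by a family of multilinear maps `E^{⊗k} → R ⊗ M` depending on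
parameters `ℓ₁, …, ℓₖ` in an arbitrary commutative `F`-algebra `R`, with no symmetry and no
sesquilinearity imposed (`ParamCochain`). On such families there are contractions `ι` (`app`), Lie
derivatives `L` (`lieDer`), and a differential defined recursively by Cartan's formula `ι d = L - d
ι` (`leibnizD`). Induction on the arity, starting from the module axiom and using the Jacobi
identity, gives `[L_ℓ(u), L_m(v)] = L_{ℓ+m}([u_ℓ v])` (`lieDer_lieDer`), then `[L, d] = 0`
(`lieDer_leibnizD`), then `d² = 0` (`leibnizD_leibnizD`). These are exact identities, before any
quotient.

The remaining work compares this with the statement, modulo the image of `∂ + ℓ₁ + ⋯ + ℓₖ`. The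
differential preserves families with values in that image, so the class of `dφ` does not depend on
the lift (`leibnizD_mem_nullCochain`). On skewsymmetric families it agrees with the
Chevalley–Eilenberg formula, because moving a bracket from slot `j` to the front costs `(-1)^j`
(`leibnizD_sub_mem`). Skewsymmetry of `dφ` also needs sesquilinearity of `φ`: the skewsymmetry of
the bracket involves `-λ-∂`, and `∂` in a slot with parameter `ℓ` acts as `-ℓ` (`IsSkew.leibnizD`).

Sesquilinearity of `dφ` over `A[∂]` is checked only in the last slot, which the recursion on first
slots leaves untouched, and is carried to the other slots by skewsymmetry. It is enough to treat the
generators `∂` and `c ∈ A`. For `c`, the substitution `x = ∂` is expressed by working over `R[x]`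
and replacing `x` by `r + ∂` acting on `c`. A Lie derivative by `u_ℓ` creates anchor terms whose
base point has moved from `r` to `r + ℓ`, and those from the action cancel those from the bracket
(`IsCoefLast.lieDer`).

Finally, a linear section of the quotient map provides lifts depending linearly on `φ`, so `d`
exists as a linear map. It is unique because lifts exist. -/

set_option linter.unusedSectionVars false

noncomputable section

namespace LCAd

/-! ### Extension of scalars and evaluation of `λ` at elements of an algebra. -/

section EvalAt

variable {F : Type*} [Field F] {R S : Type*} [CommRing R] [Algebra F R] [CommRing S] [Algebra F S]
variable {N N' N'' : Type*} [AddCommGroup N] [Module F N] [AddCommGroup N'] [Module F N']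
  [AddCommGroup N''] [Module F N'']

@[simp] theorem substVar_tmul (σ : R →ₐ[F] S) (r : R) (n : N) :
    substVar F σ (r ⊗ₜ[F] n) = σ r ⊗ₜ[F] n := rfl

theorem substVar_smul (σ : R →ₐ[F] S) (r : R) (P : R ⊗[F] N) :
    substVar F σ (r • P) = σ r • substVar F σ P := by
  induction P with
  | zero => simp
  | tmul p n => simp [TensorProduct.smul_tmul']
  | add P Q hP hQ => simp [smul_add, hP, hQ]

theorem substVar_substVar {T : Type*} [CommRing T] [Algebra F T] (τ : S →ₐ[F] T) (σ : R →ₐ[F] S)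
    (P : R ⊗[F] N) : substVar F τ (substVar F σ P) = substVar F (τ.comp σ) P := by
  induction P with
  | zero => simp
  | tmul p n => simp
  | add P Q hP hQ => simp [hP, hQ]

theorem substVar_id (P : R ⊗[F] N) : substVar F (AlgHom.id F R) P = P := by
  induction P with
  | zero => simp
  | tmul p n => simp
  | add P Q hP hQ => rw [map_add, hP, hQ]

/-- For `f : N → N'[λ]`, the `R`-linear extension of `f_ℓ : N → R ⊗ N'`. -/
def evalAt (ℓ : R) (f : N →ₗ[F] Polynomial F ⊗[F] N') : R ⊗[F] N →ₗ[R] R ⊗[F] N' :=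
  LinearMap.liftBaseChange R (substVar F (Polynomial.aeval ℓ) ∘ₗ f)

theorem evalAt_tmul (ℓ : R) (f : N →ₗ[F] Polynomial F ⊗[F] N') (r : R) (n : N) :
    evalAt ℓ f (r ⊗ₜ n) = r • substVar F (Polynomial.aeval ℓ) (f n) := by
  simp [evalAt]

theorem evalAt_const (ℓ : R) (f : N →ₗ[F] Polynomial F ⊗[F] N') (n : N) :
    evalAt ℓ f (const F R n) = substVar F (Polynomial.aeval ℓ) (f n) := by
  simp [const, evalAt_tmul]

theorem applyAt_eq_evalAt (ℓ : R) (f : N →ₗ[F] Polynomial F ⊗[F] N') (P : R ⊗[F] N) :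
    applyAt F ℓ f P = evalAt ℓ f P := by
  induction P with
  | zero => simp
  | tmul p n => simp [applyAt, extCoef, evalAt_tmul]
  | add P Q hP hQ => rw [map_add, map_add, hP, hQ]

theorem substVar_evalAt (σ : R →ₐ[F] S) (ℓ : R) (f : N →ₗ[F] Polynomial F ⊗[F] N')
    (P : R ⊗[F] N) : substVar F σ (evalAt ℓ f P) = evalAt (σ ℓ) f (substVar F σ P) := by
  induction P with
  | zero => simp
  | tmul p n =>
    rw [evalAt_tmul, substVar_smul, substVar_substVar, substVar_tmul, evalAt_tmul,
      Polynomial.aeval_algHom]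
  | add P Q hP hQ => simp [hP, hQ]

theorem substVar_const (σ : R →ₐ[F] S) (n : N) : substVar F σ (const F R n) = const F S n := by
  simp [const]

theorem evalAt_add (ℓ : R) (f g : N →ₗ[F] Polynomial F ⊗[F] N') :
    (evalAt ℓ (f + g) : R ⊗[F] N →ₗ[R] R ⊗[F] N') = evalAt ℓ f + evalAt ℓ g := by
  refine LinearMap.ext fun P => ?_
  induction P with
  | zero => simp
  | tmul p n => simp [evalAt_tmul]
  | add P Q hP hQ => rw [map_add, map_add, hP, hQ]

theorem evalAt_smul (ℓ : R) (c : F) (f : N →ₗ[F] Polynomial F ⊗[F] N') :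
    (evalAt ℓ (c • f) : R ⊗[F] N →ₗ[R] R ⊗[F] N') = c • evalAt ℓ f := by
  refine LinearMap.ext fun P => ?_
  induction P with
  | zero => simp
  | tmul p n =>
    simp only [evalAt_tmul, LinearMap.smul_apply, map_smul]
    rw [smul_comm]
  | add P Q hP hQ => rw [map_add, map_add, hP, hQ]

/-- `(u, P) ↦ f(u)_ℓ(P)` as a linear map in `u`. -/
def evalAtHom (ℓ : R) (f : N →ₗ[F] N' →ₗ[F] Polynomial F ⊗[F] N'') :
    N →ₗ[F] R ⊗[F] N' →ₗ[R] R ⊗[F] N'' where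
  toFun u := evalAt ℓ (f u)
  map_add' u v := by rw [map_add, evalAt_add]
  map_smul' c u := by rw [map_smul, evalAt_smul]; rfl

theorem evalAtHom_apply (ℓ : R) (f : N →ₗ[F] N' →ₗ[F] Polynomial F ⊗[F] N'') (u : N) :
    evalAtHom ℓ f u = (evalAt ℓ (f u) : R ⊗[F] N' →ₗ[R] R ⊗[F] N'') := rfl

/-- The axioms express a polynomial in the first argument of a bracket or action through `flip`;
this translates them to the `R`-linear extension in that argument. -/
theorem liftBaseChange_evalAtHom (ℓ : R) (f : N →ₗ[F] N' →ₗ[F] Polynomial F ⊗[F] N'')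
    (P : R ⊗[F] N) (n : N') :
    (evalAtHom ℓ f).liftBaseChange R P (const F R n) = evalAt ℓ (f.flip n) P := by
  induction P with
  | zero => simp
  | tmul p n =>
    simp [evalAt_tmul, evalAtHom_apply, evalAt_const]
  | add P Q hP hQ => rw [map_add, map_add, LinearMap.add_apply, hP, hQ]

end EvalAt

/-! ### The operators `s + ∂` and their images. -/

section Del

variable {F : Type*} [Field F] {A : Type*} [CommRing A] [Algebra F A] [DiffAlgebra F A]
variable {M : Type*} [AddCommGroup M] [Module F M] [Module A M] [DiffModule F A M]
variable {N : Type*} [AddCommGroup N] [Module F N] [Module A N] [DiffModule F A N]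
variable {R S : Type*} [CommRing R] [Algebra F R] [CommRing S] [Algebra F S]

variable (A) in
/-- The operator `s + ∂` on `R ⊗ M`, as an `R`-linear map. -/
def shiftDel (s : R) : R ⊗[F] M →ₗ[R] R ⊗[F] M :=
  s • LinearMap.id + (del F A : M →ₗ[F] M).baseChange R

theorem shiftDel_tmul (s r : R) (m : M) :
    shiftDel A s (r ⊗ₜ[F] m) = (s * r) ⊗ₜ m + r ⊗ₜ del F A m := by
  simp [shiftDel, TensorProduct.smul_tmul']

theorem shiftDel_const (s : R) (m : M) :
    shiftDel A s (const F R m) = s • const F R m + const F R (del F A m) := by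
  simp [const, shiftDel_tmul, TensorProduct.smul_tmul']

theorem shiftDel_add (s t : R) (P : R ⊗[F] M) :
    shiftDel A (s + t) P = s • P + shiftDel A t P := by
  simp [shiftDel, add_smul, add_assoc]

theorem lamDel_eq_shiftDel (s : R) (P : R ⊗[F] M) : lamDel F A s P = shiftDel A s P := by
  simp [lamDel, lamMul, coefDel, shiftDel, LinearMap.baseChange_eq_ltensor]

theorem substVar_shiftDel (σ : R →ₐ[F] S) (s : R) (P : R ⊗[F] M) :
    substVar F σ (shiftDel A s P) = shiftDel A (σ s) (substVar F σ P) := by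
  induction P with
  | zero => simp
  | tmul p n => simp [shiftDel_tmul]
  | add P Q hP hQ => simp [hP, hQ]

/-- Moving `∂` across `f_ℓ` produces `ℓ + ∂`. Hence acting by `u_ℓ` adds `ℓ` to the operator whose
image is divided out. -/
theorem evalAt_shiftDel {f : M →ₗ[F] Polynomial F ⊗[F] N}
    (hf : ∀ m, f (del F A m) = lamDel F A Polynomial.X (f m)) (ℓ s : R) (P : R ⊗[F] M) :
    evalAt ℓ f (shiftDel A s P) = shiftDel A (ℓ + s) (evalAt ℓ f P) := by
  induction P with
  | zero => simp
  | tmul p n =>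
    rw [shiftDel_tmul, map_add, evalAt_tmul, evalAt_tmul, hf, evalAt_tmul, lamDel_eq_shiftDel,
      substVar_shiftDel, map_smul, Polynomial.aeval_X, add_comm ℓ s, shiftDel_add, smul_add,
      mul_smul, smul_comm p s]
  | add P Q hP hQ => simp [hP, hQ]

variable (F A M) in
/-- The image of `s + ∂` on `R ⊗ M`. -/
def delRange (s : R) : Submodule R (R ⊗[F] M) := LinearMap.range (shiftDel A s)

theorem shiftDel_mem (s : R) (P : R ⊗[F] M) : shiftDel A s P ∈ delRange F A M s := ⟨P, rfl⟩

theorem substVar_mem_delRange (σ : R →ₐ[F] S) {s : R} {P : R ⊗[F] M} (h : P ∈ delRange F A M s) :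
    substVar F σ P ∈ delRange F A M (σ s) := by
  obtain ⟨Q, rfl⟩ := h
  rw [substVar_shiftDel]
  exact shiftDel_mem _ _

theorem evalAt_mem_delRange {f : M →ₗ[F] Polynomial F ⊗[F] N}
    (hf : ∀ m, f (del F A m) = lamDel F A Polynomial.X (f m)) (ℓ : R) {s : R} {P : R ⊗[F] M}
    (h : P ∈ delRange F A M s) : evalAt ℓ f P ∈ delRange F A N (ℓ + s) := by
  obtain ⟨Q, rfl⟩ := h
  rw [evalAt_shiftDel hf]
  exact shiftDel_mem _ _

end Del

theorem linearMap_ext_const {F : Type*} [Field F] {R : Type*} [CommRing R] [Algebra F R]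
    {N : Type*} [AddCommGroup N] [Module F N] {X : Type*} [AddCommGroup X] [Module R X]
    {f g : R ⊗[F] N →ₗ[R] X} (h : ∀ n, f (const F R n) = g (const F R n)) : f = g := by
  refine LinearMap.ext fun P => ?_
  induction P with
  | zero => simp
  | tmul p n =>
    have : p ⊗ₜ[F] n = p • const F R n := by simp [const, TensorProduct.smul_tmul']
    rw [this, map_smul, map_smul, h]
  | add P Q hP hQ => rw [map_add, map_add, hP, hQ]

/-! ### The action of `R ⊗ A` on `R ⊗ M`. -/

section CoefProd

variable {F : Type*} [Field F] {A : Type*} [CommRing A] [Algebra F A] [DiffAlgebra F A]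
variable {M : Type*} [AddCommGroup M] [Module F M] [Module A M] [IsScalarTower F A M]
variable {R S : Type*} [CommRing R] [Algebra F R] [CommRing S] [Algebra F S]

/-- The action of `R ⊗ A` on `R ⊗ M`. -/
def coefProd : R ⊗[F] A →ₗ[R] R ⊗[F] M →ₗ[R] R ⊗[F] M :=
  LinearMap.liftBaseChange R
    (LinearMap.baseChangeHom F R M M ∘ₗ (Algebra.lsmul F F M).toLinearMap)

theorem coefProd_tmul (r s : R) (a : A) (m : M) :
    coefProd (r ⊗ₜ[F] a) (s ⊗ₜ[F] m) = (r * s) ⊗ₜ (a • m) := by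
  simp [coefProd, TensorProduct.smul_tmul']

theorem coefProd_const (a : A) (P : R ⊗[F] M) :
    coefProd (const F R a) P = coefMul F a P := by
  induction P with
  | zero => simp
  | tmul p n => simp [const, coefProd_tmul, coefMul]
  | add P Q hP hQ => simp [hP, hQ]

theorem coefProd_eq_coefSmul (β : R ⊗[F] A) (m : M) :
    coefProd β (const F R m) = coefSmul F m β := by
  induction β with
  | zero => simp
  | tmul p n => simp [const, coefProd_tmul, coefSmul]
  | add P Q hP hQ => simp [hP, hQ]

theorem substVar_coefProd (σ : R →ₐ[F] S) (β : R ⊗[F] A) (P : R ⊗[F] M) :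
    substVar F σ (coefProd β P) = coefProd (substVar F σ β) (substVar F σ P) := by
  induction β with
  | zero => simp
  | tmul r a =>
    induction P with
    | zero => simp
    | tmul p n => simp [coefProd_tmul]
    | add P Q hP hQ => simp [hP, hQ]
  | add P Q hP hQ => simp [hP, hQ]

/-- Everything is `R`-linear in `β` and in `P`, so the Leibniz rule on constants extends. -/
theorem evalAt_coefProd {f : M →ₗ[F] Polynomial F ⊗[F] M} {θ : A →ₗ[F] Polynomial F ⊗[F] A}
    (h : ∀ (a : A) (m : M), f (a • m) = coefMul F a (f m) + coefSmul F m (θ a))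
    (ℓ : R) (β : R ⊗[F] A) (P : R ⊗[F] M) :
    evalAt ℓ f (coefProd β P) = coefProd β (evalAt ℓ f P) + coefProd (evalAt ℓ θ β) P := by
  induction β with
  | zero => simp
  | tmul r a =>
    induction P with
    | zero => simp
    | tmul p n =>
      have e1 : r ⊗ₜ[F] a = r • const F R a := by simp [const, TensorProduct.smul_tmul']
      have e2 : p ⊗ₜ[F] n = p • const F R n := by simp [const, TensorProduct.smul_tmul']
      have e3 : coefProd (const F R a) (const F R n) = const F R (a • n) := by
        simp [const, coefProd_tmul]
      rw [e1, e2]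
      simp only [map_smul, LinearMap.smul_apply, e3, evalAt_const, h, map_add,
        ← coefProd_eq_coefSmul, ← coefProd_const, substVar_coefProd, substVar_const, smul_add]
    | add P Q hP hQ => simp only [map_add, hP, hQ]; abel
  | add P Q hP hQ => simp only [map_add, LinearMap.add_apply, hP, hQ]; abel

end CoefProd

/-! ### Differential operators on the generators `c ∈ A` and `∂`. -/

section DiffOp

variable {F : Type*} [Field F] {A : Type*} [CommRing A] [Algebra F A] [DiffAlgebra F A]
variable {M : Type*} [AddCommGroup M] [Module F M] [Module A M] [IsScalarTower F A M]
  [DiffModule F A M]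
variable {R : Type*} [CommRing R] [Algebra F R]

theorem diffOp_C (c : A) (m : M) : diffOp F (Polynomial.C c) m = c • m := by
  simp [diffOp, Polynomial.sum_C_index]

theorem diffOp_X (m : M) : diffOp F (Polynomial.X : Polynomial A) m = del F A m := by
  simp [diffOp, Polynomial.sum_X_index]

theorem coefMul_one (P : R ⊗[F] M) : coefMul F (1 : A) P = P := by
  have : (coefMul F (1 : A) : Module.End F (R ⊗[F] M)) = LinearMap.id := by
    rw [coefMul, map_one]
    exact LinearMap.lTensor_id R M
  rw [this, LinearMap.id_apply]

theorem coefMul_zero (P : R ⊗[F] M) : coefMul F (0 : A) P = 0 := by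
  simp [coefMul]

theorem diffOpShift_C (ℓ : R) (c : A) (P : R ⊗[F] M) :
    diffOpShift F ℓ (Polynomial.C c) P = coefMul F c P := by
  rw [diffOpShift, Polynomial.sum_C_index (coefMul_zero _), pow_zero, Module.End.one_apply]

theorem diffOpShift_X (ℓ : R) (P : R ⊗[F] M) :
    diffOpShift F ℓ (Polynomial.X : Polynomial A) P = lamDel F A ℓ P := by
  rw [diffOpShift, Polynomial.sum_X_index (coefMul_zero _), pow_one, coefMul_one]

theorem shiftMul_zero (s : R →ₐ[F] Polynomial R) :
    (shiftMul F s (0 : A) : Module.End F (R ⊗[F] M)) = 0 := by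
  refine TensorProduct.ext' fun p m => ?_
  simp [shiftMul, expandMul, Polynomial.lsum, Polynomial.sum_def]

theorem adjMul_C (s : R →ₐ[F] Polynomial R) (ℓ : R) (c : A) :
    (adjMul F s ℓ (Polynomial.C c) : Module.End F (R ⊗[F] M)) = shiftMul F s c := by
  have : lamMul F (1 : R) = (1 : Module.End F (R ⊗[F] M)) := by ext; simp [lamMul]
  rw [adjMul, Polynomial.sum_C_index (by rw [shiftMul_zero, zero_mul]), pow_zero, this, mul_one]

theorem expandMul_monomial (a : A) (n : ℕ) (q : R) (m : M) :
    expandMul F a (Polynomial.monomial n q) m =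
      q ⊗ₜ[F] ((((DiffAlgebra.der (F := F) (A := A)).toLinearMap ^ n) a) • m) := by
  simp [expandMul, Polynomial.lsum, Polynomial.sum_monomial_index]

theorem der_pow_one (n : ℕ) :
    (((DiffAlgebra.der (F := F) (A := A)).toLinearMap ^ (n + 1)) (1 : A)) = 0 := by
  rw [pow_succ, Module.End.mul_apply]
  simp

/-- Since `∂ 1 = 0`, only the constant term in `x` survives. -/
theorem expandMul_one (Q : Polynomial R) (m : M) :
    expandMul F (1 : A) Q m = Q.coeff 0 ⊗ₜ[F] m := by
  induction Q using Polynomial.induction_on' with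
  | add p q hp hq => simp [hp, hq, TensorProduct.add_tmul]
  | monomial n c =>
    rw [expandMul_monomial]
    cases n with
    | zero => simp
    | succ n => rw [der_pow_one]; simp

theorem shiftMul_one {s : R →ₐ[F] Polynomial R} (hs : ∀ p, (s p).coeff 0 = p) :
    (shiftMul F s (1 : A) : Module.End F (R ⊗[F] M)) = 1 := by
  refine TensorProduct.ext' fun p m => ?_
  simp [shiftMul, expandMul_one, hs]

theorem adjMul_X {s : R →ₐ[F] Polynomial R} (hs : ∀ p, (s p).coeff 0 = p) (ℓ : R)
    (P : R ⊗[F] M) : adjMul F s ℓ (Polynomial.X : Polynomial A) P = -(ℓ • P) := by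
  rw [adjMul, Polynomial.sum_X_index (by rw [shiftMul_zero, zero_mul]), shiftMul_one hs, one_mul,
    pow_one]
  exact neg_smul ℓ P

/-- The constant coefficient is the value at `x = 0`, where `λ + x` becomes `λ`. -/
theorem shiftOne_coeff_zero (p : Polynomial F) : (shiftOne F p).coeff 0 = p := by
  have : ((Polynomial.aeval (0 : Polynomial F)).restrictScalars F).comp (shiftOne F)
      = AlgHom.id F _ := by
    ext
    simp [shiftOne]
  have h := DFunLike.congr_fun this p
  rw [Polynomial.coeff_zero_eq_aeval_zero]
  exact h

theorem shiftVar_coeff_zero {k : ℕ} (i : Fin k) (p : MvPolynomial (Fin k) F) :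
    (shiftVar F i p).coeff 0 = p := by
  have : ((Polynomial.aeval (0 : MvPolynomial (Fin k) F)).restrictScalars F).comp (shiftVar F i)
      = AlgHom.id F _ := by
    refine MvPolynomial.algHom_ext fun j => ?_
    by_cases h : j = i <;> simp [shiftVar, h]
  have h := DFunLike.congr_fun this p
  rw [Polynomial.coeff_zero_eq_aeval_zero]
  exact h

end DiffOp

/-! ### The algebroid and module axioms at arbitrary parameters. -/

section Algebroid

variable {F A E M : Type*} [Field F] [CommRing A] [Algebra F A] [DiffAlgebra F A]
  [AddCommGroup E] [Module F E] [Module A E] [IsScalarTower F A E] [DiffModule F A E]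
  [LieConformalAlgebroid F A E]
  [AddCommGroup M] [Module F M] [Module A M] [IsScalarTower F A M] [DiffModule F A M]
  [LCAdModule F A E M]
variable {R : Type*} [CommRing R] [Algebra F R]

open LieConformalAlgebroid LCAdModule

/-- The derivation rule for `1 · 1` gives `θ(1) = θ(1) + θ(1)`. -/
theorem anchor_one (u : E) : anchor (F := F) u (1 : A) = 0 := by
  have h := anchor_der (F := F) u (Polynomial.C (1 : A)) (1 : A)
  rw [diffOp_C, diffOpShift_C, Polynomial.sum_C_index] at h
  · simpa [coefMul_one] using h
  · simp

theorem anchor_del (u : E) (b : A) :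
    anchor (F := F) u (del F A b) = lamDel F A Polynomial.X (anchor (F := F) u b) := by
  have h := anchor_der (F := F) u (Polynomial.X : Polynomial A) b
  rw [diffOp_X, diffOpShift_X, Polynomial.sum_X_index] at h
  · simpa [anchor_one] using h
  · simp

theorem bracket_del (u v : E) : bracket (F := F) A u (del F A v) =
    lamDel F A Polynomial.X (bracket (F := F) A u v) :=
  (lca (F := F) (A := A) (E := E)).sesq_right u v

theorem bracket_smul (u : E) (c : A) (v : E) : bracket (F := F) A u (c • v) =
    coefMul F c (bracket (F := F) A u v) + coefSmul F v (anchor (F := F) u c) := by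
  have h := bracket_diffOp (F := F) u (Polynomial.C c) v
  rw [diffOp_C, diffOpShift_C, Polynomial.sum_C_index] at h
  · simpa using h
  · simp

/-- The symbol of `∂` has leading coefficient `1`, so its anchor term vanishes by `anchor_one`. -/
theorem action_del (u : E) (m : M) : action (F := F) A u (del F A m) =
    lamDel F A Polynomial.X (action (F := F) A u m) := by
  have h := action_diffOp (F := F) u (Polynomial.X : Polynomial A) m
  rw [diffOp_X, diffOpShift_X, Polynomial.sum_X_index] at h
  · simpa [anchor_one] using h
  · simp

theorem action_smul (u : E) (c : A) (m : M) : action (F := F) A u (c • m) =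
    coefMul F c (action (F := F) A u m) + coefSmul F m (anchor (F := F) u c) := by
  have h := action_diffOp (F := F) u (Polynomial.C c) m
  rw [diffOp_C, diffOpShift_C, Polynomial.sum_C_index] at h
  · simpa using h
  · simp

theorem del_action (u : E) (m : M) : action (F := F) A (del F A u) m =
    -((Polynomial.X : Polynomial F) • action (F := F) A u m) := by
  have h := diffOp_action (F := F) (Polynomial.X : Polynomial A) u m
  rwa [diffOp_X, adjMul_X shiftOne_coeff_zero] at h

theorem smul_action (c : A) (u : E) (m : M) : action (F := F) A (c • u) m =
    shiftMul F (shiftOne F) c (action (F := F) A u m) := by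
  have h := diffOp_action (F := F) (Polynomial.C c) u m
  rwa [diffOp_C, adjMul_C] at h

variable (F A M) in
/-- `u ↦ (P ↦ u_ℓ P)` -/
def actionAt (ℓ : R) : E →ₗ[F] R ⊗[F] M →ₗ[R] R ⊗[F] M := evalAtHom ℓ (action A)

variable (F A E) in
/-- `u ↦ (P ↦ [u_ℓ P])` -/
def bracketAt (ℓ : R) : E →ₗ[F] R ⊗[F] E →ₗ[R] R ⊗[F] E := evalAtHom ℓ (bracket A)

/-- The Jacobi identity in two free variables is the universal case: substituting `λ = ℓ`, `μ = m`
and extending `R`-linearly in the last argument gives it over any `R`. -/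
theorem bracketAt_bracketAt (ℓ m : R) (u v : E) (P : R ⊗[F] E) :
    bracketAt F A E ℓ u (bracketAt F A E m v P) - bracketAt F A E m v (bracketAt F A E ℓ u P) =
      (bracketAt F A E (ℓ + m)).liftBaseChange R (bracketAt F A E ℓ u (const F R v)) P := by
  have key : (bracketAt F A E ℓ u ∘ₗ bracketAt F A E m v
      - bracketAt F A E m v ∘ₗ bracketAt F A E ℓ u : R ⊗[F] E →ₗ[R] R ⊗[F] E)
      = (bracketAt F A E (ℓ + m)).liftBaseChange R (bracketAt F A E ℓ u (const F R v)) := by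
    refine linearMap_ext_const fun w => ?_
    have h := congrArg (substVar F (MvPolynomial.aeval ![ℓ, m]))
      ((lca (F := F) (A := A) (E := E)).jacobi u v w)
    simp only [applyAt_eq_evalAt, map_sub, substVar_evalAt, substVar_const, map_add,
      MvPolynomial.aeval_X, Matrix.cons_val_zero, Matrix.cons_val_one] at h
    rw [bracketAt, bracketAt, bracketAt, liftBaseChange_evalAtHom]
    exact h
  exact LinearMap.congr_fun key P

theorem actionAt_actionAt (ℓ m : R) (u v : E) (P : R ⊗[F] M) :
    actionAt F A M ℓ u (actionAt F A M m v P) - actionAt F A M m v (actionAt F A M ℓ u P) =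
      (actionAt F A M (ℓ + m)).liftBaseChange R (bracketAt F A E ℓ u (const F R v)) P := by
  have key : (actionAt F A M ℓ u ∘ₗ actionAt F A M m v
      - actionAt F A M m v ∘ₗ actionAt F A M ℓ u : R ⊗[F] M →ₗ[R] R ⊗[F] M)
      = (actionAt F A M (ℓ + m)).liftBaseChange R (bracketAt F A E ℓ u (const F R v)) := by
    refine linearMap_ext_const fun w => ?_
    -- The module axiom uses `μ` and `μ - λ`, so `μ` is sent to `ℓ + m` to make `v` act with
    -- parameter `m`.
    have h := congrArg (substVar F (MvPolynomial.aeval ![ℓ, ℓ + m]))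
      (bracket_action (F := F) (A := A) u v w)
    simp only [applyAt_eq_evalAt, map_sub, substVar_evalAt, substVar_const,
      MvPolynomial.aeval_X, Matrix.cons_val_zero, Matrix.cons_val_one, add_sub_cancel_left] at h
    rw [actionAt, actionAt, actionAt, liftBaseChange_evalAtHom]
    exact h.symm
  exact LinearMap.congr_fun key P

end Algebroid

/-- Multilinear maps `E^{⊗k} → R ⊗ M` depending on parameters `ℓ₁, …, ℓₖ ∈ R`. -/
def ParamCochain (F E M R : Type*) [Field F] [AddCommGroup E] [Module F E] [AddCommGroup M]
    [Module F M] [CommRing R] [Algebra F R] (k : ℕ) : Type _ :=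
  (Fin k → R) → MultilinearMap F (fun _ : Fin k => E) (R ⊗[F] M)

/-! ### Multilinear maps with parameters and their contractions. -/

section Instances

variable (F E M R : Type*) [Field F] [AddCommGroup E] [Module F E] [AddCommGroup M]
    [Module F M] [CommRing R] [Algebra F R] (k : ℕ)

instance : AddCommGroup (ParamCochain F E M R k) :=
  inferInstanceAs (AddCommGroup ((Fin k → R) → MultilinearMap F (fun _ : Fin k => E) (R ⊗[F] M)))

instance : Module R (ParamCochain F E M R k) :=
  inferInstanceAs (Module R ((Fin k → R) → MultilinearMap F (fun _ : Fin k => E) (R ⊗[F] M)))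

instance : Module F (ParamCochain F E M R k) :=
  inferInstanceAs (Module F ((Fin k → R) → MultilinearMap F (fun _ : Fin k => E) (R ⊗[F] M)))

instance : IsScalarTower F R (ParamCochain F E M R k) :=
  ⟨fun c r φ => funext fun ℓ => MultilinearMap.ext fun u => smul_assoc c r (φ ℓ u)⟩

end Instances

section Curry

variable {F E M R : Type*} [Field F] [AddCommGroup E] [Module F E] [AddCommGroup M]
    [Module F M] [CommRing R] [Algebra F R] {k : ℕ}

namespace ParamCochain

@[ext] theorem ext {φ ψ : ParamCochain F E M R k} (h : ∀ ℓ u, φ ℓ u = ψ ℓ u) : φ = ψ :=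
  funext fun ℓ => MultilinearMap.ext fun u => h ℓ u

@[simp] theorem add_apply (φ ψ : ParamCochain F E M R k) (ℓ : Fin k → R) (u : Fin k → E) :
    (φ + ψ) ℓ u = φ ℓ u + ψ ℓ u := rfl

@[simp] theorem sub_apply (φ ψ : ParamCochain F E M R k) (ℓ : Fin k → R) (u : Fin k → E) :
    (φ - ψ) ℓ u = φ ℓ u - ψ ℓ u := rfl

@[simp] theorem zero_apply (ℓ : Fin k → R) (u : Fin k → E) :
    (0 : ParamCochain F E M R k) ℓ u = 0 := rfl

@[simp] theorem smul_apply (r : R) (φ : ParamCochain F E M R k) (ℓ : Fin k → R) (u : Fin k → E) :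
    (r • φ) ℓ u = r • φ ℓ u := rfl

end ParamCochain

/-- Insert `u` with parameter `ℓ` in the first slot. -/
def app (φ : ParamCochain F E M R (k + 1)) (ℓ : R) : E →ₗ[F] ParamCochain F E M R k where
  toFun u ℓ' := (φ (Fin.cons ℓ ℓ')).curryLeft u
  map_add' u v := funext fun ℓ' => (φ (Fin.cons ℓ ℓ')).curryLeft.map_add u v
  map_smul' c u := funext fun ℓ' => (φ (Fin.cons ℓ ℓ')).curryLeft.map_smul c u

theorem app_apply (φ : ParamCochain F E M R (k + 1)) (ℓ : R) (u : E) (ℓ' : Fin k → R)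
    (u' : Fin k → E) : app φ ℓ u ℓ' u' = φ (Fin.cons ℓ ℓ') (Fin.cons u u') := rfl

theorem apply_eq_app (φ : ParamCochain F E M R (k + 1)) (ℓ : Fin (k + 1) → R)
    (u : Fin (k + 1) → E) : φ ℓ u = app φ (ℓ 0) (u 0) (Fin.tail ℓ) (Fin.tail u) := by
  rw [app_apply, Fin.cons_self_tail, Fin.cons_self_tail]

theorem ext_app {φ ψ : ParamCochain F E M R (k + 1)} (h : ∀ ℓ u, app φ ℓ u = app ψ ℓ u) :
    φ = ψ := by
  ext ℓ u
  rw [apply_eq_app, h, ← apply_eq_app]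

/-- The value at `ℓ`. -/
def evalParam (ℓ : Fin k → R) :
    ParamCochain F E M R k →ₗ[F] MultilinearMap F (fun _ : Fin k => E) (R ⊗[F] M) where
  toFun φ := φ ℓ
  map_add' _ _ := rfl
  map_smul' _ _ := rfl

/-- The inverse of `app`. -/
def unapp (f : R → E →ₗ[F] ParamCochain F E M R k) : ParamCochain F E M R (k + 1) :=
  fun ℓ => LinearMap.uncurryLeft
    (M := fun _ : Fin (k + 1) => E) (evalParam (Fin.tail ℓ) ∘ₗ f (ℓ 0))

@[simp] theorem app_unapp (f : R → E →ₗ[F] ParamCochain F E M R k) (ℓ : R) (u : E) :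
    app (unapp f) ℓ u = f ℓ u := by
  ext ℓ' u'
  simp [app_apply, unapp, evalParam]

@[simp] theorem app_add (φ ψ : ParamCochain F E M R (k + 1)) (ℓ : R) (u : E) :
    app (φ + ψ) ℓ u = app φ ℓ u + app ψ ℓ u := rfl

@[simp] theorem app_sub (φ ψ : ParamCochain F E M R (k + 1)) (ℓ : R) (u : E) :
    app (φ - ψ) ℓ u = app φ ℓ u - app ψ ℓ u := rfl

@[simp] theorem app_smul (c : R) (φ : ParamCochain F E M R (k + 1)) (ℓ : R) (u : E) :
    app (c • φ) ℓ u = c • app φ ℓ u := rfl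

/-- Insert an element of `R ⊗ E` with parameter `ℓ` in the first slot. -/
def appExt (φ : ParamCochain F E M R (k + 1)) (ℓ : R) : R ⊗[F] E →ₗ[R] ParamCochain F E M R k :=
  (app φ ℓ).liftBaseChange R

@[simp] theorem appExt_const (φ : ParamCochain F E M R (k + 1)) (ℓ : R) (u : E) :
    appExt φ ℓ (const F R u) = app φ ℓ u := by
  simp [appExt, const]

theorem appExt_add (φ ψ : ParamCochain F E M R (k + 1)) (ℓ : R) :
    appExt (φ + ψ) ℓ = appExt φ ℓ + appExt ψ ℓ :=
  linearMap_ext_const fun u => by simp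

theorem appExt_smul (c : R) (φ : ParamCochain F E M R (k + 1)) (ℓ : R) :
    appExt (c • φ) ℓ = c • appExt φ ℓ :=
  linearMap_ext_const fun u => by simp

end Curry

/-! ### Cartan calculus: Lie derivative, Leibniz differential, and `d² = 0`. -/

section Differential

variable {F A E M : Type*} [Field F] [CommRing A] [Algebra F A] [DiffAlgebra F A]
  [AddCommGroup E] [Module F E] [Module A E] [IsScalarTower F A E] [DiffModule F A E]
  [LieConformalAlgebroid F A E]
  [AddCommGroup M] [Module F M] [Module A M] [IsScalarTower F A M] [DiffModule F A M]
  [LCAdModule F A E M]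
variable {R : Type*} [CommRing R] [Algebra F R]

variable (F A M R) in
/-- The action of `u ∈ E` at the parameter `ℓ` on cochains. -/
def lieDer (ℓ : R) : ∀ k : ℕ, E →ₗ[F] ParamCochain F E M R k →ₗ[R] ParamCochain F E M R k
  | 0 =>
    { toFun u :=
        { toFun φ ℓ' := ((actionAt F A M ℓ u).restrictScalars F).compMultilinearMap (φ ℓ')
          map_add' φ ψ := ParamCochain.ext fun ℓ' u' => map_add (actionAt F A M ℓ u) _ _
          map_smul' c φ := ParamCochain.ext fun ℓ' u' => map_smul (actionAt F A M ℓ u) _ _ }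
      map_add' u v := LinearMap.ext fun φ => ParamCochain.ext fun ℓ' u' =>
        LinearMap.congr_fun (map_add (actionAt F A M ℓ) u v) (φ ℓ' u')
      map_smul' c u := LinearMap.ext fun φ => ParamCochain.ext fun ℓ' u' =>
        LinearMap.congr_fun (map_smul (actionAt F A M ℓ) c u) (φ ℓ' u') }
  | k + 1 =>
    { toFun u :=
        { toFun φ := unapp fun m => ((lieDer ℓ k u).restrictScalars F) ∘ₗ app φ m
            - (appExt φ (ℓ + m)).restrictScalars F ∘ₗ
              (bracketAt F A E ℓ u).restrictScalars F ∘ₗ TensorProduct.mk F R E 1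
          map_add' φ ψ := by
            refine ext_app fun m v => ?_
            simp [appExt_add]
            abel
          map_smul' c φ := by
            refine ext_app fun m v => ?_
            simp [appExt_smul, smul_sub] }
      map_add' u v := by
        refine LinearMap.ext fun φ => ext_app fun m w => ?_
        simp
        abel
      map_smul' c u := by
        refine LinearMap.ext fun φ => ext_app fun m w => ?_
        have : ∀ ψ : ParamCochain F E M R (k + 1), app (c • ψ) m w = c • app ψ m w :=
          fun _ => rfl
        simp [this, smul_sub] }

theorem lieDer_zero (ℓ : R) (u : E) (φ : ParamCochain F E M R 0) (ℓ' : Fin 0 → R)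
    (u' : Fin 0 → E) : lieDer F A M R ℓ 0 u φ ℓ' u' = actionAt F A M ℓ u (φ ℓ' u') := rfl

/-- Cartan's relation between contraction and Lie derivative, built into the recursion. The bracket
`[u_ℓ v]` occupies the slot of `v`, with parameter `ℓ + m`. The later inductions on arity rest on
this form. -/
theorem app_lieDer {k : ℕ} (ℓ : R) (u : E) (φ : ParamCochain F E M R (k + 1)) (m : R) (v : E) :
    app (lieDer F A M R ℓ (k + 1) u φ) m v = lieDer F A M R ℓ k u (app φ m v)
      - appExt φ (ℓ + m) (bracketAt F A E ℓ u (const F R v)) := by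
  conv_lhs => rw [lieDer]
  simp only [LinearMap.coe_mk, AddHom.coe_mk, app_unapp]
  rfl

/-- A bracket is already an element of `R ⊗ E`, so iterating Lie derivatives requires contraction
with such elements. -/
theorem appExt_lieDer {k : ℕ} (ℓ : R) (u : E) (φ : ParamCochain F E M R (k + 1)) (m : R)
    (P : R ⊗[F] E) :
    appExt (lieDer F A M R ℓ (k + 1) u φ) m P = lieDer F A M R ℓ k u (appExt φ m P)
      - appExt φ (ℓ + m) (bracketAt F A E ℓ u P) := by
  have : appExt (lieDer F A M R ℓ (k + 1) u φ) m = lieDer F A M R ℓ k u ∘ₗ appExt φ m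
      - appExt φ (ℓ + m) ∘ₗ bracketAt F A E ℓ u :=
    linearMap_ext_const fun v => by simp [app_lieDer]
  rw [this]
  rfl

/-- `lieDer` extended to `R ⊗ E`. -/
def lieDerExt (ℓ : R) (k : ℕ) :
    R ⊗[F] E →ₗ[R] ParamCochain F E M R k →ₗ[R] ParamCochain F E M R k :=
  (lieDer F A M R ℓ k).liftBaseChange R

theorem lieDerExt_const (ℓ : R) (k : ℕ) (u : E) :
    lieDerExt (F := F) (A := A) (M := M) ℓ k (const F R u) = lieDer F A M R ℓ k u := by
  simp [lieDerExt, const]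

theorem lieDerExt_zero (ℓ : R) (P : R ⊗[F] E) (φ : ParamCochain F E M R 0) (ℓ' : Fin 0 → R)
    (u' : Fin 0 → E) :
    lieDerExt (A := A) ℓ 0 P φ ℓ' u' = (actionAt F A M ℓ).liftBaseChange R P (φ ℓ' u') := by
  induction P with
  | zero => simp
  | tmul p n => simp [lieDerExt, lieDer_zero]
  | add P Q hP hQ =>
    rw [map_add, map_add, LinearMap.add_apply, LinearMap.add_apply, ← hP, ← hQ]
    rfl

theorem app_lieDerExt {k : ℕ} (ℓ : R) (P : R ⊗[F] E) (φ : ParamCochain F E M R (k + 1)) (m : R)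
    (v : E) :
    app (lieDerExt (A := A) ℓ (k + 1) P φ) m v = lieDerExt (A := A) ℓ k P (app φ m v)
      - appExt φ (ℓ + m) ((bracketAt F A E ℓ).liftBaseChange R P (const F R v)) := by
  induction P with
  | zero => simp; rfl
  | tmul p n => simp [lieDerExt, app_lieDer, smul_sub]
  | add P Q hP hQ =>
    simp only [map_add, LinearMap.add_apply, app_add, hP, hQ]
    abel

/-- In arity `0` this is the module axiom. In higher arity, contracting with `w` reduces it to lower
arity plus terms with double brackets, which match by the Jacobi identity; the mixed terms cancel.
-/
theorem lieDer_lieDer (ℓ m : R) (u v : E) : ∀ (k : ℕ) (φ : ParamCochain F E M R k),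
    lieDer F A M R ℓ k u (lieDer F A M R m k v φ) - lieDer F A M R m k v (lieDer F A M R ℓ k u φ) =
      lieDerExt (A := A) (ℓ + m) k (bracketAt F A E ℓ u (const F R v)) φ
  | 0, φ => by
    ext ℓ' u'
    rw [lieDerExt_zero, ← actionAt_actionAt]
    rfl
  | k + 1, φ => by
    refine ext_app fun n w => ?_
    -- The double brackets sit in a slot with parameter `m + (ℓ + n)` or `ℓ + (m + n)`; these must
    -- be identified before the terms can be compared.
    rw [app_sub, app_lieDer, app_lieDer, app_lieDer, app_lieDer, app_lieDerExt, appExt_lieDer,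
      appExt_lieDer, map_sub, map_sub, ← lieDer_lieDer ℓ m u v k, ← bracketAt_bracketAt, map_sub,
      add_assoc, ← add_assoc m ℓ n, add_comm m ℓ, add_assoc]
    abel

variable (F A E M R) in
/-- The Leibniz differential, defined through Cartan's formula. -/
def leibnizD : ∀ k : ℕ, ParamCochain F E M R k →ₗ[R] ParamCochain F E M R (k + 1)
  | 0 =>
    { toFun φ := unapp fun ℓ =>
        { toFun u := lieDer F A M R ℓ 0 u φ
          map_add' u v := by simp
          map_smul' c u := by simp }
      map_add' φ ψ := ext_app fun ℓ u => by simp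
      map_smul' c φ := ext_app fun ℓ u => by simp }
  | k + 1 =>
    { toFun φ := unapp fun ℓ =>
        { toFun u := lieDer F A M R ℓ (k + 1) u φ - leibnizD k (app φ ℓ u)
          map_add' u v := by simp only [map_add, LinearMap.add_apply]; abel
          map_smul' c u := by
            have : ∀ ψ : ParamCochain F E M R k, leibnizD k (c • ψ) = c • leibnizD k ψ :=
              fun ψ => ((leibnizD k).restrictScalars F).map_smul c ψ
            simp [this, smul_sub] }
      map_add' φ ψ := ext_app fun ℓ u => by
        simp
        abel
      map_smul' c φ := ext_app fun ℓ u => by simp [smul_sub] }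

theorem app_leibnizD_zero (φ : ParamCochain F E M R 0) (ℓ : R) (u : E) :
    app (leibnizD F A E M R 0 φ) ℓ u = lieDer F A M R ℓ 0 u φ := by
  conv_lhs => rw [leibnizD]
  simp only [LinearMap.coe_mk, AddHom.coe_mk, app_unapp]

theorem app_leibnizD {k : ℕ} (φ : ParamCochain F E M R (k + 1)) (ℓ : R) (u : E) :
    app (leibnizD F A E M R (k + 1) φ) ℓ u =
      lieDer F A M R ℓ (k + 1) u φ - leibnizD F A E M R k (app φ ℓ u) := by
  conv_lhs => rw [leibnizD]
  simp only [LinearMap.coe_mk, AddHom.coe_mk, app_unapp]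

theorem appExt_leibnizD_zero (φ : ParamCochain F E M R 0) (ℓ : R) (P : R ⊗[F] E) :
    appExt (leibnizD F A E M R 0 φ) ℓ P = lieDerExt (A := A) ℓ 0 P φ := by
  have : appExt (leibnizD F A E M R 0 φ) ℓ = (lieDerExt (A := A) ℓ 0).flip φ :=
    linearMap_ext_const fun u => by simp [app_leibnizD_zero, lieDerExt_const]
  rw [this]
  rfl

theorem appExt_leibnizD {k : ℕ} (φ : ParamCochain F E M R (k + 1)) (ℓ : R) (P : R ⊗[F] E) :
    appExt (leibnizD F A E M R (k + 1) φ) ℓ P =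
      lieDerExt (A := A) ℓ (k + 1) P φ - leibnizD F A E M R k (appExt φ ℓ P) := by
  have : appExt (leibnizD F A E M R (k + 1) φ) ℓ = (lieDerExt (A := A) ℓ (k + 1)).flip φ
      - leibnizD F A E M R k ∘ₗ appExt φ ℓ :=
    linearMap_ext_const fun u => by simp [app_leibnizD, lieDerExt_const]
  rw [this]
  rfl

/-- After contraction with `v`, Cartan's formula turns the claim into the commutator of two Lie
derivatives plus the same claim for `ι_v φ`. -/
theorem lieDer_leibnizD (ℓ : R) (u : E) : ∀ (k : ℕ) (φ : ParamCochain F E M R k),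
    lieDer F A M R ℓ (k + 1) u (leibnizD F A E M R k φ) =
      leibnizD F A E M R k (lieDer F A M R ℓ k u φ)
  | 0, φ => by
    refine ext_app fun m v => ?_
    rw [app_lieDer, app_leibnizD_zero, app_leibnizD_zero, appExt_leibnizD_zero, ← lieDer_lieDer,
      sub_sub_cancel]
  | k + 1, φ => by
    refine ext_app fun m v => ?_
    rw [app_lieDer, app_leibnizD, app_leibnizD, appExt_leibnizD, ← lieDer_lieDer, app_lieDer,
      map_sub, map_sub, lieDer_leibnizD ℓ u k]
    abel

/-- Contraction gives `ι d d = L d - d (L - d ι) = [L, d] + d d ι`; the first term vanishes and the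
second has lower arity. -/
theorem leibnizD_leibnizD : ∀ (k : ℕ) (φ : ParamCochain F E M R k),
    leibnizD F A E M R (k + 1) (leibnizD F A E M R k φ) = 0
  | 0, φ => by
    refine ext_app fun ℓ u => ?_
    rw [app_leibnizD, app_leibnizD_zero, lieDer_leibnizD, sub_self]
    rfl
  | k + 1, φ => by
    refine ext_app fun ℓ u => ?_
    rw [app_leibnizD, app_leibnizD, lieDer_leibnizD, map_sub, leibnizD_leibnizD k, sub_zero,
      sub_self]
    rfl

end Differential

/-! ### Families that vanish in the quotient. -/

section Null

variable {F A E M : Type*} [Field F] [CommRing A] [Algebra F A] [DiffAlgebra F A]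
  [AddCommGroup E] [Module F E] [Module A E] [IsScalarTower F A E] [DiffModule F A E]
  [LieConformalAlgebroid F A E]
  [AddCommGroup M] [Module F M] [Module A M] [IsScalarTower F A M] [DiffModule F A M]
  [LCAdModule F A E M]
variable {R : Type*} [CommRing R] [Algebra F R]

variable (F A E M) in
/-- The cochains whose value at `ℓ₁, …, ℓₖ` lies in the image of `∂ + s + ℓ₁ + ⋯ + ℓₖ`. -/
def nullCochain (s : R) (k : ℕ) : Submodule R (ParamCochain F E M R k) where
  carrier := {φ | ∀ ℓ u, φ ℓ u ∈ delRange F A M (s + ∑ i, ℓ i)}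
  add_mem' h h' ℓ u := Submodule.add_mem _ (h ℓ u) (h' ℓ u)
  zero_mem' _ _ := Submodule.zero_mem _
  smul_mem' c _ h ℓ u := Submodule.smul_mem _ c (h ℓ u)

/-- The offset `s` collects the parameters of slots already filled, so a contraction moves `ℓ` out
of the sum and into `s`. -/
theorem mem_nullCochain_iff_app {s : R} {k : ℕ} {φ : ParamCochain F E M R (k + 1)} :
    φ ∈ nullCochain F A E M s (k + 1) ↔ ∀ ℓ u, app φ ℓ u ∈ nullCochain F A E M (s + ℓ) k := by
  constructor
  · intro h ℓ u ℓ' u'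
    have := h (Fin.cons ℓ ℓ') (Fin.cons u u')
    rwa [Fin.sum_cons, ← add_assoc] at this
  · intro h ℓ u
    have := h (ℓ 0) (u 0) (Fin.tail ℓ) (Fin.tail u)
    rw [← apply_eq_app, add_assoc] at this
    rw [Fin.sum_univ_succ]
    exact this

theorem appExt_mem_nullCochain {s : R} {k : ℕ} {φ : ParamCochain F E M R (k + 1)}
    (h : φ ∈ nullCochain F A E M s (k + 1)) (ℓ : R) (P : R ⊗[F] E) :
    appExt φ ℓ P ∈ nullCochain F A E M (s + ℓ) k := by
  induction P with
  | zero => rw [map_zero]; exact Submodule.zero_mem _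
  | tmul p n =>
    simp only [appExt, LinearMap.liftBaseChange_tmul]
    exact Submodule.smul_mem _ _ (mem_nullCochain_iff_app.1 h ℓ n)
  | add P Q hP hQ => rw [map_add]; exact Submodule.add_mem _ hP hQ

/-- The action `u_ℓ` turns `s + ∂` into `ℓ + s + ∂`, while a bracket term contracts with total
parameter `ℓ + m`; both raise the offset by `ℓ`. -/
theorem lieDer_mem_nullCochain (ℓ : R) (u : E) : ∀ (k : ℕ) (s : R) {φ : ParamCochain F E M R k},
    φ ∈ nullCochain F A E M s k → lieDer F A M R ℓ k u φ ∈ nullCochain F A E M (s + ℓ) k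
  | 0, s, φ, h => fun ℓ' u' => by
    have := evalAt_mem_delRange (action_del (F := F) (A := A) (M := M) u) ℓ (h ℓ' u')
    rw [show s + ℓ + ∑ i, ℓ' i = ℓ + (s + ∑ i, ℓ' i) by ring]
    exact this
  | k + 1, s, φ, h => mem_nullCochain_iff_app.2 fun m v => by
    have h1 := lieDer_mem_nullCochain ℓ u k _ (mem_nullCochain_iff_app.1 h m v)
    have h2 := appExt_mem_nullCochain h (ℓ + m) (bracketAt F A E ℓ u (const F R v))
    rw [app_lieDer]
    rw [add_right_comm] at h1
    rw [← add_assoc] at h2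
    exact Submodule.sub_mem _ h1 h2

/-- This is the source of independence of the lift: two lifts of a cochain differ by a null family.
-/
theorem leibnizD_mem_nullCochain : ∀ (k : ℕ) (s : R) {φ : ParamCochain F E M R k},
    φ ∈ nullCochain F A E M s k → leibnizD F A E M R k φ ∈ nullCochain F A E M s (k + 1)
  | 0, s, φ, h => mem_nullCochain_iff_app.2 fun ℓ u => by
    rw [app_leibnizD_zero]
    exact lieDer_mem_nullCochain ℓ u 0 s h
  | k + 1, s, φ, h => mem_nullCochain_iff_app.2 fun ℓ u => by
    rw [app_leibnizD]
    exact Submodule.sub_mem _ (lieDer_mem_nullCochain ℓ u _ s h)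
      (leibnizD_mem_nullCochain k _ (mem_nullCochain_iff_app.1 h ℓ u))

end Null

/-! ### Compatibility of the calculus with change of the parameter ring. -/

section Naturality

variable {F A E M : Type*} [Field F] [CommRing A] [Algebra F A] [DiffAlgebra F A]
  [AddCommGroup E] [Module F E] [Module A E] [IsScalarTower F A E] [DiffModule F A E]
  [LieConformalAlgebroid F A E]
  [AddCommGroup M] [Module F M] [Module A M] [IsScalarTower F A M] [DiffModule F A M]
  [LCAdModule F A E M]
variable {R S : Type*} [CommRing R] [Algebra F R] [CommRing S] [Algebra F S]

/-- `ψ` is the cochain `φ` after the change of rings `σ`. -/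
def IsBaseChange (σ : R →ₐ[F] S) {k : ℕ} (φ : ParamCochain F E M R k)
    (ψ : ParamCochain F E M S k) : Prop :=
  ∀ ℓ u, ψ (σ ∘ ℓ) u = substVar F σ (φ ℓ u)

theorem isBaseChange_iff_app {σ : R →ₐ[F] S} {k : ℕ} {φ : ParamCochain F E M R (k + 1)}
    {ψ : ParamCochain F E M S (k + 1)} :
    IsBaseChange σ φ ψ ↔ ∀ ℓ u, IsBaseChange σ (app φ ℓ u) (app ψ (σ ℓ) u) := by
  constructor
  · intro h ℓ u ℓ' u'
    rw [app_apply, app_apply, ← h, Fin.comp_cons]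
  · intro h ℓ u
    have := h (ℓ 0) (u 0) (Fin.tail ℓ) (Fin.tail u)
    rw [← apply_eq_app] at this
    rw [← this, apply_eq_app]
    rfl

theorem IsBaseChange.appExt {σ : R →ₐ[F] S} {k : ℕ} {φ : ParamCochain F E M R (k + 1)}
    {ψ : ParamCochain F E M S (k + 1)} (h : IsBaseChange σ φ ψ) (ℓ : R) (P : R ⊗[F] E) :
    IsBaseChange σ (appExt φ ℓ P) (appExt ψ (σ ℓ) (substVar F σ P)) := by
  intro ℓ' u'
  induction P with
  | zero => simp
  | tmul p n =>
    simp only [LCAd.appExt, substVar_tmul, LinearMap.liftBaseChange_tmul,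
      ParamCochain.smul_apply, substVar_smul]
    rw [isBaseChange_iff_app.1 h]
  | add P Q hP hQ => simp only [map_add, ParamCochain.add_apply, hP, hQ]

theorem IsBaseChange.sub {σ : R →ₐ[F] S} {k : ℕ} {φ φ' : ParamCochain F E M R k}
    {ψ ψ' : ParamCochain F E M S k} (h : IsBaseChange σ φ ψ) (h' : IsBaseChange σ φ' ψ') :
    IsBaseChange σ (φ - φ') (ψ - ψ') := by
  intro ℓ u
  rw [ParamCochain.sub_apply, ParamCochain.sub_apply, map_sub, h, h']

theorem IsBaseChange.lieDer {σ : R →ₐ[F] S} (ℓ : R) (u : E) : ∀ {k : ℕ}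
    {φ : ParamCochain F E M R k} {ψ : ParamCochain F E M S k}, IsBaseChange σ φ ψ →
    IsBaseChange σ (lieDer F A M R ℓ k u φ) (lieDer F A M S (σ ℓ) k u ψ)
  | 0, φ, ψ, h => fun ℓ' u' => by
    rw [lieDer_zero, lieDer_zero, h, actionAt, actionAt, evalAtHom_apply, evalAtHom_apply,
      substVar_evalAt]
  | k + 1, φ, ψ, h => isBaseChange_iff_app.2 fun m v => by
    rw [app_lieDer, app_lieDer]
    refine (IsBaseChange.lieDer ℓ u (isBaseChange_iff_app.1 h m v)).sub ?_
    have := h.appExt (ℓ + m) (bracketAt F A E ℓ u (const F R v))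
    rwa [bracketAt, evalAtHom_apply, substVar_evalAt, substVar_const, map_add] at this

/-- For families coming from polynomials, this makes the values of `d` at the free variables
determine its values at all parameters. -/
theorem IsBaseChange.leibnizD {σ : R →ₐ[F] S} : ∀ {k : ℕ}
    {φ : ParamCochain F E M R k} {ψ : ParamCochain F E M S k}, IsBaseChange σ φ ψ →
    IsBaseChange σ (leibnizD F A E M R k φ) (leibnizD F A E M S k ψ)
  | 0, φ, ψ, h => isBaseChange_iff_app.2 fun m v => by
    rw [app_leibnizD_zero, app_leibnizD_zero]
    exact h.lieDer m v
  | k + 1, φ, ψ, h => isBaseChange_iff_app.2 fun m v => by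
    rw [app_leibnizD, app_leibnizD]
    exact (h.lieDer m v).sub (IsBaseChange.leibnizD (isBaseChange_iff_app.1 h m v))

end Naturality

/-! ### Skewsymmetry modulo null families. -/

section Skew

variable {F A E M : Type*} [Field F] [CommRing A] [Algebra F A] [DiffAlgebra F A]
  [AddCommGroup E] [Module F E] [Module A E] [IsScalarTower F A E] [DiffModule F A E]
  [LieConformalAlgebroid F A E]
  [AddCommGroup M] [Module F M] [Module A M] [IsScalarTower F A M] [DiffModule F A M]
  [LCAdModule F A E M]
variable {R : Type*} [CommRing R] [Algebra F R]

variable (A) in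
/-- Skewsymmetry modulo `nullCochain` under the exchange of neighbouring slots. -/
def IsSkew : ∀ {k : ℕ}, R → ParamCochain F E M R k → Prop
  | 0, _, _ => True
  | 1, _, _ => True
  | k + 2, s, φ => (∀ ℓ u, IsSkew (s + ℓ) (app φ ℓ u)) ∧
      ∀ ℓ m u v, app (app φ ℓ u) m v + app (app φ m v) ℓ u ∈ nullCochain F A E M (s + ℓ + m) k

theorem IsSkew.app : ∀ {k : ℕ} {s : R} {φ : ParamCochain F E M R (k + 1)}, IsSkew A s φ →
    ∀ ℓ u, IsSkew A (s + ℓ) (app φ ℓ u)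
  | 0, _, _, _ => fun _ _ => trivial
  | _ + 1, _, _, h => h.1

theorem IsSkew.add : ∀ {k : ℕ} {s : R} {φ ψ : ParamCochain F E M R k}, IsSkew A s φ →
    IsSkew A s ψ → IsSkew A s (φ + ψ)
  | 0, _, _, _, _, _ => trivial
  | 1, _, _, _, _, _ => trivial
  | k + 2, s, φ, ψ, h, h' => by
    refine ⟨fun ℓ u => (h.1 ℓ u).add (h'.1 ℓ u), fun ℓ m u v => ?_⟩
    have := Submodule.add_mem _ (h.2 ℓ m u v) (h'.2 ℓ m u v)
    rw [add_add_add_comm] at this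
    exact this

theorem IsSkew.smul (c : R) : ∀ {k : ℕ} {s : R} {φ : ParamCochain F E M R k}, IsSkew A s φ →
    IsSkew A s (c • φ)
  | 0, _, _, _ => trivial
  | 1, _, _, _ => trivial
  | k + 2, s, φ, h => by
    refine ⟨fun ℓ u => (h.1 ℓ u).smul c, fun ℓ m u v => ?_⟩
    have := Submodule.smul_mem _ c (h.2 ℓ m u v)
    rw [smul_add] at this
    exact this

theorem IsSkew.sub {k : ℕ} {s : R} {φ ψ : ParamCochain F E M R k} (h : IsSkew A s φ)
    (h' : IsSkew A s ψ) : IsSkew A s (φ - ψ) := by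
  rw [sub_eq_add_neg, ← neg_one_smul R ψ]
  exact h.add (h'.smul _)

theorem IsSkew.appExt {k : ℕ} {s : R} {φ : ParamCochain F E M R (k + 1)} (h : IsSkew A s φ)
    (ℓ : R) (P : R ⊗[F] E) : IsSkew A (s + ℓ) (appExt φ ℓ P) := by
  induction P with
  | zero =>
    have := (h.app ℓ 0)
    rwa [map_zero] at this ⊢
  | tmul p n =>
    simp only [LCAd.appExt, LinearMap.liftBaseChange_tmul]
    exact (h.app ℓ n).smul p
  | add P Q hP hQ => rw [map_add]; exact hP.add hQ

theorem IsSkew.app_appExt_add {k : ℕ} {s : R} {φ : ParamCochain F E M R (k + 2)}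
    (h : IsSkew A s φ) (ℓ : R) (P : R ⊗[F] E) (m : R) (v : E) :
    LCAd.app (LCAd.appExt φ ℓ P) m v + LCAd.appExt (LCAd.app φ m v) ℓ P
      ∈ nullCochain F A E M (s + ℓ + m) k := by
  induction P with
  | zero =>
    rw [map_zero, map_zero, add_zero]
    exact Submodule.zero_mem _
  | tmul p n =>
    simp only [LCAd.appExt, LinearMap.liftBaseChange_tmul, app_smul, ← smul_add]
    exact Submodule.smul_mem _ _ (h.2 ℓ m n v)
  | add P Q hP hQ =>
    have := Submodule.add_mem _ hP hQ
    rw [add_add_add_comm] at this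
    rw [map_add, map_add, app_add]
    exact this

theorem IsSkew.lieDer (ℓ : R) (u : E) : ∀ {k : ℕ} {s : R} {φ : ParamCochain F E M R k},
    IsSkew A s φ → IsSkew A (s + ℓ) (lieDer F A M R ℓ k u φ)
  | 0, _, _, _ => trivial
  | 1, _, _, _ => trivial
  | k + 2, s, φ, h => by
    refine ⟨fun m v => ?_, fun m n v w => ?_⟩
    · rw [app_lieDer]
      have h1 := IsSkew.lieDer ℓ u (h.app m v)
      have h2 := h.appExt (ℓ + m) (bracketAt F A E ℓ u (const F R v))
      rw [add_right_comm] at h1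
      rw [← add_assoc] at h2
      exact h1.sub h2
    -- The exchange of `v` and `w` leaves three groups of terms: the Lie derivative of the exchanged
    -- pair, and the terms where the bracket replaces `v` or `w`, each exchanged with the other
    -- argument.
    · have h1 := lieDer_mem_nullCochain (A := A) ℓ u _ _ (h.2 m n v w)
      have h2 := h.app_appExt_add (ℓ + m) (bracketAt F A E ℓ u (const F R v)) n w
      have h3 := h.app_appExt_add (ℓ + n) (bracketAt F A E ℓ u (const F R w)) m v
      rw [show s + m + n + ℓ = s + ℓ + m + n by ring] at h1
      rw [show s + (ℓ + m) + n = s + ℓ + m + n by ring] at h2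
      rw [show s + (ℓ + n) + m = s + ℓ + m + n by ring] at h3
      have := Submodule.sub_mem _ (Submodule.sub_mem _ h1 h2) h3
      convert this using 1
      rw [app_lieDer, app_lieDer, app_sub, app_sub, app_lieDer, app_lieDer, map_add]
      abel

end Skew

/-! ### Compatibility with `∂`, and skewsymmetry of the differential. -/

section DelCompat

variable {F A E M : Type*} [Field F] [CommRing A] [Algebra F A] [DiffAlgebra F A]
  [AddCommGroup E] [Module F E] [Module A E] [IsScalarTower F A E] [DiffModule F A E]
  [LieConformalAlgebroid F A E]
  [AddCommGroup M] [Module F M] [Module A M] [IsScalarTower F A M] [DiffModule F A M]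
  [LCAdModule F A E M]
variable {R : Type*} [CommRing R] [Algebra F R]

variable (A) in
/-- `φ_ℓ(∂u) = -ℓ φ_ℓ(u)` in the first slot, modulo `nullCochain`. -/
def IsSesqFirst {k : ℕ} (s : R) (φ : ParamCochain F E M R (k + 1)) : Prop :=
  ∀ ℓ u, app φ ℓ (del F A u) + ℓ • app φ ℓ u ∈ nullCochain F A E M (s + ℓ) k

variable (A) in
/-- `φ_ℓ(∂u) = -ℓ φ_ℓ(u)` in every slot, modulo `nullCochain`. -/
def IsSesq : ∀ {k : ℕ}, R → ParamCochain F E M R k → Prop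
  | 0, _, _ => True
  | _ + 1, s, φ => IsSesqFirst A s φ ∧ ∀ ℓ u, IsSesq (s + ℓ) (app φ ℓ u)

variable (A) in
/-- `φ_ℓ(∂u) = -ℓ φ_ℓ(u)` in the last slot, modulo `nullCochain`. -/
def IsSesqLast : ∀ {k : ℕ}, R → ParamCochain F E M R k → Prop
  | 0, _, _ => True
  | 1, s, φ => IsSesqFirst A s φ
  | _ + 2, s, φ => ∀ ℓ u, IsSesqLast (s + ℓ) (app φ ℓ u)

theorem IsSesq.last : ∀ {k : ℕ} {s : R} {φ : ParamCochain F E M R k}, IsSesq A s φ →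
    IsSesqLast A s φ
  | 0, _, _, _ => trivial
  | 1, _, _, h => h.1
  | _ + 2, _, _, h => fun ℓ u => IsSesq.last (h.2 ℓ u)

/-- In a slot with parameter `ℓ` the operator `∂` acts as `-ℓ`, hence `t + ∂` acts as `t - ℓ`. -/
theorem IsSesqFirst.appExt_shiftDel {k : ℕ} {s : R} {φ : ParamCochain F E M R (k + 1)}
    (h : IsSesqFirst A s φ) (ℓ t : R) (P : R ⊗[F] E) :
    appExt φ ℓ (shiftDel A t P) - (t - ℓ) • appExt φ ℓ P ∈ nullCochain F A E M (s + ℓ) k := by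
  induction P with
  | zero => simp only [map_zero, smul_zero, sub_zero]; exact Submodule.zero_mem _
  | tmul p n =>
    have := Submodule.smul_mem _ p (h ℓ n)
    convert this using 1
    rw [shiftDel_tmul, map_add]
    simp only [appExt, LinearMap.liftBaseChange_tmul]
    module
  | add P Q hP hQ =>
    have := Submodule.add_mem _ hP hQ
    convert this using 1
    simp only [map_add]
    module

theorem const_del (u : E) : const F R (del F A u) = shiftDel A 0 (const F R u) := by
  rw [shiftDel_const, zero_smul, zero_add]

theorem bracketAt_const_del (ℓ : R) (u v : E) : bracketAt F A E ℓ u (const F R (del F A v)) =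
    shiftDel A ℓ (bracketAt F A E ℓ u (const F R v)) := by
  rw [const_del, bracketAt, evalAtHom_apply, evalAt_shiftDel (bracket_del u), add_zero]

theorem actionAt_del (ℓ : R) (u : E) (P : R ⊗[F] M) :
    actionAt F A M ℓ (del F A u) P = -(ℓ • actionAt F A M ℓ u P) := by
  have : actionAt F A M ℓ (del F A u) = -(ℓ • actionAt F A M ℓ u) := by
    refine linearMap_ext_const fun m => ?_
    rw [LinearMap.neg_apply, LinearMap.smul_apply, actionAt, evalAtHom_apply, evalAtHom_apply,
      evalAt_const, evalAt_const, del_action, map_neg, substVar_smul, Polynomial.aeval_X]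
  rw [this]
  rfl

theorem IsSesqLast.sub : ∀ {k : ℕ} {s : R} {φ ψ : ParamCochain F E M R k}, IsSesqLast A s φ →
    IsSesqLast A s ψ → IsSesqLast A s (φ - ψ)
  | 0, _, _, _, _, _ => trivial
  | 1, _, φ, ψ, h, h' => fun ℓ u => by
    have := Submodule.sub_mem _ (h ℓ u) (h' ℓ u)
    convert this using 1
    rw [app_sub, app_sub, smul_sub]
    abel
  | _ + 2, _, _, _, h, h' => fun ℓ u => (h ℓ u).sub (h' ℓ u)

theorem IsSesqLast.add : ∀ {k : ℕ} {s : R} {φ ψ : ParamCochain F E M R k}, IsSesqLast A s φ →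
    IsSesqLast A s ψ → IsSesqLast A s (φ + ψ)
  | 0, _, _, _, _, _ => trivial
  | 1, _, φ, ψ, h, h' => fun ℓ u => by
    have := Submodule.add_mem _ (h ℓ u) (h' ℓ u)
    convert this using 1
    rw [app_add, app_add, smul_add]
    abel
  | _ + 2, _, _, _, h, h' => fun ℓ u => (h ℓ u).add (h' ℓ u)

theorem IsSesqLast.smul (c : R) : ∀ {k : ℕ} {s : R} {φ : ParamCochain F E M R k},
    IsSesqLast A s φ → IsSesqLast A s (c • φ)
  | 0, _, _, _ => trivial
  | 1, _, φ, h => fun ℓ u => by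
    have := Submodule.smul_mem _ c (h ℓ u)
    rw [smul_add, smul_comm] at this
    exact this
  | _ + 2, _, _, h => fun ℓ u => (h ℓ u).smul c

theorem IsSesqLast.appExt {k : ℕ} {s : R} {φ : ParamCochain F E M R (k + 2)}
    (h : IsSesqLast A s φ) (ℓ : R) (P : R ⊗[F] E) : IsSesqLast A (s + ℓ) (appExt φ ℓ P) := by
  induction P with
  | zero =>
    have := (h ℓ 0)
    rwa [map_zero] at this ⊢
  | tmul p n =>
    simp only [LCAd.appExt, LinearMap.liftBaseChange_tmul]
    exact (h ℓ n).smul p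
  | add P Q hP hQ => rw [map_add]; exact hP.add hQ

/-- With one slot left, `[u_ℓ ∂v] = (ℓ + ∂)[u_ℓ v]` sits in a slot with parameter `ℓ + m`, where `ℓ
+ ∂` acts as `-m`, the factor required for `v`. -/
theorem IsSesqLast.lieDer (ℓ : R) (u : E) : ∀ {k : ℕ} {s : R} {φ : ParamCochain F E M R k},
    IsSesqLast A s φ → IsSesqLast A (s + ℓ) (lieDer F A M R ℓ k u φ)
  | 0, _, _, _ => trivial
  | 1, s, φ, h => fun m v => by
    have h1 := lieDer_mem_nullCochain (A := A) ℓ u _ _ (h m v)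
    have h2 := IsSesqFirst.appExt_shiftDel h (ℓ + m) ℓ (bracketAt F A E ℓ u (const F R v))
    rw [add_right_comm] at h1
    rw [← add_assoc] at h2
    have := Submodule.sub_mem _ h1 h2
    convert this using 1
    rw [app_lieDer, app_lieDer, map_add, map_smul, bracketAt_const_del]
    module
  | k + 2, s, φ, h => fun m v => by
    rw [app_lieDer]
    have h1 := IsSesqLast.lieDer ℓ u (h m v)
    have h2 := h.appExt (ℓ + m) (bracketAt F A E ℓ u (const F R v))
    rw [add_right_comm] at h1
    rw [← add_assoc] at h2
    exact h1.sub h2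

/-- The recursion removes first slots, so the last slot survives to the base case, where the claim
is the axiom `(∂u)_λ m = -λ (u_λ m)`. The other slots are recovered later from skewsymmetry. -/
theorem IsSesqLast.leibnizD : ∀ {k : ℕ} {s : R} {φ : ParamCochain F E M R k},
    IsSesqLast A s φ → IsSesqLast A s (leibnizD F A E M R k φ)
  | 0, s, φ, h => fun ℓ u => by
    rw [app_leibnizD_zero, app_leibnizD_zero]
    intro ℓ' u'
    rw [ParamCochain.add_apply, ParamCochain.smul_apply, lieDer_zero, lieDer_zero, actionAt_del,
      neg_add_cancel]
    exact Submodule.zero_mem _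
  | 1, s, φ, h => fun ℓ u => by
    rw [app_leibnizD]
    exact (IsSesqLast.lieDer ℓ u h).sub (IsSesqLast.leibnizD (k := 0) trivial)
  | k + 2, s, φ, h => fun ℓ u => by
    rw [app_leibnizD]
    exact (IsSesqLast.lieDer ℓ u h).sub (IsSesqLast.leibnizD (h ℓ u))

/-- Inside a slot with parameter `ℓ + m`, the operator `-m - ∂` acts as `-m + (ℓ + m) = ℓ`. So the
reflected polynomial taken at `m` has the same effect as the original taken at `ℓ`. -/
theorem IsSesqFirst.appExt_reflect {k : ℕ} {s : R} {φ : ParamCochain F E M R (k + 1)}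
    (h : IsSesqFirst A s φ) (ℓ m : R) (Q : Polynomial F ⊗[F] E) :
    appExt φ (ℓ + m) (substVar F (Polynomial.aeval m) (reflect F A Q))
        - appExt φ (ℓ + m) (substVar F (Polynomial.aeval ℓ) Q)
      ∈ nullCochain F A E M (s + (ℓ + m)) k := by
  induction Q with
  | zero => simp only [map_zero, sub_zero]; exact Submodule.zero_mem _
  | add P Q hP hQ =>
    have := Submodule.add_mem _ hP hQ
    convert this using 1
    simp only [map_add]
    abel
  | tmul p e =>
    -- One factor `-(λ + ∂)` at `λ = m` contributes one factor `ℓ`; the general polynomial follows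
    -- by induction on degree.
    have step : ∀ Q' : Polynomial F ⊗[F] E,
        appExt φ (ℓ + m) (substVar F (Polynomial.aeval m) ((-(lamDel F A Polynomial.X : Module.End F (Polynomial F ⊗[F] E)))
            Q'))
          - ℓ • appExt φ (ℓ + m) (substVar F (Polynomial.aeval m) Q')
        ∈ nullCochain F A E M (s + (ℓ + m)) k := by
      intro Q'
      have := Submodule.neg_mem _
        (h.appExt_shiftDel (ℓ + m) m (substVar F (Polynomial.aeval m) Q'))
      convert this using 1
      rw [LinearMap.neg_apply, lamDel_eq_shiftDel, map_neg, map_neg, substVar_shiftDel,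
        Polynomial.aeval_X]
      module
    have key : ∀ p : Polynomial F,
        appExt φ (ℓ + m) (substVar F (Polynomial.aeval m)
          (Polynomial.aeval
            (-(lamDel F A Polynomial.X : Module.End F (Polynomial F ⊗[F] E))) p
            (const F (Polynomial F) e)))
          - Polynomial.aeval ℓ p • app φ (ℓ + m) e
        ∈ nullCochain F A E M (s + (ℓ + m)) k := by
      intro p
      induction p using Polynomial.induction_on with
      | C a =>
        rw [Polynomial.aeval_C, Polynomial.aeval_C, Module.algebraMap_end_apply, map_smul,
          substVar_const, algebraMap_smul, LinearMap.map_smul_of_tower, appExt_const, sub_self]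
        exact Submodule.zero_mem _
      | add p q hp hq =>
        have := Submodule.add_mem _ hp hq
        convert this using 1
        simp only [map_add, LinearMap.add_apply]
        module
      | monomial n a hn =>
        have := Submodule.add_mem _ (step ((Polynomial.aeval
          (-(lamDel F A Polynomial.X : Module.End F (Polynomial F ⊗[F] E))) (Polynomial.C a * Polynomial.X ^ n))
            (const F (Polynomial F) e))) (Submodule.smul_mem _ ℓ hn)
        convert this using 1
        rw [pow_succ', mul_left_comm, map_mul, Polynomial.aeval_X, Module.End.mul_apply,
          map_mul (Polynomial.aeval ℓ), Polynomial.aeval_X]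
        module
    have := key p
    simp only [reflect, TensorProduct.lift.tmul, LinearMap.mk₂_apply, substVar_tmul]
    convert this using 2
    rw [appExt, LinearMap.liftBaseChange_tmul]

theorem IsSesqFirst.appExt_bracketAt {k : ℕ} {s : R} {φ : ParamCochain F E M R (k + 1)}
    (h : IsSesqFirst A s φ) (ℓ m : R) (u v : E) :
    appExt φ (ℓ + m) (bracketAt F A E ℓ u (const F R v))
        + appExt φ (ℓ + m) (bracketAt F A E m v (const F R u))
      ∈ nullCochain F A E M (s + (ℓ + m)) k := by
  have := Submodule.neg_mem _ (h.appExt_reflect ℓ m (LieConformalAlgebroid.bracket A u v))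
  convert this using 1
  rw [bracketAt, bracketAt, evalAtHom_apply, evalAtHom_apply, evalAt_const, evalAt_const,
    (LieConformalAlgebroid.lca (F := F) (A := A) (E := E)).skew u v, map_neg, map_neg]
  abel

/-- Contracting `dφ` with `u` and `v` in both orders and adding, the Lie derivatives cancel. What
remains is minus the sum of the terms with `[u_ℓ v]` and `[v_m u]`, null by skewsymmetry of the
bracket, and `d` of the exchange relation for `φ`. -/
theorem IsSkew.leibnizD : ∀ {k : ℕ} {s : R} {φ : ParamCochain F E M R k},
    IsSkew A s φ → IsSesq A s φ → IsSkew A s (leibnizD F A E M R k φ)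
  | 0, _, _, _, _ => trivial
  | 1, s, φ, h, h' => by
    refine ⟨fun _ _ => trivial, fun ℓ m u v => ?_⟩
    have := Submodule.neg_mem _ (h'.1.appExt_bracketAt ℓ m u v)
    rw [← add_assoc] at this
    convert this using 1
    rw [app_leibnizD, app_leibnizD, app_sub, app_sub, app_lieDer, app_lieDer, app_leibnizD_zero,
      app_leibnizD_zero, add_comm m ℓ]
    abel
  | k + 2, s, φ, h, h' => by
    refine ⟨fun ℓ u => ?_, fun ℓ m u v => ?_⟩
    · rw [app_leibnizD]
      exact (h.lieDer ℓ u).sub ((h.app ℓ u).leibnizD (h'.2 ℓ u))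
    · have h1 := Submodule.neg_mem _ (h'.1.appExt_bracketAt ℓ m u v)
      have h2 := leibnizD_mem_nullCochain (A := A) _ _ (h.2 ℓ m u v)
      rw [← add_assoc] at h1
      have := Submodule.add_mem _ h1 h2
      convert this using 1
      rw [app_leibnizD, app_leibnizD, app_sub, app_sub, app_lieDer, app_lieDer, app_leibnizD,
        app_leibnizD, add_comm m ℓ, map_add]
      abel

end DelCompat

/-! ### The substitution `x = r + ∂` on coefficients from `A`. -/

section CoefEval

variable {F : Type*} [Field F] {A : Type*} [CommRing A] [Algebra F A] [DiffAlgebra F A]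
variable {M : Type*} [AddCommGroup M] [Module F M] [Module A M] [IsScalarTower F A M]
  [DiffModule F A M]
variable {R S : Type*} [CommRing R] [Algebra F R] [CommRing S] [Algebra F S]

variable (F A) in
/-- `q(x) ↦ q(r + ∂)`, acting on `R[x] ⊗ A`. -/
def shiftEval (r : R) : Polynomial R →ₐ[R] Module.End (Polynomial R) (Polynomial R ⊗[F] A) :=
  Polynomial.aeval (shiftDel A (Polynomial.C r))

theorem shiftEval_X_mul (r : R) (q : Polynomial R) (γ : Polynomial R ⊗[F] A) :
    shiftEval F A r (Polynomial.X * q) γ = shiftDel A (Polynomial.C r) (shiftEval F A r q γ) := by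
  rw [map_mul, shiftEval, Polynomial.aeval_X]
  rfl

theorem shiftEval_C (r b : R) (γ : Polynomial R ⊗[F] A) :
    shiftEval F A r (Polynomial.C b) γ = Polynomial.C b • γ := by
  rw [shiftEval, Polynomial.aeval_C, Module.algebraMap_end_apply, ← Polynomial.algebraMap_eq,
    algebraMap_smul]

theorem shiftEval_C_mul (r b : R) (q : Polynomial R) (γ : Polynomial R ⊗[F] A) :
    shiftEval F A r (Polynomial.C b * q) γ = Polynomial.C b • shiftEval F A r q γ := by
  rw [map_mul, Module.End.mul_apply, shiftEval_C]

variable (M) in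
/-- For `γ ∈ R[x] ⊗ A`, the map `q(x) m ↦ (q(r + ∂) γ) m` on `R[x] ⊗ M`. -/
def coefEval (r : R) : Polynomial R ⊗[F] A →ₗ[Polynomial R]
    Polynomial R ⊗[F] M →ₗ[F] Polynomial R ⊗[F] M where
  toFun γ := TensorProduct.lift <| LinearMap.mk₂ F
    (fun q m => coefProd (shiftEval F A r q γ) (const F (Polynomial R) m))
    (fun p q m => by rw [map_add, LinearMap.add_apply, map_add, LinearMap.add_apply])
    (fun c p m => by
      rw [← algebraMap_smul R c p, map_smul, algebraMap_smul, LinearMap.smul_apply,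
        LinearMap.map_smul_of_tower, LinearMap.smul_apply])
    (fun p m n => by rw [const, TensorProduct.tmul_add, map_add]; rfl)
    (fun c p m => by rw [const, TensorProduct.tmul_smul, LinearMap.map_smul_of_tower]; rfl)
  map_add' γ δ := TensorProduct.ext' fun q m => by simp
  map_smul' c γ := TensorProduct.ext' fun q m => by simp

theorem coefEval_tmul (r : R) (γ : Polynomial R ⊗[F] A) (q : Polynomial R) (m : M) :
    coefEval M r γ (q ⊗ₜ m) = coefProd (shiftEval F A r q γ) (const F (Polynomial R) m) := rfl

theorem coefEval_smul (r b : R) (γ : Polynomial R ⊗[F] A) (P : Polynomial R ⊗[F] M) :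
    coefEval M r γ (Polynomial.C b • P) = Polynomial.C b • coefEval M r γ P := by
  induction P with
  | zero => simp
  | tmul q m =>
    rw [TensorProduct.smul_tmul', smul_eq_mul, coefEval_tmul, coefEval_tmul, shiftEval_C_mul,
      map_smul, LinearMap.smul_apply]
  | add P Q hP hQ => rw [smul_add, map_add, map_add, hP, hQ, smul_add]

/-- Only the powers of `x` in `q` are converted into `r + ∂`; `Q` has coefficients in `R` and
contributes none. -/
theorem coefEval_smul_subst (r : R) (γ : Polynomial R ⊗[F] A) (q : Polynomial R) (Q : R ⊗[F] M) :
    coefEval M r γ (q • substVar F (Polynomial.CAlgHom (R := F)) Q) =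
      coefProd (shiftEval F A r q γ) (substVar F (Polynomial.CAlgHom (R := F)) Q) := by
  induction Q with
  | zero => simp
  | tmul b m =>
    have e1 : (Polynomial.C b : Polynomial R) ⊗ₜ[F] m
        = Polynomial.C b • const F (Polynomial R) m := by
      simp [const, TensorProduct.smul_tmul']
    rw [substVar_tmul, Polynomial.CAlgHom_apply, TensorProduct.smul_tmul', smul_eq_mul,
      coefEval_tmul, mul_comm, shiftEval_C_mul, e1, map_smul, map_smul, LinearMap.smul_apply]
  | add P Q hP hQ => rw [map_add, smul_add, map_add, map_add, hP, hQ]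

/-- As `θ_ℓ ∂ = (ℓ + ∂) θ_ℓ`, passing through `θ_ℓ` moves the base point from `r` to `r + ℓ`. This
is why a variable base point is carried along. -/
theorem evalAt_shiftEval {θ : A →ₗ[F] Polynomial F ⊗[F] A}
    (h : ∀ a, θ (del F A a) = lamDel F A Polynomial.X (θ a)) (ℓ r : R)
    (q : Polynomial R) (γ : Polynomial R ⊗[F] A) :
    evalAt (Polynomial.C ℓ) θ (shiftEval F A r q γ) =
      shiftEval F A (r + ℓ) q (evalAt (Polynomial.C ℓ) θ γ) := by
  induction q using Polynomial.induction_on with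
  | C a => rw [shiftEval_C, shiftEval_C, map_smul]
  | add p q hp hq =>
    rw [map_add, map_add, LinearMap.add_apply, LinearMap.add_apply, map_add, hp, hq]
  | monomial n a hn =>
    rw [pow_succ', mul_left_comm, shiftEval_X_mul, shiftEval_X_mul, evalAt_shiftDel h, hn,
      map_add Polynomial.C, add_comm (Polynomial.C r)]

theorem evalAt_coefEval {f : M →ₗ[F] Polynomial F ⊗[F] M} {θ : A →ₗ[F] Polynomial F ⊗[F] A}
    (hf : ∀ (a : A) (m : M), f (a • m) = coefMul F a (f m) + coefSmul F m (θ a))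
    (h : ∀ a, θ (del F A a) = lamDel F A Polynomial.X (θ a))
    (ℓ r : R) (γ : Polynomial R ⊗[F] A) (P : Polynomial R ⊗[F] M) :
    evalAt (Polynomial.C ℓ) f (coefEval M r γ P) =
      coefEval M r γ (evalAt (Polynomial.C ℓ) f P)
        + coefEval M (r + ℓ) (evalAt (Polynomial.C ℓ) θ γ) P := by
  induction P with
  | zero => simp
  | tmul q m =>
    have e : q ⊗ₜ[F] m = q • const F (Polynomial R) m := by
      simp [const, TensorProduct.smul_tmul']
    have e2 : evalAt (Polynomial.C ℓ) f (const F (Polynomial R) m)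
        = substVar F (Polynomial.CAlgHom (R := F)) (evalAt ℓ f (const F R m)) := by
      rw [substVar_evalAt, substVar_const, Polynomial.CAlgHom_apply]
    rw [coefEval_tmul, evalAt_coefProd hf, evalAt_shiftEval h, coefEval_tmul, e, map_smul, e2,
      coefEval_smul_subst]
  | add P Q hP hQ =>
    rw [map_add, map_add, map_add, map_add, map_add, hP, hQ]
    abel

/-- The substitution `x ↦ x - r` in `τ'` is undone when `x` becomes `r + ∂`, leaving `∂` on `c`.
Thus every base point `r` expresses the same product `(|_{x=∂} c) P(λ + x)`. -/
theorem substVar_shiftMul (s : S →ₐ[F] Polynomial S) (τ : S →ₐ[F] R) (τ' : S →ₐ[F] Polynomial R)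
    (r : R)
    (h : τ' = ((Polynomial.aeval (Polynomial.X - Polynomial.C r)).restrictScalars F).comp
      ((Polynomial.mapAlgHom τ).comp s))
    (c : A) (P : S ⊗[F] M) :
    substVar F ((Polynomial.CAlgHom (R := F)).comp τ) (shiftMul F s c P) =
      coefEval M r (const F (Polynomial R) c) (substVar F τ' P) := by
  induction P with
  | zero => simp
  | add P Q hP hQ => simp only [map_add, hP, hQ]
  | tmul p m =>
    rw [substVar_tmul, h, shiftMul, TensorProduct.lift.tmul, LinearMap.comp_apply,
      AlgHom.toLinearMap_apply, AlgHom.comp_apply, AlgHom.comp_apply]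
    generalize s p = Q
    induction Q using Polynomial.induction_on' with
    | add p q hp hq =>
      rw [map_add, LinearMap.add_apply, map_add, hp, hq, map_add, map_add,
        TensorProduct.add_tmul, map_add]
    | monomial n a =>
      -- Evaluated at `r + ∂`, the polynomial `(x - r)^n` is the operator `∂^n`.
      have key : ∀ n : ℕ, shiftEval F A r ((Polynomial.X - Polynomial.C r) ^ n)
          (const F (Polynomial R) c) = const F (Polynomial R)
            (((DiffAlgebra.der (F := F) (A := A)).toLinearMap ^ n) c) := by
        intro n
        induction n with
        | zero => rw [pow_zero, map_one]; rfl
        | succ n ih =>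
          rw [pow_succ', sub_mul, map_sub, LinearMap.sub_apply, shiftEval_X_mul, shiftEval_C_mul,
            ih, shiftDel_const, add_sub_cancel_left, pow_succ', Module.End.mul_apply]
          rfl
      have e : (Polynomial.aeval (Polynomial.X - Polynomial.C r)).restrictScalars F
          (Polynomial.mapAlgHom τ (Polynomial.monomial n a)) =
          Polynomial.C (τ a) * (Polynomial.X - Polynomial.C r) ^ n := by
        simp [Polynomial.aeval_monomial]
      rw [expandMul_monomial, e, substVar_tmul, coefEval_tmul,
        shiftEval_C_mul, key, map_smul, LinearMap.smul_apply]
      simp [const, coefProd_tmul, TensorProduct.smul_tmul']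

theorem substVar_shiftMul_shiftOne (ℓ r : R) (c : A) (P : Polynomial F ⊗[F] M) :
    substVar F (Polynomial.aeval (Polynomial.C ℓ)) (shiftMul F (shiftOne F) c P) =
      coefEval M r (const F (Polynomial R) c)
        (substVar F (Polynomial.aeval (Polynomial.C (ℓ - r) + Polynomial.X)) P) := by
  have := substVar_shiftMul (shiftOne F) (Polynomial.aeval ℓ)
    (Polynomial.aeval (Polynomial.C (ℓ - r) + Polynomial.X)) r ?_ c P
  · rw [← this]
    congr 2
    ext
    simp
  · refine Polynomial.algHom_ext ?_
    simp [shiftOne]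
    ring

theorem substVar_shiftMul_shiftVar {k : ℕ} (i : Fin k) (ℓ : Fin k → R) (r : R) (c : A)
    (P : PolyMod F M k) :
    substVar F (MvPolynomial.aeval fun j => Polynomial.C (ℓ j)) (shiftMul F (shiftVar F i) c P) =
      coefEval M r (const F (Polynomial R) c)
        (substVar F (MvPolynomial.aeval fun j => Polynomial.C (ℓ j) +
          if j = i then Polynomial.X - Polynomial.C r else 0) P) := by
  have := substVar_shiftMul (shiftVar F i) (MvPolynomial.aeval ℓ)
    (MvPolynomial.aeval fun j => Polynomial.C (ℓ j) +
          if j = i then Polynomial.X - Polynomial.C r else 0) r ?_ c P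
  · rw [← this]
    congr 2
    ext
    simp
  · refine MvPolynomial.algHom_ext fun j => ?_
    by_cases hj : j = i <;> simp [shiftVar, hj]

end CoefEval

/-! ### Compatibility with multiplication by elements of `A`. -/

section Coef

variable {F A E M : Type*} [Field F] [CommRing A] [Algebra F A] [DiffAlgebra F A]
  [AddCommGroup E] [Module F E] [Module A E] [IsScalarTower F A E] [DiffModule F A E]
  [LieConformalAlgebroid F A E]
  [AddCommGroup M] [Module F M] [Module A M] [IsScalarTower F A M] [DiffModule F A M]
  [LCAdModule F A E M]
variable {R : Type*} [CommRing R] [Algebra F R]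

variable (A) in
/-- `φ_ℓ(c u) = (|_{x=∂} c) φ_{ℓ+x}(u)` in the only slot of a `1`-cochain over `R[x]`,
modulo `delRange`. -/
def IsCoefFirst (s : R) (φ : ParamCochain F E M (Polynomial R) 1) : Prop :=
  ∀ (r ℓ : R) (c : A) (e : E) ℓ' u',
    app φ (Polynomial.C ℓ) (c • e) ℓ' u' - coefEval M r (const F (Polynomial R) c)
      (app φ (Polynomial.C (ℓ - r) + Polynomial.X) e ℓ' u') ∈
        delRange F A M (Polynomial.C (s + ℓ))

variable (A) in
/-- `φ_ℓ(c u) = (|_{x=∂} c) φ_{ℓ+x}(u)` in the last slot of a cochain over `R[x]`. -/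
def IsCoefLast : ∀ {k : ℕ}, R → ParamCochain F E M (Polynomial R) k → Prop
  | 0, _, _ => True
  | 1, s, φ => IsCoefFirst A s φ
  | _ + 2, s, φ => ∀ (ℓ : R) u, IsCoefLast (s + ℓ) (app φ (Polynomial.C ℓ) u)

/-- The values of `φ` at parameters in `R` have coefficients in `R`. -/
def IsDefinedOver {k : ℕ} (φ : ParamCochain F E M (Polynomial R) k) : Prop :=
  ∀ (ℓ : Fin k → R) (u : Fin k → E), ∃ Q : R ⊗[F] M,
    φ (fun i => Polynomial.C (ℓ i)) u = substVar F (Polynomial.CAlgHom (R := F)) Q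

theorem IsDefinedOver.app {k : ℕ} {φ : ParamCochain F E M (Polynomial R) (k + 1)}
    (h : IsDefinedOver φ) (ℓ : R) (u : E) : IsDefinedOver (app φ (Polynomial.C ℓ) u) := by
  intro ℓ' u'
  obtain ⟨Q, hQ⟩ := h (Fin.cons ℓ ℓ') (Fin.cons u u')
  refine ⟨Q, ?_⟩
  have e : (Fin.cons (Polynomial.C ℓ) fun i => Polynomial.C (ℓ' i) : Fin (k + 1) → Polynomial R)
      = fun i => Polynomial.C ((Fin.cons ℓ ℓ' : Fin (k + 1) → R) i) := by
    funext i
    refine Fin.cases ?_ (fun i => ?_) i <;> simp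
  rw [app_apply, ← hQ, e]

theorem IsCoefLast.add : ∀ {k : ℕ} {s : R} {φ ψ : ParamCochain F E M (Polynomial R) k},
    IsCoefLast A s φ → IsCoefLast A s ψ → IsCoefLast A s (φ + ψ)
  | 0, _, _, _, _, _ => trivial
  | 1, _, _, _, h, h' => fun r ℓ c e ℓ' u' => by
    have := Submodule.add_mem _ (h r ℓ c e ℓ' u') (h' r ℓ c e ℓ' u')
    convert this using 1
    rw [app_add, app_add, ParamCochain.add_apply, ParamCochain.add_apply, map_add]
    abel
  | _ + 2, _, _, _, h, h' => fun ℓ u => (h ℓ u).add (h' ℓ u)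

theorem IsCoefLast.smul (b : R) : ∀ {k : ℕ} {s : R} {φ : ParamCochain F E M (Polynomial R) k},
    IsCoefLast A s φ → IsCoefLast A s (Polynomial.C b • φ)
  | 0, _, _, _ => trivial
  | 1, _, _, h => fun r ℓ c e ℓ' u' => by
    have := Submodule.smul_mem _ (Polynomial.C b) (h r ℓ c e ℓ' u')
    rw [smul_sub, ← coefEval_smul] at this
    exact this
  | _ + 2, _, _, h => fun ℓ u => (h ℓ u).smul b

theorem IsCoefLast.sub {k : ℕ} {s : R} {φ ψ : ParamCochain F E M (Polynomial R) k}
    (h : IsCoefLast A s φ) (h' : IsCoefLast A s ψ) : IsCoefLast A s (φ - ψ) := by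
  have := h.add (h'.smul (-1))
  rwa [map_neg, map_one, neg_one_smul, ← sub_eq_add_neg] at this

theorem IsCoefLast.appExt {k : ℕ} {s : R} {φ : ParamCochain F E M (Polynomial R) (k + 2)}
    (h : IsCoefLast A s φ) (ℓ : R) (P : R ⊗[F] E) :
    IsCoefLast A (s + ℓ) (appExt φ (Polynomial.C ℓ)
      (substVar F (Polynomial.CAlgHom (R := F)) P)) := by
  induction P with
  | zero =>
    have := (h ℓ 0)
    rwa [map_zero] at this ⊢
  | tmul p n =>
    simp only [LCAd.appExt, substVar_tmul, LinearMap.liftBaseChange_tmul]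
    exact (h ℓ n).smul p
  | add P Q hP hQ => rw [map_add, map_add]; exact hP.add hQ

/-- Extension in the argument, for the bracket term `c [u_ℓ e]`. Coefficients must lie in `R`, since
`coefEval` is linear over `R` but consumes powers of `x`. -/
theorem IsCoefFirst.appExt_coefProd_const {s : R} {φ : ParamCochain F E M (Polynomial R) 1}
    (h : IsCoefFirst A s φ) (r ℓ : R) (c : A) (P : R ⊗[F] E) (ℓ' : Fin 0 → Polynomial R)
    (u' : Fin 0 → E) :
    appExt φ (Polynomial.C ℓ) (coefProd (const F (Polynomial R) c)
        (substVar F (Polynomial.CAlgHom (R := F)) P)) ℓ' u'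
      - coefEval M r (const F (Polynomial R) c) (appExt φ (Polynomial.C (ℓ - r) + Polynomial.X)
        (substVar F (Polynomial.CAlgHom (R := F)) P) ℓ' u') ∈
          delRange F A M (Polynomial.C (s + ℓ)) := by
  induction P with
  | zero => simp only [map_zero, ParamCochain.zero_apply, sub_zero]; exact Submodule.zero_mem _
  | tmul b e =>
    have := Submodule.smul_mem _ (Polynomial.C b) (h r ℓ c e ℓ' u')
    convert this using 1
    rw [substVar_tmul, const, coefProd_tmul, one_mul, Polynomial.CAlgHom_apply, appExt, appExt,
      LinearMap.liftBaseChange_tmul, LinearMap.liftBaseChange_tmul, ParamCochain.smul_apply,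
      ParamCochain.smul_apply, smul_sub, coefEval_smul]
  | add P Q hP hQ =>
    have := Submodule.add_mem _ hP hQ
    convert this using 1
    simp only [map_add, ParamCochain.add_apply]
    abel

/-- Extension in the multiplier, for the anchor term `θ(u)_ℓ(c) e`. -/
theorem IsCoefFirst.appExt_coefProd {s : R} {φ : ParamCochain F E M (Polynomial R) 1}
    (h : IsCoefFirst A s φ) (r ℓ : R) (γ : R ⊗[F] A) (e : E) (ℓ' : Fin 0 → Polynomial R)
    (u' : Fin 0 → E) :
    appExt φ (Polynomial.C ℓ) (coefProd (substVar F (Polynomial.CAlgHom (R := F)) γ)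
        (const F (Polynomial R) e)) ℓ' u'
      - coefEval M r (substVar F (Polynomial.CAlgHom (R := F)) γ)
        (app φ (Polynomial.C (ℓ - r) + Polynomial.X) e ℓ' u') ∈
          delRange F A M (Polynomial.C (s + ℓ)) := by
  induction γ with
  | zero =>
    simp only [map_zero, LinearMap.zero_apply, ParamCochain.zero_apply, sub_zero]
    exact Submodule.zero_mem _
  | tmul b c =>
    have := Submodule.smul_mem _ (Polynomial.C b) (h r ℓ c e ℓ' u')
    convert this using 1
    have e1 : (Polynomial.C b : Polynomial R) ⊗ₜ[F] c
        = Polynomial.C b • const F (Polynomial R) c := by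
      simp [const, TensorProduct.smul_tmul']
    have e2 : coefProd (const F (Polynomial R) c) (const F (Polynomial R) e)
        = const F (Polynomial R) (c • e) := by
      simp [const, coefProd_tmul]
    rw [substVar_tmul, Polynomial.CAlgHom_apply, e1, map_smul, map_smul, LinearMap.smul_apply,
      LinearMap.smul_apply, e2, map_smul, appExt_const, smul_sub, ParamCochain.smul_apply]
  | add P Q hP hQ =>
    have := Submodule.add_mem _ hP hQ
    convert this using 1
    simp only [map_add, LinearMap.add_apply, ParamCochain.add_apply]
    abel

theorem bracketAt_const_smul (ℓ : R) (u : E) (c : A) (e : E) :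
    bracketAt F A E ℓ u (const F R (c • e)) =
      coefProd (const F R c) (bracketAt F A E ℓ u (const F R e))
        + coefProd (evalAt ℓ (LieConformalAlgebroid.anchor u) (const F R c)) (const F R e) := by
  have e2 : coefProd (const F R c) (const F R e) = const F R (c • e) := by
    simp [const, coefProd_tmul]
  rw [← e2, bracketAt, evalAtHom_apply, evalAt_coefProd (bracket_smul u)]

/-- With one slot left, the Leibniz rule of the action yields an anchor term applied to `φ(e)`, and
the bracket with `c e` yields an anchor term inside `φ`. Both are evaluated at base point `r + ℓ`,
and they cancel modulo the image. -/
theorem IsCoefLast.lieDer (ℓ : R) (u : E) : ∀ {k : ℕ} {s : R}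
    {φ : ParamCochain F E M (Polynomial R) k}, IsCoefLast A s φ →
    IsCoefLast A (s + ℓ) (lieDer F A M (Polynomial R) (Polynomial.C ℓ) k u φ)
  | 0, _, _, _ => trivial
  | 1, s, φ, h => fun r m c e ℓ' u' => by
    have h1 := evalAt_mem_delRange (action_del (F := F) (A := A) (M := M) u) (Polynomial.C ℓ)
      (h r m c e ℓ' u')
    have h2 := IsCoefFirst.appExt_coefProd_const h r (ℓ + m) c
      (bracketAt F A E ℓ u (const F R e)) ℓ' u'
    -- At base point `r + ℓ` the slot parameter is `(ℓ + m) - (r + ℓ) + x = m - r + x`, the one that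
    -- already occurs in `h1`. This requires the hypothesis for all base points at once.
    have h3 := IsCoefFirst.appExt_coefProd h (r + ℓ) (ℓ + m)
      (evalAt ℓ (LieConformalAlgebroid.anchor u) (const F R c)) e ℓ' u'
    rw [map_sub, evalAt_coefEval (action_smul (A := A) (M := M) u) (anchor_del u),
      ← map_add, show ℓ + (s + m) = s + (ℓ + m) by ring] at h1
    rw [bracketAt, evalAtHom_apply, substVar_evalAt, substVar_const, Polynomial.CAlgHom_apply]
      at h2
    rw [substVar_evalAt, substVar_const, Polynomial.CAlgHom_apply,
      show ℓ + m - (r + ℓ) = m - r by ring] at h3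
    have := Submodule.sub_mem _ (Submodule.sub_mem _ h1 h2) h3
    rw [show s + ℓ + m = s + (ℓ + m) by ring]
    convert this using 1
    rw [app_lieDer, app_lieDer, ParamCochain.sub_apply, ParamCochain.sub_apply, lieDer_zero,
      lieDer_zero, bracketAt_const_smul, map_add (LCAd.appExt _ _), ParamCochain.add_apply, map_sub,
      map_add Polynomial.C ℓ m, ← add_assoc (Polynomial.C ℓ), ← map_add Polynomial.C ℓ (m - r),
      show ℓ + m - r = ℓ + (m - r) by ring]
    simp only [actionAt, bracketAt, evalAtHom_apply]
    abel
  | k + 2, s, φ, h => fun m v => by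
    rw [app_lieDer]
    have h1 := IsCoefLast.lieDer ℓ u (h m v)
    have h2 := h.appExt (ℓ + m) (bracketAt F A E ℓ u (const F R v))
    rw [add_right_comm] at h1
    rw [bracketAt, evalAtHom_apply, substVar_evalAt, substVar_const, Polynomial.CAlgHom_apply,
      map_add, ← add_assoc] at h2
    exact h1.sub h2

theorem actionAt_smul (ℓ r : R) (c : A) (e : E) (Q : R ⊗[F] M) :
    actionAt F A M (Polynomial.C ℓ) (c • e) (substVar F (Polynomial.CAlgHom (R := F)) Q) =
      coefEval M r (const F (Polynomial R) c)
        (actionAt F A M (Polynomial.C (ℓ - r) + Polynomial.X) e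
          (substVar F (Polynomial.CAlgHom (R := F)) Q)) := by
  induction Q with
  | zero => simp
  | tmul b m =>
    rw [substVar_tmul, actionAt, actionAt, evalAtHom_apply, evalAtHom_apply, evalAt_tmul,
      evalAt_tmul, smul_action, substVar_shiftMul_shiftOne ℓ r, Polynomial.CAlgHom_apply,
      coefEval_smul]
  | add P Q hP hQ => simp only [map_add, hP, hQ]

/-- The base case is the module axiom for `(c e)_λ`. It needs the value acted on to be free of `x`,
because `coefEval` would also replace those occurrences of `x`; `IsDefinedOver` guarantees this. -/
theorem IsCoefLast.leibnizD : ∀ {k : ℕ} {s : R} {φ : ParamCochain F E M (Polynomial R) k},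
    IsCoefLast A s φ → IsDefinedOver φ → IsCoefLast A s (leibnizD F A E M (Polynomial R) k φ)
  | 0, s, φ, _, h => fun r ℓ c e ℓ' u' => by
    obtain ⟨Q, hQ⟩ := h Fin.elim0 u'
    rw [app_leibnizD_zero, app_leibnizD_zero, lieDer_zero, lieDer_zero,
      Subsingleton.elim ℓ' fun i => Polynomial.C (Fin.elim0 i), hQ, ← actionAt_smul, sub_self]
    exact Submodule.zero_mem _
  | 1, s, φ, h, h' => fun ℓ u => by
    rw [app_leibnizD]
    exact (IsCoefLast.lieDer ℓ u h).sub (IsCoefLast.leibnizD (k := 0) trivial (h'.app ℓ u))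
  | k + 2, s, φ, h, h' => fun ℓ u => by
    rw [app_leibnizD]
    exact (IsCoefLast.lieDer ℓ u h).sub (IsCoefLast.leibnizD (h ℓ u) (h'.app ℓ u))

end Coef

/-! ### Agreement of the Leibniz differential with the Chevalley–Eilenberg formula. -/

section ChevalleyEilenberg

variable {F A E M : Type*} [Field F] [CommRing A] [Algebra F A] [DiffAlgebra F A]
  [AddCommGroup E] [Module F E] [Module A E] [IsScalarTower F A E] [DiffModule F A E]
  [LieConformalAlgebroid F A E]
  [AddCommGroup M] [Module F M] [Module A M] [IsScalarTower F A M] [DiffModule F A M]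
  [LCAdModule F A E M]
variable {R : Type*} [CommRing R] [Algebra F R]

variable (A) in
/-- The action terms of the Chevalley–Eilenberg formula. -/
def paramActionSum {k : ℕ} (φ : ParamCochain F E M R k) (ℓ : Fin (k + 1) → R)
    (u : Fin (k + 1) → E) : R ⊗[F] M :=
  ∑ i : Fin (k + 1), (-1 : ℤ) ^ (i : ℕ) •
    actionAt F A M (ℓ i) (u i) (φ (fun l => ℓ (i.succAbove l)) fun l => u (i.succAbove l))

variable (A) in
/-- The bracket terms of the Chevalley–Eilenberg formula. -/
def paramBracketSum : ∀ {k : ℕ}, ParamCochain F E M R k → (Fin (k + 1) → R) →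
    (Fin (k + 1) → E) → R ⊗[F] M
  | 0, _, _, _ => 0
  | n + 1, φ, ℓ, u => ∑ j : Fin (n + 2), ∑ i : Fin (n + 1),
      if i.castSucc < j then
        (-1 : ℤ) ^ ((i : ℕ) + (j : ℕ)) •
          appExt φ (ℓ i.castSucc + ℓ j)
            (bracketAt F A E (ℓ i.castSucc) (u i.castSucc) (const F R (u j)))
            (fun l => ℓ (j.succAbove (i.succAbove l))) fun l => u (j.succAbove (i.succAbove l))
      else 0

theorem cons_comp_succ_succAbove {α : Type*} {k : ℕ} (a : α) (f : Fin (k + 1) → α)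
    (j : Fin (k + 1)) :
    (fun l => (Fin.cons a f : Fin (k + 2) → α) (j.succ.succAbove l)) =
      Fin.cons a fun l => f (j.succAbove l) := by
  funext l
  refine Fin.cases ?_ (fun l => ?_) l <;> simp

theorem cons_comp_succ_succAbove_succ {α : Type*} {k : ℕ} (a : α) (f : Fin (k + 2) → α)
    (j : Fin (k + 2)) (i : Fin (k + 1)) :
    (fun l => (Fin.cons a f : Fin (k + 3) → α) (j.succ.succAbove (i.succ.succAbove l))) =
      Fin.cons a fun l => f (j.succAbove (i.succAbove l)) := by
  rw [← cons_comp_succ_succAbove a (fun l => f (j.succAbove l)) i, ← cons_comp_succ_succAbove a f j]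

theorem cons_comp_zero_succAbove {α : Type*} {k : ℕ} (a : α) (f : Fin k → α) :
    (fun l => (Fin.cons a f : Fin (k + 1) → α) ((0 : Fin (k + 1)).succAbove l)) = f := by
  funext l
  simp

/-- The recursion leaves the bracket in slot `j`; moving it to the front past `j` arguments gives
the sign `(-1)^j`, up to null terms. -/
theorem lieDer_sub_sum_mem (ℓ : R) (u : E) : ∀ {k : ℕ} {s : R} {φ : ParamCochain F E M R (k + 1)},
    IsSkew A s φ → ∀ (ℓ' : Fin (k + 1) → R) (u' : Fin (k + 1) → E),
    lieDer F A M R ℓ (k + 1) u φ ℓ' u' - (actionAt F A M ℓ u (φ ℓ' u')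
      - ∑ j : Fin (k + 1), (-1 : ℤ) ^ (j : ℕ) •
          appExt φ (ℓ + ℓ' j) (bracketAt F A E ℓ u (const F R (u' j)))
            (fun l => ℓ' (j.succAbove l)) fun l => u' (j.succAbove l)) ∈
        delRange F A M (s + ℓ + ∑ i, ℓ' i)
  | 0, s, φ, h, ℓ', u' => by
    have e : lieDer F A M R ℓ 1 u φ ℓ' u' = actionAt F A M ℓ u (φ ℓ' u')
        - appExt φ (ℓ + ℓ' 0) (bracketAt F A E ℓ u (const F R (u' 0)))
            (fun l => ℓ' ((0 : Fin 1).succAbove l)) fun l => u' ((0 : Fin 1).succAbove l) := by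
      rw [apply_eq_app, app_lieDer, ParamCochain.sub_apply, lieDer_zero, ← apply_eq_app]
      rfl
    rw [e, Fin.sum_univ_one]
    simp
  | k + 1, s, φ, h, ℓ', u' => by
    obtain ⟨m, ℓ', rfl⟩ : ∃ m ℓ'', ℓ' = Fin.cons m ℓ'' := ⟨_, _, (Fin.cons_self_tail ℓ').symm⟩
    obtain ⟨v, u', rfl⟩ : ∃ m ℓ'', u' = Fin.cons m ℓ'' := ⟨_, _, (Fin.cons_self_tail u').symm⟩
    have ih := lieDer_sub_sum_mem ℓ u (h.app m v) ℓ' u'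
    have hs : ∑ j : Fin (k + 1), (-1 : ℤ) ^ (j : ℕ) •
        ((app (appExt φ (ℓ + ℓ' j) (bracketAt F A E ℓ u (const F R (u' j)))) m v
          + appExt (app φ m v) (ℓ + ℓ' j) (bracketAt F A E ℓ u (const F R (u' j))))
            (fun l => ℓ' (j.succAbove l)) fun l => u' (j.succAbove l)) ∈
        delRange F A M (s + m + ℓ + ∑ i, ℓ' i) := by
      refine Submodule.sum_mem _ fun j _ => Submodule.smul_of_tower_mem _ _ ?_
      have := h.app_appExt_add (ℓ + ℓ' j) (bracketAt F A E ℓ u (const F R (u' j))) m v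
        (fun l => ℓ' (j.succAbove l)) fun l => u' (j.succAbove l)
      -- The bracket carries `ℓ + ℓ' j` and slot `j` is removed, so the total parameter is
      -- unchanged.
      rw [Fin.sum_univ_succAbove _ j]
      convert this using 2
      ring
    have := Submodule.sub_mem _ ih hs
    rw [Fin.sum_cons, show s + ℓ + (m + ∑ i, ℓ' i) = s + m + ℓ + ∑ i, ℓ' i by ring]
    convert this using 1
    rw [← app_apply, app_lieDer, ParamCochain.sub_apply, app_apply, Fin.sum_univ_succ]
    simp only [cons_comp_succ_succAbove, cons_comp_zero_succAbove, Fin.cons_zero, Fin.cons_succ,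
      ParamCochain.add_apply, app_apply, smul_add, Finset.sum_add_distrib, Fin.val_zero, pow_zero,
      one_smul, Fin.val_succ, pow_succ, mul_neg_one, neg_smul, Finset.sum_neg_distrib]
    abel

theorem paramActionSum_cons {k : ℕ} (φ : ParamCochain F E M R (k + 1)) (m : R)
    (ℓ : Fin (k + 1) → R) (v : E) (u : Fin (k + 1) → E) :
    paramActionSum A φ (Fin.cons m ℓ) (Fin.cons v u) =
      actionAt F A M m v (φ ℓ u) - paramActionSum A (app φ m v) ℓ u := by
  rw [paramActionSum, Fin.sum_univ_succ, paramActionSum]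
  simp only [cons_comp_succ_succAbove, cons_comp_zero_succAbove, Fin.cons_zero, Fin.cons_succ,
    app_apply, Fin.val_zero, pow_zero, one_smul, Fin.val_succ, pow_succ, mul_neg_one, neg_smul,
    Finset.sum_neg_distrib]
  abel

/-- Pairs containing the first index give the single sum of brackets with `v`. In all other pairs
the bracket stands in front of `v`, and exchanging the two produces minus the bracket sum of the
contraction. -/
theorem paramBracketSum_cons : ∀ {k : ℕ} {s : R} {φ : ParamCochain F E M R (k + 1)},
    IsSkew A s φ → ∀ (m : R) (ℓ : Fin (k + 1) → R) (v : E) (u : Fin (k + 1) → E),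
    paramBracketSum A φ (Fin.cons m ℓ) (Fin.cons v u) -
      (- (∑ j : Fin (k + 1), (-1 : ℤ) ^ (j : ℕ) •
          appExt φ (m + ℓ j) (bracketAt F A E m v (const F R (u j)))
            (fun l => ℓ (j.succAbove l)) fun l => u (j.succAbove l))
          - paramBracketSum A (app φ m v) ℓ u) ∈ delRange F A M (s + m + ∑ i, ℓ i)
  | 0, s, φ, h, m, ℓ, v, u => by
    have : paramBracketSum A φ (Fin.cons m ℓ) (Fin.cons v u) -
      (- (∑ j : Fin 1, (-1 : ℤ) ^ (j : ℕ) •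
          appExt φ (m + ℓ j) (bracketAt F A E m v (const F R (u j)))
            (fun l => ℓ (j.succAbove l)) fun l => u (j.succAbove l))
          - paramBracketSum A (app φ m v) ℓ u) = 0 := by
      simp [paramBracketSum, Fin.sum_univ_succ]
    rw [this]
    exact Submodule.zero_mem _
  | k + 1, s, φ, h, m, ℓ, v, u => by
    have hs : ∑ j : Fin (k + 2), ∑ i : Fin (k + 1), (if i.castSucc < j then
        (-1 : ℤ) ^ ((i : ℕ) + (j : ℕ)) •
          ((app (appExt φ (ℓ i.castSucc + ℓ j)
              (bracketAt F A E (ℓ i.castSucc) (u i.castSucc) (const F R (u j)))) m v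
            + appExt (app φ m v) (ℓ i.castSucc + ℓ j)
              (bracketAt F A E (ℓ i.castSucc) (u i.castSucc) (const F R (u j))))
            (fun l => ℓ (j.succAbove (i.succAbove l)))
            fun l => u (j.succAbove (i.succAbove l))) else 0) ∈
        delRange F A M (s + m + ∑ i, ℓ i) := by
      refine Submodule.sum_mem _ fun j _ => Submodule.sum_mem _ fun i _ => ?_
      split_ifs with hij
      · refine Submodule.smul_of_tower_mem _ _ ?_
        have := h.app_appExt_add (ℓ i.castSucc + ℓ j)
          (bracketAt F A E (ℓ i.castSucc) (u i.castSucc) (const F R (u j))) m v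
          (fun l => ℓ (j.succAbove (i.succAbove l)))
          fun l => u (j.succAbove (i.succAbove l))
        rw [Fin.sum_univ_succAbove _ j, Fin.sum_univ_succAbove _ i,
          Fin.succAbove_of_castSucc_lt _ _ hij]
        convert this using 2
        ring
      · exact Submodule.zero_mem _
    -- There is no `i < 0`, so the larger index can be written as a successor. The first summand is
    -- `i = 0`, with sign `(-1)^{j+1}`; for a successor `i` both indices shift and the sign is
    -- unchanged.
    have e1 : paramBracketSum A φ (Fin.cons m ℓ) (Fin.cons v u) = ∑ j : Fin (k + 2),
        (-((-1 : ℤ) ^ (j : ℕ) • appExt φ (m + ℓ j) (bracketAt F A E m v (const F R (u j)))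
            (fun l => ℓ (j.succAbove l)) fun l => u (j.succAbove l))
          + ∑ i : Fin (k + 1), if i.castSucc < j then (-1 : ℤ) ^ ((i : ℕ) + (j : ℕ)) •
            app (appExt φ (ℓ i.castSucc + ℓ j)
              (bracketAt F A E (ℓ i.castSucc) (u i.castSucc) (const F R (u j)))) m v
              (fun l => ℓ (j.succAbove (i.succAbove l)))
              (fun l => u (j.succAbove (i.succAbove l))) else 0) := by
      rw [paramBracketSum, Fin.sum_univ_succ,
        Finset.sum_eq_zero fun i _ => if_neg (Fin.not_lt_zero _), zero_add]
      refine Finset.sum_congr rfl fun j _ => ?_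
      rw [Fin.sum_univ_succ]
      congr 1
      · rw [if_pos (by simp)]
        simp [pow_succ]
      · refine Finset.sum_congr rfl fun i _ => if_congr ?_ ?_ rfl
        · rw [Fin.castSucc_succ, Fin.succ_lt_succ_iff]
        · rw [cons_comp_succ_succAbove_succ, cons_comp_succ_succAbove_succ, app_apply,
            Fin.castSucc_succ, Fin.cons_succ, Fin.cons_succ, Fin.cons_succ,
            Fin.cons_succ, Fin.val_succ, Fin.val_succ, add_add_add_comm, pow_add _ _ (1 + 1)]
          norm_num
    convert hs using 1
    rw [e1, paramBracketSum, Finset.sum_add_distrib, Finset.sum_neg_distrib, sub_sub_eq_add_sub,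
      sub_neg_eq_add]
    simp only [ParamCochain.add_apply, smul_add, ite_add_zero, Finset.sum_add_distrib]
    abel

variable (A) in
-- Both sides satisfy the same recursion modulo the image: contracting with the first argument gives
-- the Lie derivative, expanded by `lieDer_sub_sum_mem`, minus the formula in lower arity.
theorem leibnizD_sub_mem : ∀ {k : ℕ} {s : R} {φ : ParamCochain F E M R k}, IsSkew A s φ →
    ∀ (ℓ : Fin (k + 1) → R) (u : Fin (k + 1) → E),
    leibnizD F A E M R k φ ℓ u - (paramActionSum A φ ℓ u + paramBracketSum A φ ℓ u) ∈
      delRange F A M (s + ∑ i, ℓ i)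
  | 0, s, φ, h, ℓ, u => by
    have : leibnizD F A E M R 0 φ ℓ u
        - (paramActionSum A φ ℓ u + paramBracketSum A φ ℓ u) = 0 := by
      rw [apply_eq_app, app_leibnizD_zero, lieDer_zero, paramActionSum, paramBracketSum,
        Fin.sum_univ_one]
      simp [Fin.tail_def]
    rw [this]
    exact Submodule.zero_mem _
  | k + 1, s, φ, h, ℓ, u => by
    obtain ⟨m, ℓ, rfl⟩ : ∃ m ℓ'', ℓ = Fin.cons m ℓ'' := ⟨_, _, (Fin.cons_self_tail ℓ).symm⟩
    obtain ⟨v, u, rfl⟩ : ∃ m ℓ'', u = Fin.cons m ℓ'' := ⟨_, _, (Fin.cons_self_tail u).symm⟩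
    have := Submodule.sub_mem _ (Submodule.sub_mem _ (lieDer_sub_sum_mem m v h ℓ u)
      (leibnizD_sub_mem (h.app m v) ℓ u)) (paramBracketSum_cons h m ℓ v u)
    rw [Fin.sum_cons, ← add_assoc]
    convert this using 1
    rw [← app_apply, app_leibnizD, ParamCochain.sub_apply, paramActionSum_cons]
    abel

end ChevalleyEilenberg

/-! ### From polynomial-valued maps to maps with parameters. -/

section Lift

variable {F A E M : Type*} [Field F] [CommRing A] [Algebra F A] [DiffAlgebra F A]
  [AddCommGroup E] [Module F E] [Module A E] [IsScalarTower F A E] [DiffModule F A E]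
  [LieConformalAlgebroid F A E]
  [AddCommGroup M] [Module F M] [Module A M] [IsScalarTower F A M] [DiffModule F A M]
  [LCAdModule F A E M]
variable {R S : Type*} [CommRing R] [Algebra F R] [CommRing S] [Algebra F S]

variable (R) in
/-- Substitute parameters in `R` for the variables `λ₁, …, λₖ`. -/
def paramLift {k : ℕ} : MultilinearMap F (fun _ : Fin k => E) (PolyMod F M k) →ₗ[F]
    ParamCochain F E M R k where
  toFun Φ ℓ := (substVar F (MvPolynomial.aeval ℓ)).compMultilinearMap Φ
  map_add' Φ Ψ := ParamCochain.ext fun ℓ u =>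
    (substVar F (MvPolynomial.aeval ℓ)).map_add (Φ u) (Ψ u)
  map_smul' c Φ := ParamCochain.ext fun ℓ u =>
    (substVar F (MvPolynomial.aeval ℓ)).map_smul c (Φ u)

theorem paramLift_apply {k : ℕ} (Φ : MultilinearMap F (fun _ : Fin k => E) (PolyMod F M k))
    (ℓ : Fin k → R) (u : Fin k → E) :
    paramLift R Φ ℓ u = substVar F (MvPolynomial.aeval ℓ) (Φ u) := rfl

theorem isBaseChange_paramLift (σ : R →ₐ[F] S) {k : ℕ}
    (Φ : MultilinearMap F (fun _ : Fin k => E) (PolyMod F M k)) :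
    IsBaseChange σ (paramLift R Φ) (paramLift S Φ) := by
  intro ℓ u
  rw [paramLift_apply, paramLift_apply, substVar_substVar]
  congr 2
  ext i
  simp

theorem actionSum_eq {k : ℕ} (Φ : MultilinearMap F (fun _ : Fin k => E) (PolyMod F M k))
    (u : Fin (k + 1) → E) :
    actionSum A Φ u = paramActionSum A (paramLift _ Φ) MvPolynomial.X u := by
  refine Finset.sum_congr rfl fun i _ => ?_
  have : MvPolynomial.rename i.succAbove = MvPolynomial.aeval (R := F)
      fun l => (MvPolynomial.X (i.succAbove l) : MvPolynomial (Fin (k + 1)) F) := by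
    ext l
    simp
  rw [applyAt_eq_evalAt, paramLift_apply, this]
  rfl

theorem extCoef_eq {N N' T : Type*} [AddCommGroup N] [Module F N] [AddCommGroup N'] [Module F N']
    [CommRing T] [Algebra F T] (σ : T →ₐ[F] R) (g : N →ₗ[F] R ⊗[F] N') (Q : T ⊗[F] N) :
    extCoef F σ g Q = g.liftBaseChange R (substVar F σ Q) := by
  induction Q with
  | zero => simp
  | tmul p n => simp [extCoef]
  | add P Q hP hQ => simp only [map_add, hP, hQ]

theorem appExt_apply {k : ℕ} (φ : ParamCochain F E M R (k + 1)) (ℓ : R) (P : R ⊗[F] E)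
    (ℓ' : Fin k → R) (u' : Fin k → E) (g : E →ₗ[F] R ⊗[F] M)
    (hg : ∀ e, g e = φ (Fin.cons ℓ ℓ') (Fin.cons e u')) :
    appExt φ ℓ P ℓ' u' = g.liftBaseChange R P := by
  induction P with
  | zero => simp
  | tmul p n =>
    rw [appExt, LinearMap.liftBaseChange_tmul, LinearMap.liftBaseChange_tmul, hg,
      ParamCochain.smul_apply, app_apply]
  | add P Q hP hQ => rw [map_add, map_add, ParamCochain.add_apply, hP, hQ]

/-- The formula in the statement is the parametric one at the universal parameters, the variables
themselves. -/
theorem bracketSum_eq {k : ℕ} (Φ : MultilinearMap F (fun _ : Fin k => E) (PolyMod F M k))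
    (u : Fin (k + 1) → E) :
    bracketSum A Φ u = paramBracketSum A (paramLift _ Φ) MvPolynomial.X u := by
  cases k with
  | zero => rfl
  | succ n =>
    refine Finset.sum_congr rfl fun j _ => Finset.sum_congr rfl fun i _ => if_congr Iff.rfl ?_ rfl
    rw [extCoef_eq, bracketAt, evalAtHom_apply, evalAt_const]
    congr 1
    exact (appExt_apply _ _ _ _ _ _ fun e => rfl).symm

end Lift

/-! ### Recursive conditions translated into conditions on individual slots. -/

section Flat

variable {F A E M : Type*} [Field F] [CommRing A] [Algebra F A] [DiffAlgebra F A]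
  [AddCommGroup E] [Module F E] [Module A E] [IsScalarTower F A E] [DiffModule F A E]
  [LieConformalAlgebroid F A E]
  [AddCommGroup M] [Module F M] [Module A M] [IsScalarTower F A M] [DiffModule F A M]
  [LCAdModule F A E M]
variable {R : Type*} [CommRing R] [Algebra F R]

theorem cons_comp_swap_succ {α : Type*} {k : ℕ} (a : α) (f : Fin k → α) (i j : Fin k) :
    (Fin.cons a f : Fin (k + 1) → α) ∘ Equiv.swap i.succ j.succ =
      Fin.cons a (f ∘ Equiv.swap i j) := by
  funext l
  refine Fin.cases ?_ (fun l => ?_) l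
  · rw [Function.comp_apply, Equiv.swap_apply_of_ne_of_ne (Fin.succ_ne_zero i).symm
      (Fin.succ_ne_zero j).symm, Fin.cons_zero, Fin.cons_zero]
  · rw [Function.comp_apply, (Fin.succ_injective k).swap_apply, Fin.cons_succ, Fin.cons_succ,
      Function.comp_apply]

theorem cons_cons_comp_swap {α : Type*} {k : ℕ} (a b : α) (f : Fin k → α) :
    (Fin.cons a (Fin.cons b f : Fin (k + 1) → α) : Fin (k + 2) → α) ∘ Equiv.swap 0 1 =
      Fin.cons b (Fin.cons a f : Fin (k + 1) → α) := by
  funext l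
  refine Fin.cases ?_ (fun l => Fin.cases ?_ (fun l => ?_) l) l
  · simp
  · simp
  · rw [Function.comp_apply, Equiv.swap_apply_of_ne_of_ne (Fin.succ_ne_zero _)]
    · rfl
    · rw [← Fin.succ_zero_eq_one]
      exact fun h => Fin.succ_ne_zero _ (Fin.succ_injective _ h)

theorem isSkew_of_swap : ∀ {k : ℕ} {s : R} {φ : ParamCochain F E M R k},
    (∀ i j, i ≠ j → ∀ ℓ u, φ (ℓ ∘ Equiv.swap i j) (u ∘ Equiv.swap i j) + φ ℓ u ∈
      delRange F A M (s + ∑ l, ℓ l)) → IsSkew A s φ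
  | 0, _, _, _ => trivial
  | 1, _, _, _ => trivial
  | k + 2, s, φ, h => by
    refine ⟨fun ℓ u => isSkew_of_swap fun i j hij ℓ' u' => ?_, fun ℓ m u v ℓ' u' => ?_⟩
    · have := h i.succ j.succ (fun e => hij (Fin.succ_injective _ e)) (Fin.cons ℓ ℓ')
        (Fin.cons u u')
      rwa [cons_comp_swap_succ, cons_comp_swap_succ, Fin.sum_cons, ← add_assoc] at this
    · have := h 0 1 (by simp) (Fin.cons ℓ (Fin.cons m ℓ' : Fin (k + 1) → R))
        (Fin.cons u (Fin.cons v u' : Fin (k + 1) → E))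
      rw [cons_cons_comp_swap, cons_cons_comp_swap, Fin.sum_cons, Fin.sum_cons, ← add_assoc,
        ← add_assoc] at this
      convert this using 1
      exact add_comm _ _

theorem IsSkew.swap : ∀ {k : ℕ} {s : R} {φ : ParamCochain F E M R (k + 1)}, IsSkew A s φ →
    ∀ (i : Fin k) ℓ u, φ (ℓ ∘ Equiv.swap i.castSucc i.succ) (u ∘ Equiv.swap i.castSucc i.succ)
      + φ ℓ u ∈ delRange F A M (s + ∑ l, ℓ l)
  | 0, _, _, _, i => i.elim0
  | k + 1, s, φ, h, i => by
    intro ℓ u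
    obtain ⟨a, ℓ, rfl⟩ : ∃ m ℓ'', ℓ = Fin.cons m ℓ'' := ⟨_, _, (Fin.cons_self_tail ℓ).symm⟩
    obtain ⟨x, u, rfl⟩ : ∃ m ℓ'', u = Fin.cons m ℓ'' := ⟨_, _, (Fin.cons_self_tail u).symm⟩
    refine Fin.cases ?_ (fun i => ?_) i
    · obtain ⟨b, ℓ, rfl⟩ : ∃ m ℓ'', ℓ = Fin.cons m ℓ'' := ⟨_, _, (Fin.cons_self_tail ℓ).symm⟩
      obtain ⟨y, u, rfl⟩ : ∃ m ℓ'', u = Fin.cons m ℓ'' := ⟨_, _, (Fin.cons_self_tail u).symm⟩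
      have := h.2 a b x y ℓ u
      rw [Fin.castSucc_zero, Fin.succ_zero_eq_one, cons_cons_comp_swap, cons_cons_comp_swap,
        Fin.sum_cons, Fin.sum_cons, ← add_assoc, ← add_assoc]
      convert this using 1
      exact add_comm _ _
    · have := (h.app a x).swap i ℓ u
      rw [Fin.castSucc_succ, cons_comp_swap_succ, cons_comp_swap_succ, Fin.sum_cons, ← add_assoc]
      exact this

theorem IsSkew.perm {k : ℕ} {s : R} {φ : ParamCochain F E M R (k + 1)} (h : IsSkew A s φ)
    (π : Equiv.Perm (Fin (k + 1))) : ∀ ℓ u,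
    φ (ℓ ∘ π) (u ∘ π) - (Equiv.Perm.sign π : ℤ) • φ ℓ u ∈ delRange F A M (s + ∑ l, ℓ l) := by
  -- Adjacent transpositions generate the symmetric group already as a monoid, so no case for
  -- inverses is needed.
  have hπ : π ∈ Submonoid.closure
      (Set.range fun i : Fin k => Equiv.swap i.castSucc i.succ) := by
    rw [Equiv.Perm.mclosure_swap_castSucc_succ]
    exact Submonoid.mem_top _
  induction hπ using Submonoid.closure_induction with
  | mem π hπ =>
    obtain ⟨i, rfl⟩ := hπ
    intro ℓ u
    have := h.swap i ℓ u
    rw [Equiv.Perm.sign_swap (Fin.castSucc_lt_succ).ne]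
    simpa using this
  | one =>
    intro ℓ u
    simp
  | mul π τ _ _ hπ hτ =>
    intro ℓ u
    have h1 := hτ (ℓ ∘ π) (u ∘ π)
    have h2 := Submodule.smul_of_tower_mem _ (Equiv.Perm.sign τ : ℤ) (hπ ℓ u)
    rw [show ∑ l, (ℓ ∘ π) l = ∑ l, ℓ l from Equiv.sum_comp π ℓ] at h1
    have := Submodule.add_mem _ h1 h2
    convert this using 1
    rw [Equiv.Perm.coe_mul, ← Function.comp_assoc, ← Function.comp_assoc, Equiv.Perm.sign_mul,
      Units.val_mul, mul_comm, smul_sub, mul_smul]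
    abel

theorem isSesq_of_update : ∀ {k : ℕ} {s : R} {φ : ParamCochain F E M R k},
    (∀ i ℓ u, φ ℓ (Function.update u i (del F A (u i))) + ℓ i • φ ℓ u ∈
      delRange F A M (s + ∑ l, ℓ l)) → IsSesq A s φ
  | 0, _, _, _ => trivial
  | k + 1, s, φ, h => by
    refine ⟨fun ℓ u ℓ' u' => ?_, fun ℓ u => isSesq_of_update fun i ℓ' u' => ?_⟩
    · have := h 0 (Fin.cons ℓ ℓ') (Fin.cons u u')
      rwa [Fin.update_cons_zero, Fin.cons_zero, Fin.cons_zero, Fin.sum_cons, ← add_assoc] at this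
    · have := h i.succ (Fin.cons ℓ ℓ') (Fin.cons u u')
      rwa [← Fin.cons_update, Fin.cons_succ, Fin.cons_succ, Fin.sum_cons, ← add_assoc] at this

theorem IsSesqLast.update : ∀ {k : ℕ} {s : R} {φ : ParamCochain F E M R (k + 1)},
    IsSesqLast A s φ → ∀ ℓ u,
    φ ℓ (Function.update u (Fin.last k) (del F A (u (Fin.last k)))) + ℓ (Fin.last k) • φ ℓ u ∈
      delRange F A M (s + ∑ l, ℓ l)
  | 0, s, φ, h => by
    intro ℓ u
    obtain ⟨a, ℓ, rfl⟩ : ∃ m ℓ'', ℓ = Fin.cons m ℓ'' := ⟨_, _, (Fin.cons_self_tail ℓ).symm⟩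
    obtain ⟨x, u, rfl⟩ : ∃ m ℓ'', u = Fin.cons m ℓ'' := ⟨_, _, (Fin.cons_self_tail u).symm⟩
    have := h a x ℓ u
    rw [show Fin.last 0 = 0 from rfl, Fin.update_cons_zero, Fin.cons_zero, Fin.cons_zero,
      Fin.sum_cons, ← add_assoc]
    exact this
  | k + 1, s, φ, h => by
    intro ℓ u
    obtain ⟨a, ℓ, rfl⟩ : ∃ m ℓ'', ℓ = Fin.cons m ℓ'' := ⟨_, _, (Fin.cons_self_tail ℓ).symm⟩
    obtain ⟨x, u, rfl⟩ : ∃ m ℓ'', u = Fin.cons m ℓ'' := ⟨_, _, (Fin.cons_self_tail u).symm⟩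
    have := IsSesqLast.update (h a x) ℓ u
    rw [← Fin.succ_last, ← Fin.cons_update, Fin.cons_succ, Fin.cons_succ, Fin.sum_cons,
      ← add_assoc]
    exact this

variable (A) in
/-- The compatibility with the `A`-module structure in the last slot, in unfolded form. -/
def IsCoefUpdate {k : ℕ} (s : R) (φ : ParamCochain F E M (Polynomial R) (k + 1)) : Prop :=
  ∀ (r : R) (ℓ : Fin (k + 1) → R) (c : A) (u : Fin (k + 1) → E),
    φ (fun j => Polynomial.C (ℓ j)) (Function.update u (Fin.last k) (c • u (Fin.last k)))
      - coefEval M r (const F (Polynomial R) c)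
        (φ (fun j => Polynomial.C (ℓ j) +
          if j = Fin.last k then Polynomial.X - Polynomial.C r else 0) u) ∈
      delRange F A M (Polynomial.C (s + ∑ l, ℓ l))

theorem cons_C {k : ℕ} (a : R) (ℓ : Fin k → R) :
    (fun j => Polynomial.C ((Fin.cons a ℓ : Fin (k + 1) → R) j)) =
      Fin.cons (Polynomial.C a) fun j => Polynomial.C (ℓ j) := by
  funext j
  refine Fin.cases ?_ (fun j => ?_) j <;> simp

theorem cons_C_add {k : ℕ} (r a : R) (ℓ : Fin (k + 1) → R) :
    (fun j => Polynomial.C ((Fin.cons a ℓ : Fin (k + 2) → R) j) +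
        if j = Fin.last (k + 1) then Polynomial.X - Polynomial.C r else 0) =
      Fin.cons (Polynomial.C a) fun j => Polynomial.C (ℓ j) +
        if j = Fin.last k then Polynomial.X - Polynomial.C r else 0 := by
  funext j
  refine Fin.cases ?_ (fun j => ?_) j
  · rw [if_neg (Fin.last_pos).ne]
    simp
  · simp [← Fin.succ_last]

theorem isCoefFirst_iff {s : R} {φ : ParamCochain F E M (Polynomial R) 1} :
    IsCoefFirst A s φ ↔ IsCoefUpdate A s φ := by
  have e : ∀ (r a : R) (ℓ : Fin 0 → R), (fun j => Polynomial.C ((Fin.cons a ℓ : Fin 1 → R) j) +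
        if j = Fin.last 0 then Polynomial.X - Polynomial.C r else 0) =
      Fin.cons (Polynomial.C (a - r) + Polynomial.X) Fin.elim0 := by
    intro r a ℓ
    funext j
    rw [Fin.eq_zero j]
    simp
    ring
  constructor
  · intro h r ℓ c u
    obtain ⟨a, ℓ, rfl⟩ : ∃ m ℓ'', ℓ = Fin.cons m ℓ'' := ⟨_, _, (Fin.cons_self_tail ℓ).symm⟩
    obtain ⟨x, u, rfl⟩ : ∃ m ℓ'', u = Fin.cons m ℓ'' := ⟨_, _, (Fin.cons_self_tail u).symm⟩
    have := h r a c x Fin.elim0 u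
    rw [e, cons_C, Subsingleton.elim (fun j => Polynomial.C (ℓ j)) Fin.elim0,
      show Fin.last 0 = 0 from rfl, Fin.update_cons_zero, Fin.cons_zero, Fin.sum_cons]
    simpa [app_apply] using this
  · intro h r a c x ℓ u
    have := h r (Fin.cons a Fin.elim0) c (Fin.cons x u)
    rw [e, cons_C, Subsingleton.elim (fun j => Polynomial.C _) ℓ,
      show Fin.last 0 = 0 from rfl, Fin.update_cons_zero, Fin.cons_zero, Fin.sum_cons,
      Subsingleton.elim Fin.elim0 ℓ] at this
    simpa [app_apply] using this

/-- Contraction of a first slot leaves the shifted parameter in the last slot, so the recursion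
unwinds to a condition on all arguments at once. -/
theorem isCoefLast_iff : ∀ {k : ℕ} {s : R} {φ : ParamCochain F E M (Polynomial R) (k + 1)},
    IsCoefLast A s φ ↔ IsCoefUpdate A s φ
  | 0, s, φ => isCoefFirst_iff
  | k + 1, s, φ => by
    constructor
    · intro h r ℓ c u
      obtain ⟨a, ℓ, rfl⟩ : ∃ m ℓ'', ℓ = Fin.cons m ℓ'' := ⟨_, _, (Fin.cons_self_tail ℓ).symm⟩
      obtain ⟨x, u, rfl⟩ : ∃ m ℓ'', u = Fin.cons m ℓ'' := ⟨_, _, (Fin.cons_self_tail u).symm⟩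
      have := isCoefLast_iff.1 (h a x) r ℓ c u
      rw [cons_C, cons_C_add, ← Fin.succ_last, ← Fin.cons_update, Fin.cons_succ, Fin.sum_cons,
        ← add_assoc]
      exact this
    · intro h a x
      refine isCoefLast_iff.2 fun r ℓ c u => ?_
      have := h r (Fin.cons a ℓ) c (Fin.cons x u)
      rw [cons_C, cons_C_add, ← Fin.succ_last, ← Fin.cons_update, Fin.cons_succ, Fin.sum_cons,
        ← add_assoc] at this
      exact this

end Flat

theorem prod_ofFn_eq {X : Type*} [Monoid X] : ∀ {k : ℕ} (f : Fin k → X) (i : Fin k),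
    (∀ j, j ≠ i → f j = 1) → (List.ofFn f).prod = f i
  | 0, _, i, _ => i.elim0
  | k + 1, f, i, h => by
    rw [List.ofFn_succ, List.prod_cons]
    induction i using Fin.cases with
    | zero =>
      rw [List.prod_eq_one, mul_one]
      intro x hx
      obtain ⟨j, rfl⟩ := (List.mem_ofFn' _ _).1 hx
      exact h _ (Fin.succ_ne_zero j)
    | succ i =>
      rw [h 0 (Fin.succ_ne_zero i).symm, one_mul]
      exact prod_ofFn_eq _ i fun j hj => h _ fun e => hj (Fin.succ_injective _ e)

/-- Reduces simultaneous sesquilinearity to one slot at a time. Changing the slots successively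
produces the operators in the order of `List.ofFn`, so no commutation between them is used. -/
theorem apply_eq_prod_ofFn {F E Q : Type*} [Field F] [AddCommGroup Q] [Module F Q] : ∀ {k : ℕ}
    (f : (Fin k → E) → Q) (g : Fin k → E → E) (T : Fin k → Module.End F Q),
    (∀ i u, f (Function.update u i (g i (u i))) = T i (f u)) → ∀ u,
    f (fun i => g i (u i)) = (List.ofFn T).prod (f u)
  | 0, f, g, T, _, u => by
    rw [List.ofFn_zero, List.prod_nil, Module.End.one_apply]
    congr 1
    exact Subsingleton.elim _ _
  | k + 1, f, g, T, h, u => by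
    have h0 := h 0 (Fin.cons (u 0) fun i : Fin k => g i.succ (u i.succ))
    rw [Fin.update_cons_zero, Fin.cons_zero] at h0
    have e : (fun i => g i (u i)) = Fin.cons (g 0 (u 0)) fun i : Fin k => g i.succ (u i.succ) := by
      funext i
      refine Fin.cases ?_ (fun i => ?_) i <;> simp
    have ih := apply_eq_prod_ofFn (fun v : Fin k → E => f (Fin.cons (u 0) v)) (fun i => g i.succ)
      (fun i => T i.succ) (fun i v => by
        have := h i.succ (Fin.cons (u 0) v)
        rwa [← Fin.cons_update, Fin.cons_succ] at this) (Fin.tail u)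
    rw [e, h0, List.ofFn_succ, List.prod_cons, Module.End.mul_apply]
    congr 1
    rw [Fin.cons_self_tail] at ih
    exact ih

/-! ### Operators on the quotient and their behaviour under permutations. -/

section Quotient

variable {F A M : Type*} [Field F] [CommRing A] [Algebra F A] [DiffAlgebra F A]
  [AddCommGroup M] [Module F M] [Module A M] [IsScalarTower F A M] [DiffModule F A M]

theorem toQuot_eq_iff {k : ℕ} {P Q : PolyMod F M k} :
    toQuot F A M k P = toQuot F A M k Q ↔
      P - Q ∈ delRange F A M (∑ i : Fin k, (MvPolynomial.X i : MvPolynomial (Fin k) F)) := by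
  rw [toQuot, Submodule.mkQ_apply, Submodule.mkQ_apply, Submodule.Quotient.eq]
  simp only [delRange, LinearMap.mem_range, totalDel, lamDel_eq_shiftDel]

theorem adjQuot_toQuot {k : ℕ} (i : Fin k) (a : Polynomial A) (P : PolyMod F M k) :
    adjQuot F M i a (toQuot F A M k P) =
      toQuot F A M k (adjMul F (shiftVar F i) (MvPolynomial.X i) a P) := rfl

theorem permQuot_toQuot {k : ℕ} (π : Equiv.Perm (Fin k)) (P : PolyMod F M k) :
    permQuot F A M π (toQuot F A M k P) =
      toQuot F A M k (substVar F (MvPolynomial.rename π) P) := rfl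

theorem adjQuot_one {k : ℕ} (i : Fin k) : adjQuot F M i (1 : Polynomial A) = 1 := by
  refine LinearMap.ext fun Q => ?_
  obtain ⟨P, rfl⟩ := Submodule.mkQ_surjective _ Q
  rw [adjQuot_toQuot, ← Polynomial.C_1, adjMul_C, shiftMul_one (shiftVar_coeff_zero i)]
  rfl

theorem adjMul_add {R : Type*} [CommRing R] [Algebra F R] (s : R →ₐ[F] Polynomial R) (ℓ : R)
    (a b : Polynomial A) :
    (adjMul F s ℓ (a + b) : Module.End F (R ⊗[F] M)) = adjMul F s ℓ a + adjMul F s ℓ b := by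
  have hadd : ∀ c d : A, (shiftMul F s (c + d) : Module.End F (R ⊗[F] M)) =
      shiftMul F s c + shiftMul F s d := by
    intro c d
    refine TensorProduct.ext' fun p m => ?_
    simp only [shiftMul, TensorProduct.lift.tmul, LinearMap.comp_apply, LinearMap.add_apply]
    generalize s.toLinearMap p = Q
    induction Q using Polynomial.induction_on' with
    | add p q hp hq => simp only [map_add, LinearMap.add_apply, hp, hq]; abel
    | monomial n q =>
      rw [expandMul_monomial, expandMul_monomial, expandMul_monomial, map_add, add_smul,
        TensorProduct.tmul_add]
  rw [adjMul, adjMul, adjMul, Polynomial.sum_add_index]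
  · intro i
    rw [shiftMul_zero, zero_mul]
  · intro i c d
    rw [hadd, add_mul]

theorem adjQuot_add {k : ℕ} (i : Fin k) (a b : Polynomial A) :
    adjQuot F M i (a + b) = adjQuot F M i a + adjQuot F M i b := by
  refine LinearMap.ext fun Q => ?_
  obtain ⟨P, rfl⟩ := Submodule.mkQ_surjective _ Q
  rw [LinearMap.add_apply, adjQuot_toQuot, adjQuot_toQuot, adjQuot_toQuot, adjMul_add,
    LinearMap.add_apply, map_add]

theorem adjMul_monomial {R : Type*} [CommRing R] [Algebra F R] (s : R →ₐ[F] Polynomial R) (ℓ : R)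
    (n : ℕ) (c : A) (P : R ⊗[F] M) :
    adjMul F s ℓ (Polynomial.monomial n c) P = shiftMul F s c ((-ℓ) ^ n • P) := by
  rw [adjMul, Polynomial.sum_monomial_index _ _ (by rw [shiftMul_zero, zero_mul])]
  rfl

theorem adjQuot_X {k : ℕ} (i : Fin k) (P : PolyMod F M k) :
    adjQuot F M i (Polynomial.X : Polynomial A) (toQuot F A M k P) =
      toQuot F A M k (-((MvPolynomial.X i : MvPolynomial (Fin k) F) • P)) := by
  rw [adjQuot_toQuot, adjMul_X (shiftVar_coeff_zero i)]

theorem adjQuot_C {k : ℕ} (i : Fin k) (c : A) (P : PolyMod F M k) :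
    adjQuot F M i (Polynomial.C c) (toQuot F A M k P) =
      toQuot F A M k (shiftMul F (shiftVar F i) c P) := by
  rw [adjQuot_toQuot, adjMul_C]

theorem adjQuot_monomial_succ {k : ℕ} (i : Fin k) (n : ℕ) (c : A) (Q : QuotMod F A M k) :
    adjQuot F M i (Polynomial.monomial (n + 1) c) Q =
      adjQuot F M i (Polynomial.monomial n c) (adjQuot F M i (Polynomial.X : Polynomial A) Q) := by
  obtain ⟨P, rfl⟩ := Submodule.mkQ_surjective _ Q
  rw [adjQuot_X, adjQuot_toQuot, adjQuot_toQuot, adjMul_monomial, adjMul_monomial, pow_succ,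
    mul_smul, neg_smul]

theorem substVar_expandMul {R S : Type*} [CommRing R] [Algebra F R] [CommRing S] [Algebra F S]
    (σ : R →ₐ[F] S) (c : A) (Q : Polynomial R) (m : M) :
    substVar F σ (expandMul F c Q m) = expandMul F c (Polynomial.mapAlgHom σ Q) m := by
  induction Q using Polynomial.induction_on' with
  | add p q hp hq => simp only [map_add, LinearMap.add_apply, hp, hq]
  | monomial n q =>
    rw [expandMul_monomial, Polynomial.coe_mapAlgHom, Polynomial.map_monomial, expandMul_monomial]
    rfl

/-- Renaming by `π` turns the shift of `λⱼ` into the shift of the variable with index `π j`, and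
leaves the coefficients alone. -/
theorem rename_shiftMul {k : ℕ} (π : Equiv.Perm (Fin k)) (j : Fin k) (c : A) (P : PolyMod F M k) :
    substVar F (MvPolynomial.rename π) (shiftMul F (shiftVar F j) c P) =
      shiftMul F (shiftVar F (π j)) c (substVar F (MvPolynomial.rename π) P) := by
  have e : (Polynomial.mapAlgHom (MvPolynomial.rename π)).comp (shiftVar F j) =
      (shiftVar F (π j)).comp (MvPolynomial.rename π) := by
    refine MvPolynomial.algHom_ext fun i => ?_
    by_cases h : i = j <;> simp [shiftVar, h]
  induction P using TensorProduct.induction_on with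
  | zero => simp
  | add P Q hP hQ => simp only [map_add, hP, hQ]
  | tmul p m =>
    simp only [shiftMul, TensorProduct.lift.tmul, LinearMap.comp_apply, substVar_tmul,
      AlgHom.toLinearMap_apply, substVar_expandMul]
    rw [← AlgHom.comp_apply, e, AlgHom.comp_apply]

theorem permQuot_adjQuot_C {k : ℕ} (π : Equiv.Perm (Fin k)) (j : Fin k) (c : A)
    (Q : QuotMod F A M k) :
    permQuot F A M π (adjQuot F M j (Polynomial.C c) Q) =
      adjQuot F M (π j) (Polynomial.C c) (permQuot F A M π Q) := by
  obtain ⟨P, rfl⟩ := Submodule.mkQ_surjective _ Q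
  rw [adjQuot_C, permQuot_toQuot, permQuot_toQuot, adjQuot_C, rename_shiftMul]

theorem permQuot_adjQuot_X {k : ℕ} (π : Equiv.Perm (Fin k)) (j : Fin k) (Q : QuotMod F A M k) :
    permQuot F A M π (adjQuot F M j (Polynomial.X : Polynomial A) Q) =
      adjQuot F M (π j) (Polynomial.X : Polynomial A) (permQuot F A M π Q) := by
  obtain ⟨P, rfl⟩ := Submodule.mkQ_surjective _ Q
  rw [adjQuot_X, permQuot_toQuot, permQuot_toQuot, adjQuot_X, map_neg, substVar_smul,
    MvPolynomial.rename_X]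

theorem diffOp_one (m : M) : diffOp F (1 : Polynomial A) m = m := by
  rw [← Polynomial.C_1, diffOp_C, one_smul]

theorem diffOp_add (a b : Polynomial A) (m : M) :
    diffOp F (a + b) m = diffOp F a m + diffOp F b m :=
  Polynomial.sum_add_index _ _ _ (fun _ => zero_smul _ _) fun _ _ _ => add_smul _ _ _

theorem diffOp_monomial_succ (n : ℕ) (c : A) (m : M) :
    diffOp F (Polynomial.monomial (n + 1) c) m =
      diffOp F (Polynomial.monomial n c) (del F A m) := by
  rw [diffOp, diffOp, Polynomial.sum_monomial_index _ _ (by rw [zero_smul]),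
    Polynomial.sum_monomial_index _ _ (by rw [zero_smul]), pow_succ, Module.End.mul_apply]

end Quotient

/-! ### Descent to cochains, existence, uniqueness and `d² = 0`. -/

section Cochain

variable {F A E M : Type*} [Field F] [CommRing A] [Algebra F A] [DiffAlgebra F A]
  [AddCommGroup E] [Module F E] [Module A E] [IsScalarTower F A E] [DiffModule F A E]
  [LieConformalAlgebroid F A E]
  [AddCommGroup M] [Module F M] [Module A M] [IsScalarTower F A M] [DiffModule F A M]
  [LCAdModule F A E M]
variable {R : Type*} [CommRing R] [Algebra F R]

/-- Sesquilinearity with the operator `1` in all other slots, where it acts trivially. -/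
theorem Cochain.update_diffOp {k : ℕ} (φ : Cochain F A M E k) (i : Fin k) (a : Polynomial A)
    (u : Fin k → E) :
    φ.1 (Function.update u i (diffOp F a (u i))) = adjQuot F M i a (φ.1 u) := by
  have h := φ.2.1 (Function.update (fun _ => 1) i a) u
  rw [prod_ofFn_eq _ i fun j hj => by rw [Function.update_of_ne hj, adjQuot_one],
    Function.update_self] at h
  rw [← h]
  congr 1
  funext j
  by_cases hj : j = i
  · subst hj
    simp
  · simp [hj, diffOp_one]

theorem isSkew_paramLift {k : ℕ} {φ : Cochain F A M E k}
    {Φ : MultilinearMap F (fun _ : Fin k => E) (PolyMod F M k)}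
    (hΦ : ∀ u, toQuot F A M k (Φ u) = φ.1 u) : IsSkew A 0 (paramLift R Φ) := by
  refine isSkew_of_swap fun i j hij ℓ u => ?_
  have h := φ.2.2 (Equiv.swap i j) u
  rw [Equiv.Perm.sign_swap hij, ← hΦ, ← hΦ, permQuot_toQuot, Units.val_neg, Units.val_one,
    neg_one_smul, ← map_neg, toQuot_eq_iff, sub_neg_eq_add, add_comm] at h
  have := substVar_mem_delRange (MvPolynomial.aeval ℓ) h
  rw [map_add, substVar_substVar, map_sum] at this
  simp only [MvPolynomial.aeval_X] at this
  rw [zero_add, paramLift_apply, paramLift_apply]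
  convert this using 3
  · congr 2
    ext i
    simp

theorem isSesq_paramLift {k : ℕ} {φ : Cochain F A M E k}
    {Φ : MultilinearMap F (fun _ : Fin k => E) (PolyMod F M k)}
    (hΦ : ∀ u, toQuot F A M k (Φ u) = φ.1 u) : IsSesq A 0 (paramLift R Φ) := by
  refine isSesq_of_update fun i ℓ u => ?_
  have h := Cochain.update_diffOp φ i Polynomial.X u
  rw [diffOp_X, ← hΦ, ← hΦ, adjQuot_X, toQuot_eq_iff, sub_neg_eq_add] at h
  have := substVar_mem_delRange (MvPolynomial.aeval ℓ) h
  rw [map_add, substVar_smul, map_sum] at this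
  simp only [MvPolynomial.aeval_X] at this
  rwa [zero_add, paramLift_apply, paramLift_apply]

/-- The defining condition on `φ` is the universal case; by `substVar_shiftMul_shiftVar` it can be
rewritten at any base point `r`. -/
theorem isCoefLast_paramLift {k : ℕ} {φ : Cochain F A M E k}
    {Φ : MultilinearMap F (fun _ : Fin k => E) (PolyMod F M k)}
    (hΦ : ∀ u, toQuot F A M k (Φ u) = φ.1 u) :
    IsCoefLast A (0 : R) (paramLift (Polynomial R) Φ) := by
  cases k with
  | zero => trivial
  | succ k =>
    refine isCoefLast_iff.2 fun r ℓ c u => ?_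
    have h := Cochain.update_diffOp φ (Fin.last k) (Polynomial.C c) u
    rw [diffOp_C, ← hΦ, ← hΦ, adjQuot_C, toQuot_eq_iff] at h
    have := substVar_mem_delRange (MvPolynomial.aeval fun j => Polynomial.C (ℓ j)) h
    rw [map_sub, substVar_shiftMul_shiftVar _ _ r, map_sum] at this
    simp only [MvPolynomial.aeval_X] at this
    rw [zero_add, map_sum]
    exact this

theorem isDefinedOver_paramLift {k : ℕ}
    (Φ : MultilinearMap F (fun _ : Fin k => E) (PolyMod F M k)) :
    IsDefinedOver (R := R) (paramLift (Polynomial R) Φ) := fun ℓ u =>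
  ⟨paramLift R Φ ℓ u, isBaseChange_paramLift (Polynomial.CAlgHom (R := F)) Φ ℓ u⟩

variable (A) in
/-- The Leibniz differential of a multilinear map with values in polynomials. -/
def polyD (k : ℕ) : MultilinearMap F (fun _ : Fin k => E) (PolyMod F M k) →ₗ[F]
    MultilinearMap F (fun _ : Fin (k + 1) => E) (PolyMod F M (k + 1)) :=
  evalParam MvPolynomial.X ∘ₗ
    ((leibnizD F A E M (MvPolynomial (Fin (k + 1)) F) k).restrictScalars F) ∘ₗ paramLift _

theorem polyD_apply {k : ℕ} (Φ : MultilinearMap F (fun _ : Fin k => E) (PolyMod F M k))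
    (u : Fin (k + 1) → E) :
    polyD A k Φ u = leibnizD F A E M _ k (paramLift _ Φ) MvPolynomial.X u := rfl

variable (R) in
-- `polyD` records only the value at the free variables, and naturality recovers all others. This
-- permits iterating `polyD`, hence `polyD_polyD`.
theorem paramLift_polyD {k : ℕ} (Φ : MultilinearMap F (fun _ : Fin k => E) (PolyMod F M k)) :
    paramLift R (polyD A k Φ) = leibnizD F A E M R k (paramLift R Φ) := by
  ext ℓ u
  have e : MvPolynomial.aeval (R := F) ℓ ∘ MvPolynomial.X = ℓ := by
    funext i
    simp
  rw [paramLift_apply, polyD_apply,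
    ← (isBaseChange_paramLift (MvPolynomial.aeval ℓ) Φ).leibnizD, e]

theorem polyD_polyD {k : ℕ} (Φ : MultilinearMap F (fun _ : Fin k => E) (PolyMod F M k)) :
    polyD A (k + 1) (polyD A k Φ) = 0 := by
  ext u
  rw [polyD_apply, paramLift_polyD, leibnizD_leibnizD]
  rfl

theorem paramLift_X {k : ℕ} (Φ : MultilinearMap F (fun _ : Fin k => E) (PolyMod F M k))
    (u : Fin k → E) : paramLift (MvPolynomial (Fin k) F) Φ MvPolynomial.X u = Φ u := by
  rw [paramLift_apply]
  convert substVar_id (Φ u)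
  ext i
  simp

theorem toQuot_polyD_eq {k : ℕ} {φ : Cochain F A M E k}
    {Φ : MultilinearMap F (fun _ : Fin k => E) (PolyMod F M k)}
    (hΦ : ∀ u, toQuot F A M k (Φ u) = φ.1 u) (u : Fin (k + 1) → E) :
    toQuot F A M (k + 1) (polyD A k Φ u) =
      toQuot F A M (k + 1) (actionSum A Φ u + bracketSum A Φ u) := by
  rw [toQuot_eq_iff, actionSum_eq, bracketSum_eq, polyD_apply]
  have := leibnizD_sub_mem A (isSkew_paramLift hΦ)
    (MvPolynomial.X : Fin (k + 1) → MvPolynomial (Fin (k + 1)) F) u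
  rwa [zero_add] at this

/-- The difference of two lifts is a null family, and `d` preserves these. -/
theorem toQuot_polyD_congr {k : ℕ} {Φ Ψ : MultilinearMap F (fun _ : Fin k => E) (PolyMod F M k)}
    (h : ∀ u, toQuot F A M k (Φ u) = toQuot F A M k (Ψ u)) (u : Fin (k + 1) → E) :
    toQuot F A M (k + 1) (polyD A k Φ u) = toQuot F A M (k + 1) (polyD A k Ψ u) := by
  rw [toQuot_eq_iff, polyD_apply, polyD_apply, ← ParamCochain.sub_apply, ← map_sub, ← map_sub]
  have : paramLift (MvPolynomial (Fin (k + 1)) F) (Φ - Ψ) ∈ nullCochain F A E M 0 k := by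
    intro ℓ v
    have := substVar_mem_delRange (MvPolynomial.aeval ℓ) (toQuot_eq_iff.1 (h v))
    rw [map_sum] at this
    simp only [MvPolynomial.aeval_X] at this
    rwa [zero_add, paramLift_apply]
  have := leibnizD_mem_nullCochain k 0 this
    (MvPolynomial.X : Fin (k + 1) → MvPolynomial (Fin (k + 1)) F) u
  rwa [zero_add] at this

variable {k : ℕ} {φ : Cochain F A M E k}
  {Φ : MultilinearMap F (fun _ : Fin k => E) (PolyMod F M k)}

theorem toQuot_polyD_perm (hΦ : ∀ u, toQuot F A M k (Φ u) = φ.1 u)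
    (π : Equiv.Perm (Fin (k + 1))) (u : Fin (k + 1) → E) :
    toQuot F A M (k + 1) (polyD A k Φ u) = (Equiv.Perm.sign π : ℤ) •
      permQuot F A M π (toQuot F A M (k + 1) (polyD A k Φ (u ∘ π))) := by
  have h := ((isSkew_paramLift hΦ).leibnizD (isSesq_paramLift hΦ)).perm π
    (MvPolynomial.X : Fin (k + 1) → MvPolynomial (Fin (k + 1)) F) u
  rw [← paramLift_polyD, paramLift_X, paramLift_apply, zero_add, ← toQuot_eq_iff] at h
  have e : MvPolynomial.rename π = MvPolynomial.aeval (R := F)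
      ((MvPolynomial.X : Fin (k + 1) → MvPolynomial (Fin (k + 1)) F) ∘ π) := by
    ext l
    simp
  rw [permQuot_toQuot, e, h, map_zsmul, ← mul_smul, ← Units.val_mul, Int.units_mul_self,
    Units.val_one, one_smul]

theorem toQuot_polyD_del (hΦ : ∀ u, toQuot F A M k (Φ u) = φ.1 u) (u : Fin (k + 1) → E) :
    toQuot F A M (k + 1) (polyD A k Φ
        (Function.update u (Fin.last k) (diffOp F (Polynomial.X : Polynomial A) (u (Fin.last k))))) =
      adjQuot F M (Fin.last k) (Polynomial.X : Polynomial A) (toQuot F A M (k + 1) (polyD A k Φ u)) := by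
  have h := (isSesq_paramLift hΦ).last.leibnizD.update
    (MvPolynomial.X : Fin (k + 1) → MvPolynomial (Fin (k + 1)) F) u
  rw [← paramLift_polyD, paramLift_X, paramLift_X, zero_add, ← sub_neg_eq_add,
    ← toQuot_eq_iff] at h
  rw [diffOp_X, h, adjQuot_X]

/-- The compatibility over `R[x]` is used at base point `r = 0`, where it reads `x = ∂` literally.
-/
theorem toQuot_polyD_smul (hΦ : ∀ u, toQuot F A M k (Φ u) = φ.1 u) (c : A)
    (u : Fin (k + 1) → E) :
    toQuot F A M (k + 1) (polyD A k Φ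
        (Function.update u (Fin.last k) (diffOp F (Polynomial.C c) (u (Fin.last k))))) =
      adjQuot F M (Fin.last k) (Polynomial.C c) (toQuot F A M (k + 1) (polyD A k Φ u)) := by
  have h := isCoefLast_iff.1 ((isCoefLast_paramLift hΦ).leibnizD (isDefinedOver_paramLift Φ)) 0
    (MvPolynomial.X : Fin (k + 1) → MvPolynomial (Fin (k + 1)) F) c u
  rw [← paramLift_polyD, paramLift_apply, paramLift_apply, ← substVar_shiftMul_shiftVar,
    ← map_sub, zero_add] at h
  -- The compared elements are images of elements over the ring of the `λ`'s, so setting `x = 0`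
  -- returns the relation to that ring unchanged.
  have h2 := substVar_mem_delRange ((Polynomial.aeval
    (0 : MvPolynomial (Fin (k + 1)) F)).restrictScalars F) h
  rw [substVar_substVar, AlgHom.restrictScalars_apply, Polynomial.aeval_C] at h2
  have e : ((Polynomial.aeval (0 : MvPolynomial (Fin (k + 1)) F)).restrictScalars F).comp
      (MvPolynomial.aeval fun j => Polynomial.C
        (MvPolynomial.X j : MvPolynomial (Fin (k + 1)) F)) = AlgHom.id F _ := by
    ext j
    simp
  rw [e, substVar_id] at h2
  rw [diffOp_C, adjQuot_C, toQuot_eq_iff]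
  exact h2

/-- Conjugation by the transposition of slot `i` with the last slot; the sign appears on both sides.
-/
theorem toQuot_polyD_update (hΦ : ∀ u, toQuot F A M k (Φ u) = φ.1 u) {a : Polynomial A}
    (hlast : ∀ u, toQuot F A M (k + 1) (polyD A k Φ
        (Function.update u (Fin.last k) (diffOp F a (u (Fin.last k))))) =
      adjQuot F M (Fin.last k) a (toQuot F A M (k + 1) (polyD A k Φ u)))
    (hperm : ∀ (π : Equiv.Perm (Fin (k + 1))) (j : Fin (k + 1)) (Q : QuotMod F A M (k + 1)),
      permQuot F A M π (adjQuot F M j a Q) = adjQuot F M (π j) a (permQuot F A M π Q))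
    (i : Fin (k + 1)) (u : Fin (k + 1) → E) :
    toQuot F A M (k + 1) (polyD A k Φ (Function.update u i (diffOp F a (u i)))) =
      adjQuot F M i a (toQuot F A M (k + 1) (polyD A k Φ u)) := by
  have e : Function.update u i (diffOp F a (u i)) ∘ Equiv.swap i (Fin.last k) =
      Function.update (u ∘ Equiv.swap i (Fin.last k)) (Fin.last k)
        (diffOp F a ((u ∘ Equiv.swap i (Fin.last k)) (Fin.last k))) := by
    rw [Function.update_comp_equiv, Equiv.symm_swap, Equiv.swap_apply_left, Function.comp_apply,
      Equiv.swap_apply_right]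
  rw [toQuot_polyD_perm hΦ (Equiv.swap i (Fin.last k)), e, hlast, hperm, Equiv.swap_apply_right,
    toQuot_polyD_perm hΦ (Equiv.swap i (Fin.last k)) u, map_zsmul]

/-- Induction on the symbol: sums, then `c ∂^{n+1} = (c ∂^n) ∘ ∂`, reduce everything to `c` and `∂`.
-/
theorem toQuot_polyD_diffOp (hΦ : ∀ u, toQuot F A M k (Φ u) = φ.1 u) (i : Fin (k + 1))
    (a : Polynomial A) (u : Fin (k + 1) → E) :
    toQuot F A M (k + 1) (polyD A k Φ (Function.update u i (diffOp F a (u i)))) =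
      adjQuot F M i a (toQuot F A M (k + 1) (polyD A k Φ u)) := by
  induction a using Polynomial.induction_on' generalizing u with
  | add p q hp hq =>
    rw [diffOp_add, MultilinearMap.map_update_add, map_add, hp, hq, adjQuot_add,
      LinearMap.add_apply]
  | monomial n c =>
    induction n generalizing u with
    | zero =>
      rw [Polynomial.monomial_zero_left]
      exact toQuot_polyD_update hΦ (toQuot_polyD_smul hΦ c)
        (fun π j Q => permQuot_adjQuot_C π j c Q) i u
    | succ n ih =>
      have h := ih (Function.update u i (diffOp F (Polynomial.X : Polynomial A) (u i)))
      rw [Function.update_idem, Function.update_self, toQuot_polyD_update hΦ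
        (toQuot_polyD_del hΦ) (fun π j Q => permQuot_adjQuot_X π j Q), diffOp_X] at h
      rw [diffOp_monomial_succ, adjQuot_monomial_succ, h]

theorem polyD_mem_cochain (hΦ : ∀ u, toQuot F A M k (Φ u) = φ.1 u) :
    (toQuot F A M (k + 1)).compMultilinearMap (polyD A k Φ) ∈ Cochain F A M E (k + 1) :=
  ⟨fun a u => apply_eq_prod_ofFn
      (fun u => toQuot F A M (k + 1) (polyD A k Φ u)) (fun i => diffOp F (a i))
      (fun i => adjQuot F M i (a i)) (fun i u => toQuot_polyD_diffOp hΦ i (a i) u) u,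
    fun π u => toQuot_polyD_perm hΦ π u⟩

variable (F A M) in
-- Surjections of vector spaces split. A section linear on the whole quotient makes the chosen lift
-- linear in the cochain, hence also `cochainD`.
theorem exists_toQuot_section (k : ℕ) :
    ∃ σ : QuotMod F A M k →ₗ[F] PolyMod F M k, toQuot F A M k ∘ₗ σ = LinearMap.id :=
  LinearMap.exists_rightInverse_of_surjective _
    (LinearMap.range_eq_top.2 (Submodule.mkQ_surjective _))

variable (F A M) in
/-- A linear section of the quotient map. -/
def toQuotSection (k : ℕ) : QuotMod F A M k →ₗ[F] PolyMod F M k :=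
  (exists_toQuot_section F A M k).choose

theorem toQuot_toQuotSection (k : ℕ) (Q : QuotMod F A M k) :
    toQuot F A M k (toQuotSection F A M k Q) = Q :=
  LinearMap.congr_fun (exists_toQuot_section F A M k).choose_spec Q

/-- A linear lift of a cochain. -/
def cochainLift (φ : Cochain F A M E k) :
    MultilinearMap F (fun _ : Fin k => E) (PolyMod F M k) :=
  (toQuotSection F A M k).compMultilinearMap φ.1

theorem toQuot_cochainLift (φ : Cochain F A M E k) (u : Fin k → E) :
    toQuot F A M k (cochainLift φ u) = φ.1 u := toQuot_toQuotSection k _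

variable (F A E M) in
/-- The differential of the LCAd cohomology complex. -/
def cochainD (k : ℕ) : Cochain F A M E k →ₗ[F] Cochain F A M E (k + 1) where
  toFun φ := ⟨_, polyD_mem_cochain (toQuot_cochainLift φ)⟩
  map_add' φ ψ := by
    refine Subtype.ext (MultilinearMap.ext fun u => ?_)
    have : cochainLift (φ + ψ) = cochainLift φ + cochainLift ψ :=
      MultilinearMap.ext fun u => (toQuotSection F A M k).map_add (φ.1 u) (ψ.1 u)
    simp [this]
  map_smul' c φ := by
    refine Subtype.ext (MultilinearMap.ext fun u => ?_)
    have : cochainLift (c • φ) = c • cochainLift φ :=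
      MultilinearMap.ext fun u => (toQuotSection F A M k).map_smul c (φ.1 u)
    simp [this]

theorem isCEDifferential_iff (d : Cochain F A M E k →ₗ[F] Cochain F A M E (k + 1)) :
    IsCEDifferential A d ↔
      ∀ (φ : Cochain F A M E k) (Φ : MultilinearMap F (fun _ : Fin k => E) (PolyMod F M k)),
        (∀ u, toQuot F A M k (Φ u) = φ.1 u) →
        ∀ u, (d φ).1 u = toQuot F A M (k + 1) (polyD A k Φ u) := by
  refine forall₂_congr fun φ Φ => forall_congr' fun hΦ => forall_congr' fun u => ?_
  rw [toQuot_polyD_eq hΦ]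

theorem isCEDifferential_cochainD : IsCEDifferential A (cochainD F A E M k) := by
  rw [isCEDifferential_iff]
  intro φ Φ hΦ u
  exact toQuot_polyD_congr (fun v => (toQuot_cochainLift φ v).trans (hΦ v).symm) u

theorem IsCEDifferential.unique {d d' : Cochain F A M E k →ₗ[F] Cochain F A M E (k + 1)}
    (h : IsCEDifferential A d) (h' : IsCEDifferential A d') : d = d' := by
  refine LinearMap.ext fun φ => Subtype.ext (MultilinearMap.ext fun u => ?_)
  rw [h φ _ (toQuot_cochainLift φ), h' φ _ (toQuot_cochainLift φ)]

/-- If `Φ` lifts `φ`, then `polyD A k Φ` lifts `d₀ φ` and may be used to compute `d₁`; applying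
`polyD` to it again gives exactly zero. -/
theorem IsCEDifferential.comp_eq_zero {d₀ : Cochain F A M E k →ₗ[F] Cochain F A M E (k + 1)}
    {d₁ : Cochain F A M E (k + 1) →ₗ[F] Cochain F A M E (k + 2)}
    (h₀ : IsCEDifferential A d₀) (h₁ : IsCEDifferential A d₁) : d₁ ∘ₗ d₀ = 0 := by
  rw [isCEDifferential_iff] at h₀ h₁
  refine LinearMap.ext fun φ => Subtype.ext (MultilinearMap.ext fun u => ?_)
  rw [LinearMap.comp_apply, h₁ _ _ fun v => (h₀ φ _ (toQuot_cochainLift φ) v).symm, polyD_polyD]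
  exact map_zero _

end Cochain

end LCAd

end

theorem mainTheorem4 (F A E M : Type*) [Field F] [CharZero F]
    [CommRing A] [Algebra F A] [LCAd.DiffAlgebra F A]
    [AddCommGroup E] [Module F E] [Module A E] [IsScalarTower F A E] [LCAd.DiffModule F A E]
    [LCAd.LieConformalAlgebroid F A E]
    [AddCommGroup M] [Module F M] [Module A M] [IsScalarTower F A M] [LCAd.DiffModule F A M]
    [LCAd.LCAdModule F A E M] :
    (∀ k : ℕ, ∃! d : LCAd.Cochain F A M E k →ₗ[F] LCAd.Cochain F A M E (k + 1),
      LCAd.IsCEDifferential A d) ∧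
    ∀ (k : ℕ) (d₀ : LCAd.Cochain F A M E k →ₗ[F] LCAd.Cochain F A M E (k + 1))
      (d₁ : LCAd.Cochain F A M E (k + 1) →ₗ[F] LCAd.Cochain F A M E (k + 2)),
      LCAd.IsCEDifferential A d₀ → LCAd.IsCEDifferential A d₁ → d₁ ∘ₗ d₀ = 0 :=
  ⟨fun k => ⟨LCAd.cochainD F A E M k, LCAd.isCEDifferential_cochainD,
    fun _ h => h.unique LCAd.isCEDifferential_cochainD⟩,
    fun _ _ _ h₀ h₁ => h₀.comp_eq_zero h₁⟩
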